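/- **Setting.** Let $h=1/n$ with $n\in\mathbb N$, $n\ge 1$, let $\kappa>0$ be fixed, let $k\ge1$ be an integer, and let $a=a_h\in\mathbb R$ (possibly depending on $h$, of any sign). Write $b=a\kappa^2$ and, in the variables $(\rho,\sigma)\in\mathbb R^2$, $P_0=-(\partial_\rho^2+\partial_\sigma^2)+4\rho^2+\sigma^2$ and $H=\{v\in H^1(\mathbb R^2;\mathbb R):(\rho^2+\sigma^2)^{1/2}v\in L^2(\mathbb R^2)\}$. A *profile* for $(k,b)$ consists of $v_0,v_1,v_2\in H$ and $E_0,E_1,E_2\in\mathbb R$ such that $v_0\ge0$, $\|v_0\|_{L^2}=1$, $v_0$ minimizes $\int\big(|\nabla v|^2+(4\rho^2+\sigma^2)v^2+\tfrac12 b\,v^4\big)$ among $v\in H$ with $\|v\|_{L^2}=1$, and, weakly, $$P_0v_0=E_0v_0-b\,v_0^3,$$ $$P_0v_1=E_0v_1+E_1v_0-3b\,v_0^2v_1+\tfrac1k\partial_\rho v_0+\tfrac4k\rho^3v_0,$$ $$P_0v_2=E_0v_2+E_1v_1+E_2v_0-3b\,(v_0^2v_2+v_0v_1^2)+\tfrac1k\partial_\rho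 v_1+\tfrac4k\rho^3v_1-\tfrac1{k^2}\rho\,\partial_\rho v_0-\tfrac5{k^2}\rho^4v_0 .$$ Let $\chi\in C_0^\infty(\mathbb R)$, $\chi\ge0$, $\operatorname{supp}\chi\subset[-\frac12,\frac12]$, $\chi=1$ on $[-\frac14,\frac14]$. In cylindrical coordinates $x=(r\cos\theta,r\sin\theta,y)$ of $\mathbb R^3$ put $$u_{app}(t,x)=\kappa h^{-1/2}e^{-i\lambda t}e^{i\frac{k^2}{h}\theta}\,v\Big(\frac{r-k}{\sqrt h},\frac{y}{\sqrt h}\Big),\qquad v(\rho,\sigma)=\chi(\sqrt h\rho)\,(v_0+h^{1/2}v_1+hv_2)(\rho,\sigma),$$ $$\lambda=\frac{2k^2}{h}+E_0+h^{1/2}E_1+hE_2 .$$ A *solution* on $[0,T]$ of the equation below is a function $u\in C([0,T];D)$, where $D=\{w\in L^2(\mathbb R^3;\mathbb C):\Delta w\in L^2,\ |x|^2w\in L^2\}$, which is differentiable in time with values in $L^2(\mathbb R^3)$ and satisfies the equation in $L^2(\mathbb R^3)$ at every $t\in[0,T]$. **Statement.** There is a constant $c_0>0$ such that for all $k$ and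 $\chi$ as above and every $M$ there is $\delta>0$ for which the following holds. Let $\kappa>0$, let $|a_h|\kappa^2\le c_0$ for all $h$, let a profile for $(k,a_h\kappa^2)$ with $\|v_1\|_{L^2},\|v_2\|_{L^2}\le M$ be given for each $h$, and let $u_{app}=u_{app,h}$ be the corresponding function. Let $t_h$ satisfy $0\le t_h\le\delta\log\frac1h$ for all small $h$, and for all small $h$ let $u=u_h$ be a solution on $[0,t_h]$ of $$ih\partial_tu+h^2\Delta u-|x|^2u=a_hh^2|u|^2u,\qquad u(0,x)=u_{app}(0,x).$$ Then $$\|(u-u_{app})(t_h)\|_{L^2(\mathbb R^3)}\longrightarrow0\quad\text{as }h=1/n\to0 .$$ (In particular, this holds whenever $t_h\ge 0$ and $t_h=o(\log\frac1h)$.) -/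

import Mathlib

open MeasureTheory Filter Topology
open scoped ContDiff SchwartzMap Laplacian LineDeriv

noncomputable section

namespace GrossPitaevskii

/-- The physical space `ℝ³`, with coordinates `x = (x₁, x₂, x₃)`. -/
abbrev Space := EuclideanSpace ℝ (Fin 3)

/-- The plane `ℝ²` of rescaled variables `ξ = (ρ, σ)`. -/
abbrev Plane := EuclideanSpace ℝ (Fin 2)

/-! ### Strong solutions of the Gross-Pitaevskii equation -/

/-- `u ∈ C([0,T]; D(H))`, where `D(H) = {w ∈ L²(ℝ³) : Δw ∈ L², |x|²w ∈ L²}` is the domain of the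
harmonic oscillator, `u` is differentiable in time with values in `L²(ℝ³)`, and
`i h ∂ₜu + h² Δu - |x|² u = a h² |u|² u` on `[0,T]`.
Here `lap t`, `pot t`, `dt t` are the `L²` functions `Δu(t)` (in the sense of tempered
distributions), `|x|²u(t)` and `∂ₜu(t)`. -/
def IsStrongSolution (h a T : ℝ) (u : ℝ → Lp ℂ 2 (volume : Measure Space)) : Prop :=
  ∃ lap pot dt : ℝ → Lp ℂ 2 (volume : Measure Space),
    ContinuousOn u (Set.Icc 0 T) ∧
    ContinuousOn lap (Set.Icc 0 T) ∧
    ContinuousOn pot (Set.Icc 0 T) ∧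
    ∀ t ∈ Set.Icc 0 T,
      (Δ (u t : 𝓢'(Space, ℂ)) = (lap t : 𝓢'(Space, ℂ))) ∧
      (∀ᵐ x : Space, pot t x = ((‖x‖ ^ 2 : ℝ) : ℂ) * u t x) ∧
      HasDerivWithinAt u (dt t) (Set.Icc 0 T) t ∧
      ∀ᵐ x : Space,
        Complex.I * (h : ℂ) * dt t x + (h : ℂ) ^ 2 * lap t x - pot t x
          = (a : ℂ) * (h : ℂ) ^ 2 * ((‖u t x‖ ^ 2 : ℝ) : ℂ) * u t x

/-! ### The profiles in the rescaled variables -/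

/-- Smooth compactly supported real test functions on the plane. -/
def IsTest (φ : Plane → ℝ) : Prop := ContDiff ℝ ∞ φ ∧ HasCompactSupport φ

/-- The partial derivative `∂ᵢ φ` (`i = 0` for `∂_ρ`, `i = 1` for `∂_σ`). -/
def pderiv (i : Fin 2) (φ : Plane → ℝ) (ξ : Plane) : ℝ :=
  fderiv ℝ φ ξ (EuclideanSpace.single i 1)

/-- The harmonic potential `4ρ² + σ²`. -/
def potential (ξ : Plane) : ℝ := 4 * ξ 0 ^ 2 + ξ 1 ^ 2

/-- `v ∈ H¹(ℝ²)` with `|ξ| v ∈ L²(ℝ²)`, and `dv = (∂_ρ v, ∂_σ v)` is its weak gradient. -/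
structure InFormDomain (v : Plane → ℝ) (dv : Fin 2 → Plane → ℝ) : Prop where
  memLp : MemLp v 2 volume
  grad_memLp : ∀ i, MemLp (dv i) 2 volume
  moment_memLp : MemLp (fun ξ => ‖ξ‖ * v ξ) 2 volume
  weak_grad : ∀ i, ∀ φ : Plane → ℝ, IsTest φ →
    ∫ ξ, v ξ * pderiv i φ ξ = - ∫ ξ, dv i ξ * φ ξ

/-- The functional `∫ |∇v|² + (4ρ² + σ²) v² + ½ b v⁴`. -/
def energy (b : ℝ) (v : Plane → ℝ) (dv : Fin 2 → Plane → ℝ) : ℝ :=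
  ∫ ξ, (dv 0 ξ ^ 2 + dv 1 ξ ^ 2 + potential ξ * v ξ ^ 2 + 1 / 2 * b * v ξ ^ 4)

/-- `v`, with weak gradient `dv`, is a weak solution of `P₀ v = F`, where
`P₀ = -(∂_ρ² + ∂_σ²) + (4ρ² + σ²)`. -/
def SolvesP0 (v : Plane → ℝ) (dv : Fin 2 → Plane → ℝ) (F : Plane → ℝ) : Prop :=
  ∀ φ : Plane → ℝ, IsTest φ →
    ∫ ξ, (dv 0 ξ * pderiv 0 φ ξ + dv 1 ξ * pderiv 1 φ ξ + potential ξ * v ξ * φ ξ)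
      = ∫ ξ, F ξ * φ ξ

/-- The profiles `v₀, v₁, v₂` and the coefficients `E₀, E₁, E₂` of the quasimode concentrating on
the circle of radius `k`, for the coupling constant `b = a κ²`; `dv j` is the weak gradient of
`v j`. -/
structure Profile (k : ℕ) (b : ℝ) where
  v : Fin 3 → Plane → ℝ
  dv : Fin 3 → Fin 2 → Plane → ℝ
  E : Fin 3 → ℝ
  mem : ∀ j, InFormDomain (v j) (dv j)
  v0_nonneg : ∀ᵐ ξ, 0 ≤ v 0 ξ
  v0_norm : ∫ ξ, v 0 ξ ^ 2 = 1
  v0_min : ∀ w dw, InFormDomain w dw → ∫ ξ, w ξ ^ 2 = 1 →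
    energy b (v 0) (dv 0) ≤ energy b w dw
  eq0 : SolvesP0 (v 0) (dv 0) fun ξ => E 0 * v 0 ξ - b * v 0 ξ ^ 3
  eq1 : SolvesP0 (v 1) (dv 1) fun ξ =>
    E 0 * v 1 ξ + E 1 * v 0 ξ - 3 * b * (v 0 ξ ^ 2 * v 1 ξ)
      + 1 / k * dv 0 0 ξ + 4 / k * ξ 0 ^ 3 * v 0 ξ
  eq2 : SolvesP0 (v 2) (dv 2) fun ξ =>
    E 0 * v 2 ξ + E 1 * v 1 ξ + E 2 * v 0 ξ
      - 3 * b * (v 0 ξ ^ 2 * v 2 ξ + v 0 ξ * v 1 ξ ^ 2)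
      + 1 / k * dv 1 0 ξ + 4 / k * ξ 0 ^ 3 * v 1 ξ
      - 1 / (k : ℝ) ^ 2 * ξ 0 * dv 0 0 ξ - 5 / (k : ℝ) ^ 2 * ξ 0 ^ 4 * v 0 ξ

/-! ### The approximate solution -/

/-- A smooth cutoff around `0`. It is applied to `√h ρ = r - k`, the signed distance to the
circle radius. -/
structure IsCutoff (χ : ℝ → ℝ) : Prop where
  smooth : ContDiff ℝ ∞ χ
  nonneg : ∀ s, 0 ≤ χ s
  support : tsupport χ ⊆ Set.Icc (-(1 / 2)) (1 / 2)
  eq_one : ∀ s ∈ Set.Icc (-(1 / 4) : ℝ) (1 / 4), χ s = 1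

variable {k : ℕ} {b : ℝ}

/-- `v = χ(√h ρ) (v₀ + h^{1/2} v₁ + h v₂)`. -/
def truncatedProfile (χ : ℝ → ℝ) (p : Profile k b) (h : ℝ) (ξ : Plane) : ℝ :=
  χ (√h * ξ 0) * (p.v 0 ξ + √h * p.v 1 ξ + h * p.v 2 ξ)

/-- `λ = 2k²/h + E₀ + h^{1/2} E₁ + h E₂`. -/
def frequency (p : Profile k b) (h : ℝ) : ℝ :=
  2 * (k : ℝ) ^ 2 / h + p.E 0 + √h * p.E 1 + h * p.E 2

/-- The cylindrical radius `r`. -/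
def radius (x : Space) : ℝ := √(x 0 ^ 2 + x 1 ^ 2)

/-- The cylindrical angle `θ`. -/
def angle (x : Space) : ℝ := Complex.arg ⟨x 0, x 1⟩

/-- `u_app(t,x) = κ h^{-1/2} e^{-iλt} e^{i k²θ/h} v((r-k)/√h, x₃/√h)`. -/
def uApp (κ : ℝ) (χ : ℝ → ℝ) (p : Profile k b) (h t : ℝ) (x : Space) : ℂ :=
  ((κ / √h : ℝ) : ℂ)
    * Complex.exp (-Complex.I * (frequency p h * t : ℝ))
    * Complex.exp (Complex.I * ((k : ℝ) ^ 2 / h * angle x : ℝ))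
    * ((truncatedProfile χ p h !₂[(radius x - k) / √h, x 2 / √h] : ℝ) : ℂ)

end GrossPitaevskii

end

/-! Write `ε = √h`, `b = aκ²`, `Λ = hλ`. Multiplying by `κ⁻¹ e^{iλt}` turns `u_app` into a
time-independent function `U` and `u` into a solution `v` of `ih v' = Hv + bh²|v|²v`, `v(0) = U`,
with `H = -h²Δ + |x|² - Λ`. The claim becomes that `U` is a nearly stationary state from which `v`
does not move away on the given time interval. There are three ingredients.

Quasimode. Since `h = 1/n`, the angular frequency `m = k²/h` is an integer, so `e^{imθ}` is
single-valued. On `e^{imθ}P(r, y)` the operator `H` acts with effective radial potential `k⁴/r² + r²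
- 2k² = (r - k²/r)²`, which for `r = k + ερ` equals `4ε²ρ² - 4ε³ρ³/k + 5ε⁴ρ⁴/k²` up to order `ε⁵`.
The three profile equations cancel the first three orders, and `Profile.residual_eq` leaves a
pointwise residual `ε⁴` times a fixed combination of profiles, powers of `ρ` and cutoffs. The tube
contributes a further `ε²` to squared norms, so the residual `R` has `‖R‖² = O(h⁵)`
(`BoundedProfiles.exists_residual`).

Uniformity. The constants may depend only on `k`, `χ` and `M`, so all profile bounds are proved for
arbitrary families. For small `|b|` the Gagliardo-Nirenberg inequality bounds the energy of the
minimizer. Testing the profile equations bounds the multipliers `E_j`, and a weighted energy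
estimate (`exists_weighted_step`) gives decay of every polynomial order. Polynomial decay suffices
to make the cutoff errors small, because the derivatives of `χ` and the difference `χ - χ³` vanish
near zero. The Sobolev embedding bounds the profiles in sup norm, whence `|U|² = O(1/h)`.

Stability. Let `w = v - U`, `A = ‖w‖²`, `Y = h²‖∇w‖²`, `Q = ∫|w|⁴`. In the time derivative of `A`
the self-adjoint part drops out; the nonlinear term has coefficient `bh²|U|² = O(h)`, so `|A'| ≤ K(A
+ ‖R‖√A/h + hQ)`, a growth rate of order one. This is the source of the logarithmic time scale. The
term `Q` is controlled by conservation of energy: expanding the energy around `U` gives `Y ≤ K(A +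
‖R‖√A + h²Q)`, while Gagliardo-Nirenberg in dimension three gives `Q²h⁶ ≤ KAY³`. As long as `Y ≤
h²`, these combine to `|A'| ≤ L(A + h³)`, so `A ≤ h³e^{Lt} ≤ h^{5/2}` for `t ≤ (2L)⁻¹ log(1/h)`.
Then `Y` is also `O(h^{5/2})`, and the assumption `Y ≤ h²` propagates (`bootstrap`). Undoing the
rotation gives `‖u - u_app‖ ≤ κh`. -/

noncomputable section

namespace GrossPitaevskii

/-! ### Density of compactly supported functions among Schwartz functions -/

section Cutoff

variable {E : Type*} [NormedAddCommGroup E] [InnerProductSpace ℝ E] [FiniteDimensional ℝ E]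

/-- A fixed smooth bump function at the origin. -/
def bump (E : Type*) [NormedAddCommGroup E] [InnerProductSpace ℝ E] [FiniteDimensional ℝ E] :
    ContDiffBump (0 : E) := ⟨1, 2, one_pos, one_lt_two⟩

/-- The cutoff function equal to one on the ball of radius `n + 1`. -/
def cutoff (n : ℕ) (x : E) : ℝ := bump E ((n + 1 : ℝ)⁻¹ • x)

theorem contDiff_cutoff (n : ℕ) : ContDiff ℝ ∞ (cutoff n : E → ℝ) :=
  (bump E).contDiff.comp (contDiff_const_smul _)

theorem hasCompactSupport_cutoff (n : ℕ) : HasCompactSupport (cutoff n : E → ℝ) :=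
  (bump E).hasCompactSupport.comp_smul (inv_ne_zero (by positivity))

theorem cutoff_nonneg (n : ℕ) (x : E) : 0 ≤ cutoff n x := (bump E).nonneg

theorem cutoff_le_one (n : ℕ) (x : E) : cutoff n x ≤ 1 := (bump E).le_one

theorem cutoff_eq_one {n : ℕ} {x : E} (hx : ‖x‖ ≤ n + 1) : cutoff n x = 1 := by
  refine (bump E).one_of_mem_closedBall ?_
  have hn : (0 : ℝ) < n + 1 := by positivity
  have : ‖(n + 1 : ℝ)⁻¹ • x‖ ≤ 1 := by
    rw [norm_smul, norm_inv, Real.norm_of_nonneg hn.le, inv_mul_le_iff₀ hn]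
    simpa using hx
  simpa [bump] using this

/-- All cutoffs are one bump composed with a dilation of norm at most one, which can only decrease
derivatives; hence the constant does not depend on `n`. -/
theorem exists_norm_iteratedFDeriv_cutoff_le (i : ℕ) :
    ∃ C : ℝ, 0 ≤ C ∧ ∀ (n : ℕ) (x : E), ‖iteratedFDeriv ℝ i (cutoff n : E → ℝ) x‖ ≤ C := by
  let ζ : 𝓢(E, ℝ) := (bump E).hasCompactSupport.toSchwartzMap (bump E).contDiff
  refine ⟨SchwartzMap.seminorm ℝ 0 i ζ, apply_nonneg _ _, fun n x => ?_⟩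
  let g : E →L[ℝ] E := ((n + 1 : ℝ)⁻¹) • ContinuousLinearMap.id ℝ E
  have hg : ‖g‖ ≤ 1 := by
    refine (norm_smul_le (n + 1 : ℝ)⁻¹ (ContinuousLinearMap.id ℝ E)).trans ?_
    have h1 : ‖((n : ℝ) + 1)⁻¹‖ ≤ 1 := by
      rw [norm_inv, Real.norm_of_nonneg (by positivity)]
      exact inv_le_one_of_one_le₀ (by simp)
    exact mul_le_one₀ h1 (norm_nonneg _) (ContinuousLinearMap.norm_id_le)
  have hc : (cutoff n : E → ℝ) = (bump E) ∘ g := rfl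
  rw [hc, g.iteratedFDeriv_comp_right (bump E).contDiff x (i := i) (by exact_mod_cast le_top)]
  refine (ContinuousMultilinearMap.norm_compContinuousLinearMap_le _ _).trans ?_
  have h2 : ‖iteratedFDeriv ℝ i (bump E) (g x)‖ ≤ SchwartzMap.seminorm ℝ 0 i ζ :=
    ζ.norm_iteratedFDeriv_le_seminorm ℝ i (g x)
  refine (mul_le_mul h2 (Finset.prod_le_one (fun _ _ => norm_nonneg _) fun _ _ => hg)
    (Finset.prod_nonneg fun _ _ => norm_nonneg _) (apply_nonneg _ _)).trans (by simp)

/-- The product of a Schwartz function with a cutoff function. -/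
def cutSchwartz (n : ℕ) (φ : 𝓢(E, ℝ)) : 𝓢(E, ℝ) :=
  HasCompactSupport.toSchwartzMap (f := fun x => cutoff n x * φ x)
    (hasCompactSupport_cutoff n).mul_right ((contDiff_cutoff n).mul (φ.smooth ⊤))

theorem cutSchwartz_apply (n : ℕ) (φ : 𝓢(E, ℝ)) (x : E) :
    cutSchwartz n φ x = cutoff n x * φ x := rfl

theorem hasCompactSupport_cutSchwartz (n : ℕ) (φ : 𝓢(E, ℝ)) :
    HasCompactSupport (cutSchwartz n φ) := (hasCompactSupport_cutoff n).mul_right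

/-- The factor `cutoff n - 1` vanishes for `‖x‖ < n + 1`, and elsewhere `‖x‖ ^ k ≤ ‖x‖ ^ (k + 1) /
(n + 1)`. One extra power of the weight thus buys a factor `1 / (n + 1)` in every seminorm. -/
theorem tendsto_cutSchwartz (φ : 𝓢(E, ℝ)) :
    Tendsto (fun n => cutSchwartz n φ) atTop (𝓝 φ) := by
  rw [(schwartz_withSeminorms ℝ E ℝ).tendsto_nhds]
  rintro ⟨k, N⟩ ε hε
  choose C hC0 hC using exists_norm_iteratedFDeriv_cutoff_le (E := E)
  let K : ℝ := ∑ i ∈ Finset.range (N + 1),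
    (N.choose i : ℝ) * (C i + 1) * SchwartzMap.seminorm ℝ (k + 1) (N - i) φ
  have hK : 0 ≤ K := Finset.sum_nonneg fun i _ =>
    mul_nonneg (mul_nonneg (Nat.cast_nonneg _) (by linarith [hC0 i])) (apply_nonneg _ _)
  have key : ∀ n : ℕ, SchwartzMap.seminorm ℝ k N (cutSchwartz n φ - φ) ≤ K / (n + 1) := by
    intro n
    have hn : (0 : ℝ) < n + 1 := by positivity
    refine SchwartzMap.seminorm_le_bound ℝ k N _ (by positivity) fun x => ?_
    have hfun : ((cutSchwartz n φ - φ : 𝓢(E, ℝ)) : E → ℝ) =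
        fun y => (cutoff n y - 1) * φ y := by
      ext y
      simp [cutSchwartz_apply]
      ring
    rw [hfun]
    rcases lt_or_ge ‖x‖ (n + 1) with hx | hx
    · have h0 : (fun y : E => (cutoff n y - 1) * φ y) =ᶠ[𝓝 x] fun _ => 0 := by
        filter_upwards [(isOpen_lt continuous_norm continuous_const).mem_nhds hx] with y hy
        rw [cutoff_eq_one (le_of_lt hy)]
        simp
      rw [(h0.iteratedFDeriv ℝ N).self_of_nhds]
      have : iteratedFDeriv ℝ N (fun _ : E => (0 : ℝ)) x = 0 := by
        simp
      rw [this]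
      simp
      positivity
    · have h1 := norm_iteratedFDeriv_mul_le (𝕜 := ℝ) (N := ∞) (f := fun y : E => cutoff n y - 1)
        (g := φ) ((contDiff_cutoff n).sub contDiff_const) (φ.smooth ⊤) x (n := N)
        (by exact_mod_cast le_top)
      have h2 : ∀ i, ‖iteratedFDeriv ℝ i (fun y : E => cutoff n y - 1) x‖ ≤ C i + 1 := by
        intro i
        have h3 : iteratedFDeriv ℝ i (fun y : E => cutoff n y - 1) x
            = iteratedFDeriv ℝ i (cutoff n) x - iteratedFDeriv ℝ i (fun _ => (1 : ℝ)) x := by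
          exact iteratedFDeriv_sub_apply
            ((contDiff_cutoff n).contDiffAt.of_le (by exact_mod_cast le_top)) contDiffAt_const
        rw [h3]
        refine (norm_sub_le _ _).trans (add_le_add (hC i n x) ?_)
        rcases eq_or_ne i 0 with rfl | hi
        · simp
        · rw [iteratedFDeriv_const_of_ne hi]
          simp
      calc ‖x‖ ^ k * ‖iteratedFDeriv ℝ N (fun y => (cutoff n y - 1) * φ y) x‖
          ≤ (‖x‖ ^ (k + 1) / (n + 1)) * ∑ i ∈ Finset.range (N + 1), (N.choose i : ℝ) *
            ‖iteratedFDeriv ℝ i (fun y : E => cutoff n y - 1) x‖ *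
            ‖iteratedFDeriv ℝ (N - i) φ x‖ := by
            refine mul_le_mul ?_ h1 (norm_nonneg _) (by positivity)
            rw [le_div_iff₀ hn, pow_succ]
            gcongr
        _ = (∑ i ∈ Finset.range (N + 1), (N.choose i : ℝ) *
            ‖iteratedFDeriv ℝ i (fun y : E => cutoff n y - 1) x‖ *
            (‖x‖ ^ (k + 1) * ‖iteratedFDeriv ℝ (N - i) φ x‖)) / (n + 1) := by
            rw [div_mul_eq_mul_div, Finset.mul_sum]
            congr 1
            exact Finset.sum_congr rfl fun i _ => by ring
        _ ≤ K / (n + 1) := by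
            refine div_le_div_of_nonneg_right (Finset.sum_le_sum fun i _ => ?_) hn.le
            refine mul_le_mul (mul_le_mul_of_nonneg_left (h2 i) (Nat.cast_nonneg _))
              (φ.le_seminorm ℝ (k + 1) (N - i) x) (by positivity) ?_
            exact mul_nonneg (Nat.cast_nonneg _) (by linarith [hC0 i])
  have hlim : Tendsto (fun n : ℕ => K / ((n : ℝ) + 1)) atTop (𝓝 0) :=
    tendsto_const_div_atTop_nhds_zero_nat K |>.comp (tendsto_add_atTop_nat 1) |>.congr
      fun n => by simp
  filter_upwards [hlim.eventually (gt_mem_nhds hε)] with n hn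
  exact (key n).trans_lt hn

end Cutoff

/-! ### Weak derivatives in `L²` -/

theorem schwartz_laplacian_postcomp {E : Type*} [NormedAddCommGroup E] [InnerProductSpace ℝ E]
    [FiniteDimensional ℝ E] (L : ℂ →L[ℝ] ℝ) (Φ : 𝓢(E, ℂ)) (x : E) :
    L (Δ Φ x) = Δ (SchwartzMap.postcompCLM L Φ) x := by
  rw [SchwartzMap.laplacian_apply, SchwartzMap.laplacian_apply]
  have h := ContDiffAt.laplacian_CLM_comp_left (l := L) (f := (Φ : E → ℂ)) (x := x)
    ((Φ.smooth 2).contDiffAt)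
  exact h.symm

section WeakDerivatives

variable {E : Type*} [NormedAddCommGroup E] [InnerProductSpace ℝ E] [FiniteDimensional ℝ E]
  [MeasurableSpace E] [BorelSpace E]

/-- The constant `(2π)⁻²` for which the symbol of `1 - c Δ` is `1 + |ξ|²`. -/
def besselConst : ℝ := ((2 * Real.pi) ^ 2)⁻¹

theorem besselConst_pos : 0 < besselConst := by unfold besselConst; positivity

/-- The hypothesis says `(1 - cΔ) z = 0` in the sense of distributions. With `c = (2π)⁻²` this
operator is the Bessel potential of order two, which is invertible on tempered distributions, and
`L²` embeds into these. This uniqueness is the source of all the density statements below. -/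
theorem toLp_eq_zero_of_forall_integral (z : Lp ℝ 2 (volume : Measure E))
    (hz : ∀ φ : 𝓢(E, ℝ), ∫ x, z x * φ x = besselConst * ∫ x, z x * Δ φ x) : z = 0 := by
  let Z : Lp ℂ 2 (volume : Measure E) := Complex.ofRealCLM.compLp z
  have hZ : ∀ᵐ x, Z x = (z x : ℂ) := Complex.ofRealCLM.coeFn_compLp z
  have hint : ∀ φ : 𝓢(E, ℝ), Integrable fun x => z x * φ x := fun φ =>
    (Lp.memLp z).integrable_mul (φ.memLp 2)
  -- The hypothesis concerns real test functions only, so a complex one is split into its real and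
  -- imaginary parts.
  have hT : ∀ Φ : 𝓢(E, ℂ), (Z : 𝓢'(E, ℂ)) Φ =
      (∫ x, z x * SchwartzMap.postcompCLM Complex.reCLM Φ x : ℝ) +
      (∫ x, z x * SchwartzMap.postcompCLM Complex.imCLM Φ x : ℝ) * Complex.I := by
    intro Φ
    rw [Lp.toTemperedDistribution_apply, ← integral_complex_ofReal, ← integral_complex_ofReal,
      ← integral_mul_const, ← integral_add]
    · refine integral_congr_ae ?_
      filter_upwards [hZ] with x hx
      rw [hx, smul_eq_mul, SchwartzMap.postcompCLM_apply, SchwartzMap.postcompCLM_apply,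
        Complex.reCLM_apply, Complex.imCLM_apply]
      push_cast
      linear_combination (-(z x : ℂ)) * Complex.re_add_im (Φ x)
    · exact (hint _).ofReal
    · exact (hint _).ofReal.mul_const _
  have hΔ : (Z : 𝓢'(E, ℂ)) = besselConst • Δ (Z : 𝓢'(E, ℂ)) := by
    ext Φ
    have e1 : (besselConst • Δ (Z : 𝓢'(E, ℂ))) Φ = (besselConst : ℂ) * (Z : 𝓢'(E, ℂ)) (Δ Φ) := by
      rw [← TemperedDistribution.laplacian_apply_apply]
      simp
    rw [e1, hT (Δ Φ), hT Φ, hz (SchwartzMap.postcompCLM Complex.reCLM Φ),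
      hz (SchwartzMap.postcompCLM Complex.imCLM Φ)]
    have h1 : ∀ x, SchwartzMap.postcompCLM Complex.reCLM (Δ Φ) x =
        Δ (SchwartzMap.postcompCLM Complex.reCLM Φ) x := fun x => by
      rw [← schwartz_laplacian_postcomp]; simp
    have h2 : ∀ x, SchwartzMap.postcompCLM Complex.imCLM (Δ Φ) x =
        Δ (SchwartzMap.postcompCLM Complex.imCLM Φ) x := fun x => by
      rw [← schwartz_laplacian_postcomp]; simp
    simp only [h1, h2]
    push_cast
    ring
  have hB : TemperedDistribution.besselPotential E ℂ 2 (Z : 𝓢'(E, ℂ)) = 0 := by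
    -- The symbol is written as a sum of two terms indexed by `Bool`, to which additivity of Fourier
    -- multipliers applies.
    have e : (fun x : E => (((1 + ‖x‖ ^ 2) ^ ((2 : ℝ) / 2) : ℝ) : ℂ)) =
        fun x => ∑ i : Bool, (if i then (fun _ : E => (1 : ℂ)) else
          fun x : E => Complex.ofReal (‖x‖ ^ 2)) x := by
      ext x
      simp
    rw [TemperedDistribution.besselPotential, e,
      TemperedDistribution.fourierMultiplierCLM_sum ℂ
        (g := fun i : Bool => if i then (fun _ : E => (1 : ℂ)) else
          fun x : E => Complex.ofReal (‖x‖ ^ 2)) (s := Finset.univ)]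
    · have h3 := TemperedDistribution.laplacian_eq_fourierMultiplierCLM (Z : 𝓢'(E, ℂ))
      rw [h3] at hΔ
      simp
      nth_rewrite 1 [hΔ]
      rw [smul_smul]
      have : besselConst * -(2 * Real.pi) ^ 2 = -1 := by
        unfold besselConst
        field_simp
      rw [this]
      simp
    · rintro (_ | _) _
      · change Function.HasTemperateGrowth fun x : E => Complex.ofReal (‖x‖ ^ 2)
        fun_prop
      · change Function.HasTemperateGrowth fun _ : E => (1 : ℂ)
        fun_prop
  have hZ0 : (Z : 𝓢'(E, ℂ)) = 0 := by
    have := TemperedDistribution.besselPotential_besselPotential_apply 2 (-2) (Z : 𝓢'(E, ℂ))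
    rw [hB] at this
    simpa using this.symm
  have hZ1 : Z ∈ (Lp.toTemperedDistributionCLM ℂ (volume : Measure E) 2).ker := by
    rw [LinearMap.mem_ker]
    exact hZ0
  rw [Lp.ker_toTemperedDistributionCLM_eq_bot] at hZ1
  have hZ2 : Z = 0 := by simpa using hZ1
  rw [Lp.eq_zero_iff_ae_eq_zero]
  have := (Lp.eq_zero_iff_ae_eq_zero).1 hZ2
  filter_upwards [hZ, this] with x h1 h2
  rw [h1] at h2
  simpa using h2

end WeakDerivatives

/-! ### Weak Laplacians and gradients in `L²`, and their approximation by Schwartz functions -/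

/-- The Euclidean space `ℝᵈ`. -/
abbrev Eu (d : ℕ) := EuclideanSpace ℝ (Fin d)

/-- The space `L²(ℝᵈ)` of real functions. -/
abbrev LL (d : ℕ) := Lp ℝ 2 (volume : Measure (Eu d))

variable {d : ℕ}

/-- The `i`-th unit vector. -/
def ev (i : Fin d) : Eu d := EuclideanSpace.single i 1

/-- The class in `L²` of a Schwartz function. -/
def sL : 𝓢(Eu d, ℝ) →L[ℝ] LL d := SchwartzMap.toLpCLM ℝ ℝ 2 volume

/-- The `i`-th partial derivative on Schwartz functions. -/
def sD (i : Fin d) : 𝓢(Eu d, ℝ) →L[ℝ] 𝓢(Eu d, ℝ) := LineDeriv.lineDerivOpCLM ℝ _ (ev i)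

/-- The Laplacian on Schwartz functions. -/
def sΔ : 𝓢(Eu d, ℝ) →L[ℝ] 𝓢(Eu d, ℝ) := LineDeriv.laplacianCLM ℝ (Eu d) 𝓢(Eu d, ℝ)

theorem sΔ_eq (φ : 𝓢(Eu d, ℝ)) : sΔ φ = Δ φ := SchwartzMap.laplacianCLM_eq' φ

theorem coeFn_sL (φ : 𝓢(Eu d, ℝ)) : sL φ =ᵐ[volume] φ := SchwartzMap.coeFn_toLp φ 2 volume

theorem sD_apply (i : Fin d) (φ : 𝓢(Eu d, ℝ)) (x : Eu d) : sD i φ x = fderiv ℝ φ x (ev i) := rfl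

theorem sΔ_eq_sum (φ : 𝓢(Eu d, ℝ)) : sΔ φ = ∑ i, sD i (sD i φ) := by
  rw [sΔ_eq, SchwartzMap.laplacian_eq_sum (EuclideanSpace.basisFun (Fin d) ℝ)]
  simp [sD, ev]

theorem inner_eq_integral (f g : LL d) : inner ℝ f g = ∫ x, f x * g x := by
  rw [L2.inner_def]
  simp [mul_comm]

theorem inner_sL (f : LL d) (φ : 𝓢(Eu d, ℝ)) : inner ℝ f (sL φ) = ∫ x, f x * φ x := by
  rw [inner_eq_integral]
  refine integral_congr_ae ?_
  filter_upwards [coeFn_sL φ] with x hx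
  rw [hx]

theorem inner_sL_sL (ψ φ : 𝓢(Eu d, ℝ)) : inner ℝ (sL ψ) (sL φ) = ∫ x, ψ x * φ x := by
  rw [inner_sL]
  refine integral_congr_ae ?_
  filter_upwards [coeFn_sL ψ] with x hx
  rw [hx]

theorem inner_sL_sD (ψ φ : 𝓢(Eu d, ℝ)) (i : Fin d) :
    inner ℝ (sL ψ) (sL (sD i φ)) = - inner ℝ (sL (sD i ψ)) (sL φ) := by
  rw [inner_sL_sL, inner_sL_sL]
  exact SchwartzMap.integral_mul_lineDerivOp_right_eq_neg_left ψ φ (ev i)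

theorem inner_sL_sΔ (ψ φ : 𝓢(Eu d, ℝ)) :
    inner ℝ (sL ψ) (sL (sΔ φ)) = - ∑ i, inner ℝ (sL (sD i ψ)) (sL (sD i φ)) := by
  rw [sΔ_eq_sum, map_sum, inner_sum, ← Finset.sum_neg_distrib]
  exact Finset.sum_congr rfl fun i _ => inner_sL_sD _ _ _

theorem inner_sL_sΔ_self (φ : 𝓢(Eu d, ℝ)) :
    inner ℝ (sL φ) (sL (sΔ φ)) = - ∑ i, ‖sL (sD i φ)‖ ^ 2 := by
  rw [inner_sL_sΔ]
  simp

theorem denseRange_sL : DenseRange (sL : 𝓢(Eu d, ℝ) → LL d) :=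
  SchwartzMap.denseRange_toLpCLM (by simp)

theorem eq_of_forall_inner_sL {f g : LL d} (h : ∀ φ, inner ℝ f (sL φ) = inner ℝ g (sL φ)) :
    f = g := by
  have h1 : ∀ v : LL d, inner ℝ f v = inner ℝ g v := fun v =>
    denseRange_sL.induction_on (p := fun v => inner ℝ f v = inner ℝ g v) v
      (isClosed_eq (by fun_prop) (by fun_prop)) h
  exact ext_inner_right ℝ h1

/-- `Δ f = g` in the weak sense. -/
def WeakLap (f g : LL d) : Prop := ∀ φ, inner ℝ f (sL (sΔ φ)) = inner ℝ g (sL φ)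

/-- `∂ᵢ f = df i` in the weak sense, for all `i`. -/
def WeakGrad (f : LL d) (df : Fin d → LL d) : Prop :=
  ∀ i φ, inner ℝ f (sL (sD i φ)) = - inner ℝ (df i) (sL φ)

theorem weakLap_sL (φ : 𝓢(Eu d, ℝ)) : WeakLap (sL φ) (sL (sΔ φ)) := fun ψ => by
  rw [inner_sL_sΔ, real_inner_comm, inner_sL_sΔ]
  simp [real_inner_comm]

theorem weakGrad_sL (φ : 𝓢(Eu d, ℝ)) : WeakGrad (sL φ) (fun i => sL (sD i φ)) := fun i ψ =>
  inner_sL_sD φ ψ i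

theorem WeakLap.of_tendsto {f g : LL d} {F G : ℕ → LL d} (h : ∀ n, WeakLap (F n) (G n))
    (hf : Tendsto F atTop (𝓝 f)) (hg : Tendsto G atTop (𝓝 g)) : WeakLap f g := fun φ =>
  tendsto_nhds_unique ((hf.inner tendsto_const_nhds).congr fun n => h n φ)
    (hg.inner tendsto_const_nhds)

theorem WeakGrad.of_tendsto {f : LL d} {df : Fin d → LL d} {F : ℕ → LL d} {G : ℕ → Fin d → LL d}
    (h : ∀ n, WeakGrad (F n) (G n)) (hf : Tendsto F atTop (𝓝 f))
    (hg : ∀ i, Tendsto (fun n => G n i) atTop (𝓝 (df i))) : WeakGrad f df := fun i φ =>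
  tendsto_nhds_unique ((hf.inner tendsto_const_nhds).congr fun n => h n i φ)
    ((hg i).inner tendsto_const_nhds).neg

theorem WeakGrad.unique {f : LL d} {df df' : Fin d → LL d} (h : WeakGrad f df)
    (h' : WeakGrad f df') : df = df' := by
  ext1 i
  refine eq_of_forall_inner_sL fun φ => ?_
  have := (h i φ).symm.trans (h' i φ)
  linarith

theorem eq_zero_of_inner_sub {z : LL d}
    (h : ∀ φ, inner ℝ z (sL φ) = besselConst * inner ℝ z (sL (sΔ φ))) : z = 0 :=
  toLp_eq_zero_of_forall_integral z fun φ => by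
    have := h φ
    rwa [inner_sL, inner_sL, sΔ_eq] at this

/-- Expanding the square and integrating by parts, `‖φ - cΔφ‖² = ‖φ‖² + 2c‖∇φ‖² + c²‖Δφ‖²` with all
terms nonnegative. Convergence of `φ - cΔφ` therefore forces convergence of `φ` and of `Δφ`
separately. -/
theorem norm_sL_le (φ : 𝓢(Eu d, ℝ)) :
    ‖sL φ‖ ≤ ‖sL φ - besselConst • sL (sΔ φ)‖ ∧
      besselConst * ‖sL (sΔ φ)‖ ≤ ‖sL φ - besselConst • sL (sΔ φ)‖ := by
  have h1 : ‖sL φ - besselConst • sL (sΔ φ)‖ ^ 2 = ‖sL φ‖ ^ 2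
      + 2 * besselConst * ∑ i, ‖sL (sD i φ)‖ ^ 2 + (besselConst * ‖sL (sΔ φ)‖) ^ 2 := by
    rw [@norm_sub_sq_real, real_inner_smul_right, inner_sL_sΔ_self, norm_smul,
      Real.norm_of_nonneg besselConst_pos.le]
    ring
  have h2 : 0 ≤ 2 * besselConst * ∑ i, ‖sL (sD i φ)‖ ^ 2 :=
    mul_nonneg (by linarith [besselConst_pos]) (Finset.sum_nonneg fun i _ => by positivity)
  have h3 := besselConst_pos
  constructor <;> refine le_of_sq_le_sq ?_ (norm_nonneg _) <;> nlinarith [sq_nonneg ‖sL φ‖, sq_nonneg (besselConst * ‖sL (sΔ φ)‖)]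

/-- The range of `1 - cΔ` on Schwartz functions is dense, since a vector orthogonal to it is a weak
solution of `z = cΔz` and so vanishes. Approximating `f - cg` from this range, `norm_sL_le` makes
the functions and their Laplacians Cauchy; the limit pair solves the same equation as `(f, g)`, and
uniqueness identifies the two. -/
theorem WeakLap.exists_seq {f g : LL d} (h : WeakLap f g) :
    ∃ φ : ℕ → 𝓢(Eu d, ℝ), Tendsto (fun n => sL (φ n)) atTop (𝓝 f) ∧
      Tendsto (fun n => sL (sΔ (φ n))) atTop (𝓝 g) := by
  let T : 𝓢(Eu d, ℝ) →ₗ[ℝ] LL d :=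
    (sL (d := d)).toLinearMap - besselConst • ((sL (d := d)).toLinearMap ∘ₗ (sΔ (d := d)).toLinearMap)
  have hT : ∀ φ, T φ = sL φ - besselConst • sL (sΔ φ) := fun φ => rfl
  have hd : (LinearMap.range T).topologicalClosure = ⊤ := by
    rw [Submodule.topologicalClosure_eq_top_iff, Submodule.eq_bot_iff]
    intro z hz
    refine eq_zero_of_inner_sub fun φ => ?_
    have h1 := (Submodule.mem_orthogonal' _ _).1 hz (T φ) ⟨φ, rfl⟩
    rw [hT, inner_sub_right, real_inner_smul_right] at h1
    linarith
  have h1 : f - besselConst • g ∈ closure (LinearMap.range T : Set (LL d)) := by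
    have : f - besselConst • g ∈ (LinearMap.range T).topologicalClosure := hd ▸ Submodule.mem_top
    exact this
  obtain ⟨y, hy, hlim⟩ := mem_closure_iff_seq_limit.1 h1
  choose φ hφ using hy
  have hlim' : Tendsto (fun n => sL (φ n) - besselConst • sL (sΔ (φ n))) atTop
      (𝓝 (f - besselConst • g)) := hlim.congr fun n => (hφ n).symm
  have hc := Metric.cauchySeq_iff'.1 hlim'.cauchySeq
  have hsub : ∀ m n, sL (φ m - φ n) - besselConst • sL (sΔ (φ m - φ n)) =
      (sL (φ m) - besselConst • sL (sΔ (φ m))) - (sL (φ n) - besselConst • sL (sΔ (φ n))) := by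
    intro m n
    simp only [map_sub, smul_sub]
    abel
  have c1 : CauchySeq fun n => sL (φ n) := by
    refine Metric.cauchySeq_iff'.2 fun ε hε => ?_
    obtain ⟨N, hN⟩ := hc ε hε
    refine ⟨N, fun n hn => ?_⟩
    have := hN n hn
    rw [dist_eq_norm, ← hsub] at this
    rw [dist_eq_norm, ← map_sub]
    exact (norm_sL_le _).1.trans_lt this
  have c2 : CauchySeq fun n => sL (sΔ (φ n)) := by
    refine Metric.cauchySeq_iff'.2 fun ε hε => ?_
    obtain ⟨N, hN⟩ := hc (besselConst * ε) (mul_pos besselConst_pos hε)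
    refine ⟨N, fun n hn => ?_⟩
    have := hN n hn
    rw [dist_eq_norm, ← hsub] at this
    rw [dist_eq_norm, ← map_sub, ← map_sub]
    exact lt_of_mul_lt_mul_left ((norm_sL_le _).2.trans_lt this) besselConst_pos.le
  obtain ⟨f', hf'⟩ := cauchySeq_tendsto_of_complete c1
  obtain ⟨g', hg'⟩ := cauchySeq_tendsto_of_complete c2
  have hw : WeakLap f' g' := WeakLap.of_tendsto (fun n => weakLap_sL (φ n)) hf' hg'
  have he : f' - besselConst • g' = f - besselConst • g :=
    tendsto_nhds_unique (hf'.sub (hg'.const_smul _)) hlim'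
  have hz : f' - f = 0 := by
    refine eq_zero_of_inner_sub fun ψ => ?_
    have h2 : f' - f = besselConst • (g' - g) := by
      rw [smul_sub]
      exact sub_eq_sub_iff_sub_eq_sub.1 (by simpa using he)
    have h3 : inner ℝ (f' - f) (sL (sΔ ψ)) = inner ℝ (g' - g) (sL ψ) := by
      rw [inner_sub_left, inner_sub_left, hw ψ, h ψ]
    rw [h3]
    nth_rewrite 1 [h2]
    rw [real_inner_smul_left]
  have hff : f' = f := sub_eq_zero.1 hz
  have hgg : g' = g := by
    rw [hff] at he
    exact smul_right_injective _ besselConst_pos.ne' (sub_right_injective he)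
  exact ⟨φ, hff ▸ hf', hgg ▸ hg'⟩

/-- The interpolation bound `‖∂ᵢφ‖² ≤ -⟨φ, Δφ⟩ ≤ ‖φ‖‖Δφ‖` makes the gradients of an approximating
sequence Cauchy too. -/
theorem WeakLap.exists_grad {f g : LL d} (h : WeakLap f g) :
    ∃ (φ : ℕ → 𝓢(Eu d, ℝ)) (df : Fin d → LL d), WeakGrad f df ∧
      Tendsto (fun n => sL (φ n)) atTop (𝓝 f) ∧ Tendsto (fun n => sL (sΔ (φ n))) atTop (𝓝 g) ∧
      ∀ i, Tendsto (fun n => sL (sD i (φ n))) atTop (𝓝 (df i)) := by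
  obtain ⟨φ, h1, h2⟩ := h.exists_seq
  have hb : ∀ (i : Fin d) (ψ : 𝓢(Eu d, ℝ)), ‖sL (sD i ψ)‖ ≤ ‖sL ψ‖ + ‖sL (sΔ ψ)‖ := by
    intro i ψ
    refine le_of_sq_le_sq ?_ (by positivity)
    have h3 : ‖sL (sD i ψ)‖ ^ 2 ≤ ∑ i, ‖sL (sD i ψ)‖ ^ 2 :=
      Finset.single_le_sum (f := fun i => ‖sL (sD i ψ)‖ ^ 2) (fun _ _ => by positivity)
        (Finset.mem_univ i)
    have h4 := inner_sL_sΔ_self ψ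
    have h5 := abs_real_inner_le_norm (sL ψ) (sL (sΔ ψ))
    have h6 := neg_abs_le (inner ℝ (sL ψ) (sL (sΔ ψ)))
    nlinarith [norm_nonneg (sL ψ), norm_nonneg (sL (sΔ ψ)), sq_nonneg ‖sL ψ‖,
      sq_nonneg ‖sL (sΔ ψ)‖, mul_nonneg (norm_nonneg (sL ψ)) (norm_nonneg (sL (sΔ ψ)))]
  have c : ∀ i, CauchySeq fun n => sL (sD i (φ n)) := by
    intro i
    refine Metric.cauchySeq_iff'.2 fun ε hε => ?_
    obtain ⟨N1, hN1⟩ := Metric.cauchySeq_iff.1 h1.cauchySeq (ε / 2) (half_pos hε)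
    obtain ⟨N2, hN2⟩ := Metric.cauchySeq_iff.1 h2.cauchySeq (ε / 2) (half_pos hε)
    refine ⟨max N1 N2, fun n hn => ?_⟩
    have h3 := hN1 n (le_of_max_le_left hn) (max N1 N2) (le_max_left _ _)
    have h4 := hN2 n (le_of_max_le_right hn) (max N1 N2) (le_max_right _ _)
    rw [dist_eq_norm, ← map_sub] at h3
    rw [dist_eq_norm, ← map_sub, ← map_sub] at h4
    rw [dist_eq_norm, ← map_sub, ← map_sub]
    refine (hb i _).trans_lt ?_
    linarith
  choose df hdf using fun i => cauchySeq_tendsto_of_complete (c i)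
  exact ⟨φ, df, WeakGrad.of_tendsto (fun n => weakGrad_sL (φ n)) h1 hdf, h1, h2, hdf⟩

/-- The Hilbert space of pairs of a function and a gradient. -/
abbrev GradSpace (d : ℕ) := PiLp 2 (fun _ : Option (Fin d) => LL d)

/-- This is `H = W` by orthogonal projection. The part of `(f, ∇f)` orthogonal to all Schwartz pairs
is itself a weak gradient pair, and orthogonality then reads `z = cΔz` for its first component,
which must vanish; hence so does the gradient. -/
theorem WeakGrad.exists_seq {f : LL d} {df : Fin d → LL d} (h : WeakGrad f df) :
    ∃ φ : ℕ → 𝓢(Eu d, ℝ), Tendsto (fun n => sL (φ n)) atTop (𝓝 f) ∧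
      ∀ i, Tendsto (fun n => sL (sD i (φ n))) atTop (𝓝 (df i)) := by
  -- Scaling the gradient components by `c` puts the factor `c ^ 2 = besselConst` in front of the
  -- Laplacian in the orthogonality relation, as `eq_zero_of_inner_sub` requires.
  obtain ⟨c, hc, hcc⟩ : ∃ c : ℝ, 0 < c ∧ besselConst = c ^ 2 :=
    ⟨(2 * Real.pi)⁻¹, by positivity, by rw [besselConst, inv_pow]⟩
  let mk (f : LL d) (df : Fin d → LL d) : GradSpace d :=
    WithLp.toLp 2 (fun o => o.elim f (fun i => c • df i))
  let T : 𝓢(Eu d, ℝ) →ₗ[ℝ] GradSpace d :=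
    { toFun := fun φ => mk (sL φ) (fun i => sL (sD i φ))
      map_add' := fun φ ψ => by
        ext1 o
        cases o <;> simp [mk]
      map_smul' := fun r φ => by
        ext1 o
        cases o <;> simp [mk, smul_comm c r] }
  have hinner : ∀ (F : GradSpace d) φ, inner ℝ F (T φ) = inner ℝ (F none) (sL φ) +
      ∑ i, c * inner ℝ (F (some i)) (sL (sD i φ)) := by
    intro F φ
    rw [PiLp.inner_apply, Fintype.sum_option]
    simp [T, mk, real_inner_smul_right]
  let K := (LinearMap.range T).topologicalClosure
  have hKc : IsClosed (K : Set (GradSpace d)) := Submodule.isClosed_topologicalClosure _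
  have : CompleteSpace K := hKc.completeSpace_coe
  let W : Set (GradSpace d) := {F | ∀ (i : Fin d) φ,
    c * inner ℝ (F none) (sL (sD i φ)) = - inner ℝ (F (some i)) (sL φ)}
  have hWc : IsClosed W := by
    simp only [W, Set.ofPred_forall]
    refine isClosed_iInter fun i => isClosed_iInter fun φ => isClosed_eq ?_ ?_ <;> fun_prop
  have hKW : (K : Set (GradSpace d)) ⊆ W := by
    refine closure_minimal ?_ hWc
    rintro _ ⟨φ, rfl⟩ i ψ
    simp only [T, mk, LinearMap.coe_mk, AddHom.coe_mk, Option.elim, real_inner_smul_left]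
    rw [inner_sL_sD]
    ring
  let F : GradSpace d := mk f df
  have hFW : F ∈ W := fun i φ => by
    simp only [F, mk, Option.elim, real_inner_smul_left]
    rw [h i φ]
    ring
  let P : GradSpace d := K.starProjection F
  have hPK : P ∈ K := Submodule.starProjection_apply_mem K F
  have hG : ∀ φ, inner ℝ (F - P) (T φ) = 0 := fun φ =>
    (Submodule.mem_orthogonal' _ _).1 (Submodule.sub_starProjection_mem_orthogonal F) (T φ)
      (Submodule.le_topologicalClosure _ ⟨φ, rfl⟩)
  have hGW : ∀ (i : Fin d) φ,
      c * inner ℝ ((F - P) none) (sL (sD i φ)) = - inner ℝ ((F - P) (some i)) (sL φ) := by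
    intro i φ
    have h1 := hFW i φ
    have h2 := hKW hPK i φ
    simp only [PiLp.sub_apply, inner_sub_left]
    linarith
  have h0 : (F - P) none = 0 := by
    refine eq_zero_of_inner_sub fun φ => ?_
    have h1 := hG φ
    rw [hinner] at h1
    have h2 : ∀ i, c * inner ℝ ((F - P) (some i)) (sL (sD i φ)) =
        - (c ^ 2 * inner ℝ ((F - P) none) (sL (sD i (sD i φ)))) := fun i => by
      have := hGW i (sD i φ)
      linear_combination c * this
    rw [Finset.sum_congr rfl fun i _ => h2 i, Finset.sum_neg_distrib, ← Finset.mul_sum,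
      ← inner_sum, ← map_sum, ← sΔ_eq_sum] at h1
    rw [hcc]
    linarith
  have hi : ∀ i, (F - P) (some i) = 0 := fun i => by
    refine eq_of_forall_inner_sL fun φ => ?_
    have := hGW i φ
    rw [h0] at this
    simp only [inner_zero_left, mul_zero] at this ⊢
    linarith
  have hFP : F = P := by
    refine sub_eq_zero.1 ?_
    ext1 o
    cases o with
    | none => exact h0
    | some i => exact hi i
  have hFK : F ∈ closure (LinearMap.range T : Set (GradSpace d)) := by
    rw [hFP]
    exact hPK
  obtain ⟨y, hy, hlim⟩ := mem_closure_iff_seq_limit.1 hFK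
  choose φ hφ using hy
  have hco : ∀ o, Tendsto (fun n => (T (φ n)) o) atTop (𝓝 (F o)) := fun o =>
    ((PiLp.continuous_apply 2 (fun _ : Option (Fin d) => LL d) o).tendsto F).comp
      (hlim.congr fun n => (hφ n).symm)
  refine ⟨φ, hco none, fun i => ?_⟩
  have := (hco (some i)).const_smul c⁻¹
  simpa [T, F, mk, smul_smul, hc.ne'] using this

/-- The approximating sequence can be taken with compact supports. -/
theorem WeakGrad.exists_seq_compact {f : LL d} {df : Fin d → LL d} (h : WeakGrad f df) :
    ∃ φ : ℕ → 𝓢(Eu d, ℝ), (∀ n, HasCompactSupport (φ n)) ∧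
      Tendsto (fun n => sL (φ n)) atTop (𝓝 f) ∧
      ∀ i, Tendsto (fun n => sL (sD i (φ n))) atTop (𝓝 (df i)) := by
  obtain ⟨φ, h1, h2⟩ := h.exists_seq
  let G : 𝓢(Eu d, ℝ) → LL d × (Fin d → LL d) := fun φ => (sL φ, fun i => sL (sD i φ))
  have hG : Continuous G := by fun_prop
  have hlim : Tendsto (fun n => G (φ n)) atTop (𝓝 (f, df)) :=
    h1.prodMk_nhds (tendsto_pi_nhds.2 h2)
  have hcl : (f, df) ∈ closure (G '' {φ | HasCompactSupport φ}) := by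
    refine closure_minimal (s := Set.range fun n => G (φ n)) ?_ isClosed_closure
      (mem_closure_of_tendsto hlim (Eventually.of_forall fun n => ⟨n, rfl⟩))
    rintro _ ⟨n, rfl⟩
    exact mem_closure_of_tendsto ((hG.tendsto _).comp (tendsto_cutSchwartz (φ n)))
      (Eventually.of_forall fun m => ⟨_, hasCompactSupport_cutSchwartz m (φ n), rfl⟩)
  obtain ⟨y, hy, hl⟩ := mem_closure_iff_seq_limit.1 hcl
  choose ψ hψ1 hψ2 using hy
  have hl' : Tendsto (fun n => G (ψ n)) atTop (𝓝 (f, df)) := hl.congr fun n => (hψ2 n).symm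
  exact ⟨ψ, hψ1, (continuous_fst.tendsto _).comp hl',
    fun i => ((continuous_apply i).tendsto _).comp ((continuous_snd.tendsto _).comp hl')⟩

variable {d : ℕ}

/-! ### Gagliardo-Nirenberg and Sobolev inequalities -/

theorem exists_ae_tendsto_of_tendsto_sL {f : LL d} {φ : ℕ → 𝓢(Eu d, ℝ)}
    (h : Tendsto (fun n => sL (φ n)) atTop (𝓝 f)) :
    ∃ ns : ℕ → ℕ, StrictMono ns ∧ ∀ᵐ x, Tendsto (fun n => φ (ns n) x) atTop (𝓝 (f x)) := by
  obtain ⟨ns, hns, hae⟩ := (tendstoInMeasure_of_tendsto_Lp h).exists_seq_tendsto_ae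
  refine ⟨ns, hns, ?_⟩
  have h1 : ∀ᵐ x, ∀ n, sL (φ n) x = φ n x := ae_all_iff.2 fun n => coeFn_sL (φ n)
  filter_upwards [hae, h1] with x hx hx1
  exact hx.congr fun n => hx1 _

/-- Fatou's lemma along an almost everywhere convergent subsequence; it carries the inequalities for
Schwartz functions to their `L²` limits, including integrability of the power. -/
theorem integral_pow_le_of_tendsto {f : LL d} {φ : ℕ → 𝓢(Eu d, ℝ)} {m : ℕ} {B : ℕ → ℝ} {b : ℝ}
    (hm : Even m) (h : Tendsto (fun n => sL (φ n)) atTop (𝓝 f))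
    (hi : ∀ n, Integrable fun x => φ n x ^ m) (hB : ∀ n, ∫ x, φ n x ^ m ≤ B n)
    (hb : Tendsto B atTop (𝓝 b)) :
    Integrable (fun x => f x ^ m) ∧ ∫ x, f x ^ m ≤ b := by
  obtain ⟨ns, hns, hae⟩ := exists_ae_tendsto_of_tendsto_sL h
  have hmeas : AEStronglyMeasurable (fun x => f x ^ m) volume :=
    (Lp.aestronglyMeasurable f).pow m
  have key : ∫⁻ x, ENNReal.ofReal (f x ^ m) ≤ ENNReal.ofReal b := by
    have h1 : ∫⁻ x, ENNReal.ofReal (f x ^ m) ≤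
        ∫⁻ x, liminf (fun n => ENNReal.ofReal (φ (ns n) x ^ m)) atTop := by
      refine lintegral_mono_ae ?_
      filter_upwards [hae] with x hx
      rw [((ENNReal.continuous_ofReal.tendsto _).comp (hx.pow m)).liminf_eq.symm]
      rfl
    refine h1.trans ((lintegral_liminf_le fun n => ?_).trans ?_)
    · exact ((φ (ns n)).continuous.pow m).measurable.ennreal_ofReal
    · have h2 : Tendsto (fun n => ENNReal.ofReal (B (ns n))) atTop (𝓝 (ENNReal.ofReal b)) :=
        (ENNReal.continuous_ofReal.tendsto _).comp (hb.comp hns.tendsto_atTop)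
      rw [← h2.liminf_eq]
      refine liminf_le_liminf (Eventually.of_forall fun n => ?_)
      change ∫⁻ x, ENNReal.ofReal (φ (ns n) x ^ m) ≤ ENNReal.ofReal (B (ns n))
      rw [← ofReal_integral_eq_lintegral_ofReal (hi _)
        (Eventually.of_forall fun x => hm.pow_nonneg _)]
      exact ENNReal.ofReal_le_ofReal (hB _)
  have hInt : Integrable (fun x => f x ^ m) := by
    refine ⟨hmeas, ?_⟩
    rw [hasFiniteIntegral_iff_ofReal (Eventually.of_forall fun x => hm.pow_nonneg _)]
    exact key.trans_lt ENNReal.ofReal_lt_top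
  refine ⟨hInt, ?_⟩
  rw [← ofReal_integral_eq_lintegral_ofReal hInt
    (Eventually.of_forall fun x => hm.pow_nonneg _)] at key
  by_cases hb0 : 0 ≤ b
  · exact (ENNReal.ofReal_le_ofReal_iff hb0).1 key
  · exfalso
    refine hb0 (ge_of_tendsto' hb fun n => ?_)
    exact (integral_nonneg fun x => hm.pow_nonneg _).trans (hB n)

theorem norm_sq_le_sum_ev (L : Eu d →L[ℝ] ℝ) : ‖L‖ ^ 2 ≤ ∑ i, L (ev i) ^ 2 := by
  have h0 : 0 ≤ ∑ i, L (ev i) ^ 2 := Finset.sum_nonneg fun i _ => sq_nonneg _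
  have : ‖L‖ ≤ √(∑ i, L (ev i) ^ 2) := by
    refine L.opNorm_le_bound (Real.sqrt_nonneg _) fun v => ?_
    have hv : v = ∑ i, v i • ev i := by
      have := (EuclideanSpace.basisFun (Fin d) ℝ).sum_repr v
      simpa [ev] using this.symm
    have h1 : L v = ∑ i, L (ev i) * v i := by
      conv_lhs => rw [hv]
      simp [mul_comm]
    refine abs_le_of_sq_le_sq ?_ (by positivity)
    rw [h1, mul_pow, Real.sq_sqrt h0, EuclideanSpace.real_norm_sq_eq]
    exact Finset.sum_mul_sq_le_sq_mul_sq _ _ _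
  calc ‖L‖ ^ 2 ≤ √(∑ i, L (ev i) ^ 2) ^ 2 := by gcongr
    _ = _ := Real.sq_sqrt h0

theorem norm_sL_sq (φ : 𝓢(Eu d, ℝ)) : ‖sL φ‖ ^ 2 = ∫ x, φ x ^ 2 := by
  rw [← real_inner_self_eq_norm_sq, inner_sL_sL]
  simp [sq]

theorem integrable_schwartz_mul (φ ψ : 𝓢(Eu d, ℝ)) : Integrable fun x => φ x * ψ x :=
  (φ.memLp 2).integrable_mul (ψ.memLp 2)

theorem integral_norm_fderiv_sq_le (φ : 𝓢(Eu d, ℝ)) :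
    Integrable (fun x => ‖fderiv ℝ φ x‖ ^ 2) ∧
      ∫ x, ‖fderiv ℝ φ x‖ ^ 2 ≤ ∑ i, ‖sL (sD i φ)‖ ^ 2 := by
  have h1 : ∀ i, Integrable fun x => sD i φ x ^ 2 := fun i => by
    simpa [sq] using integrable_schwartz_mul (sD i φ) (sD i φ)
  have h2 : Integrable fun x => ∑ i, sD i φ x ^ 2 := integrable_finsetSum _ fun i _ => h1 i
  have h3 : Integrable (fun x => ‖fderiv ℝ φ x‖ ^ 2) := by
    refine h2.mono' ?_ (Eventually.of_forall fun x => ?_)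
    · exact (((φ.smooth 1).continuous_fderiv one_ne_zero).norm.pow 2).aestronglyMeasurable
    · rw [Real.norm_of_nonneg (by positivity)]
      exact norm_sq_le_sum_ev _
  refine ⟨h3, ?_⟩
  simp_rw [norm_sL_sq]
  rw [← integral_finsetSum _ fun i _ => h1 i]
  exact integral_mono h3 h2 fun x => norm_sq_le_sum_ev _

theorem integral_mul_sq_le {α : Type*} [MeasurableSpace α] {μ : Measure α} {f g : α → ℝ}
    (hf : MemLp f 2 μ) (hg : MemLp g 2 μ) :
    (∫ x, f x * g x ∂μ) ^ 2 ≤ (∫ x, f x ^ 2 ∂μ) * ∫ x, g x ^ 2 ∂μ := by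
  have h := real_inner_mul_inner_self_le (hf.toLp f) (hg.toLp g)
  have e : ∀ {u v : α → ℝ} (hu : MemLp u 2 μ) (hv : MemLp v 2 μ),
      inner ℝ (hu.toLp u) (hv.toLp v) = ∫ x, u x * v x ∂μ := by
    intro u v hu hv
    rw [L2.inner_def]
    refine integral_congr_ae ?_
    filter_upwards [hu.coeFn_toLp, hv.coeFn_toLp] with x h1 h2
    rw [h1, h2]
    simp [mul_comm]
  rw [e hf hg, e hf hf, e hg hg] at h
  simpa [sq] using h

/-- The endpoint embedding of `W^{1,1}` into `L²` in the plane: the conjugate exponent of the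
dimension two is two. -/
theorem exists_integral_sq_le_integral_fderiv :
    ∃ C : ℝ, 0 ≤ C ∧ ∀ u : Eu 2 → ℝ, ContDiff ℝ 1 u → HasCompactSupport u →
      ∫ x, u x ^ 2 ≤ C * (∫ x, ‖fderiv ℝ u x‖) ^ 2 := by
  have hp : Real.HolderConjugate (Module.finrank ℝ (Eu 2)) 2 := by
    simp
    exact Real.HolderConjugate.two_two
  obtain ⟨C, hC⟩ : ∃ C : NNReal, ∀ u : Eu 2 → ℝ, ContDiff ℝ 1 u → HasCompactSupport u →
      ∫⁻ x, ‖u x‖ₑ ^ (2 : ℝ) ≤ C * (∫⁻ x, ‖fderiv ℝ u x‖ₑ) ^ (2 : ℝ) :=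
    ⟨_, fun u hu hc => lintegral_pow_le_pow_lintegral_fderiv (volume : Measure (Eu 2)) hu hc hp⟩
  refine ⟨C, C.2, fun u hu hc => ?_⟩
  have h := hC u hu hc
  have hcd := (hu.continuous_fderiv one_ne_zero)
  have hi1 : Integrable fun x => ‖fderiv ℝ u x‖ :=
    (hcd.integrable_of_hasCompactSupport (hc.fderiv (𝕜 := ℝ))).norm
  have hi2 : Integrable fun x => u x ^ 2 := by
    have h2 : HasCompactSupport (fun x => u x * u x) := hc.mul_right
    have h3 : Integrable (fun x => u x * u x) :=
      Continuous.integrable_of_hasCompactSupport (hu.continuous.mul hu.continuous) h2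
    simpa only [sq] using h3
  have e1 : ∫⁻ x, ‖u x‖ₑ ^ (2 : ℝ) = ENNReal.ofReal (∫ x, u x ^ 2) := by
    rw [ofReal_integral_eq_lintegral_ofReal hi2 (Eventually.of_forall fun x => sq_nonneg _)]
    refine lintegral_congr fun x => ?_
    rw [← ofReal_norm, ENNReal.ofReal_rpow_of_nonneg (norm_nonneg _) (by norm_num)]
    simp
  have e2 : ∫⁻ x, ‖fderiv ℝ u x‖ₑ = ENNReal.ofReal (∫ x, ‖fderiv ℝ u x‖) := by
    rw [ofReal_integral_eq_lintegral_ofReal hi1 (Eventually.of_forall fun x => norm_nonneg _)]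
    simp
  have h0 : 0 ≤ ∫ x, ‖fderiv ℝ u x‖ := integral_nonneg fun x => norm_nonneg _
  rw [e1, e2, ENNReal.ofReal_rpow_of_nonneg h0 (by norm_num), ← ENNReal.ofReal_coe_nnreal,
    ← ENNReal.ofReal_mul C.coe_nonneg] at h
  have := (ENNReal.ofReal_le_ofReal_iff (by positivity)).1 h
  simpa using this

theorem schwartz_pow_memLp (φ : 𝓢(Eu d, ℝ)) (m : ℕ) (hm : m ≠ 0) (p : ENNReal) :
    MemLp (fun x => φ x ^ m) p := by
  obtain ⟨n, rfl⟩ := Nat.exists_eq_succ_of_ne_zero hm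
  have h : MemLp (fun x => φ x ^ n) ⊤ := by
    induction n with
    | zero => simpa using memLp_top_const (1 : ℝ)
    | succ n ih =>
      have := (φ.memLp ⊤).mul' (r := ⊤) (p := ⊤) (ih (by omega))
      simpa [pow_succ] using this
  have := (φ.memLp p).mul' (r := p) (p := ⊤) h
  simpa [pow_succ] using this

/-- Apply the endpoint embedding to the power `φ^{m+1}` and use Cauchy-Schwarz on `∫ |φ|^m |∇φ|`:
this bounds `∫ φ^{2m+2}` by `∫ φ^{2m}` times `‖∇φ‖²`. The case `m = 1` is the quartic bound, and `m
= 2` then yields the sextic one. -/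
theorem exists_schwartz_gagliardo_nirenberg_two :
    ∃ C : ℝ, 0 ≤ C ∧ ∀ φ : 𝓢(Eu 2, ℝ), HasCompactSupport φ →
      ∫ x, φ x ^ 4 ≤ C * ‖sL φ‖ ^ 2 * ∑ i, ‖sL (sD i φ)‖ ^ 2 ∧
      ∫ x, φ x ^ 6 ≤ C * ‖sL φ‖ ^ 2 * (∑ i, ‖sL (sD i φ)‖ ^ 2) ^ 2 := by
  obtain ⟨C, hC, h⟩ := exists_integral_sq_le_integral_fderiv
  have key : ∀ (m : ℕ) (φ : 𝓢(Eu 2, ℝ)), m ≠ 0 → HasCompactSupport φ →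
      ∫ x, φ x ^ (2 * m + 2) ≤ C * (m + 1) ^ 2 * (∫ x, φ x ^ (2 * m)) *
        ∑ i, ‖sL (sD i φ)‖ ^ 2 := by
    intro m φ hm hφ
    have hs : ContDiff ℝ 1 fun x => φ x ^ (m + 1) := (φ.smooth 1).pow _
    have hc : HasCompactSupport fun x => φ x ^ (m + 1) :=
      hφ.comp_left (g := fun y : ℝ => y ^ (m + 1)) (by simp)
    have h1 := h _ hs hc
    have e1 : ∫ x, (φ x ^ (m + 1)) ^ 2 = ∫ x, φ x ^ (2 * m + 2) := by
      congr 1; ext x; ring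
    have e2 : ∀ x, ‖fderiv ℝ (fun x => φ x ^ (m + 1)) x‖ =
        (m + 1) * (|φ x ^ m| * ‖fderiv ℝ φ x‖) := by
      intro x
      rw [fderiv_fun_pow _ (φ.differentiableAt), norm_smul]
      simp
      rw [abs_of_nonneg (by positivity : (0 : ℝ) ≤ m + 1)]
      ring
    obtain ⟨i1, i2⟩ := integral_norm_fderiv_sq_le φ
    have hm1 : MemLp (fun x => |φ x ^ m|) 2 := (schwartz_pow_memLp φ m hm 2).norm
    have hm2 : MemLp (fun x => ‖fderiv ℝ φ x‖) 2 := by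
      refine (memLp_two_iff_integrable_sq ?_).2 i1
      exact ((φ.smooth 1).continuous_fderiv one_ne_zero).norm.aestronglyMeasurable
    have h2 := integral_mul_sq_le hm1 hm2
    have e3 : ∫ x, |φ x ^ m| ^ 2 = ∫ x, φ x ^ (2 * m) := by
      congr 1; ext x; rw [sq_abs]; ring
    rw [e1] at h1
    simp_rw [e2] at h1
    rw [integral_const_mul, mul_pow] at h1
    rw [e3] at h2
    have h0 : 0 ≤ ∫ x, φ x ^ (2 * m) :=
      integral_nonneg fun x => (even_two_mul m).pow_nonneg _
    calc _ ≤ _ := h1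
      _ ≤ C * ((m + 1) ^ 2 * ((∫ x, φ x ^ (2 * m)) * ∫ x, ‖fderiv ℝ φ x‖ ^ 2)) := by gcongr
      _ ≤ C * ((m + 1) ^ 2 * ((∫ x, φ x ^ (2 * m)) * ∑ i, ‖sL (sD i φ)‖ ^ 2)) := by gcongr
      _ = _ := by ring
  -- The numbers 4 and 9 are `(m + 1) ^ 2` for `m = 1, 2`; the second constant contains the first
  -- because the sextic bound uses the quartic one.
  refine ⟨max (C * 4) (C * 9 * (C * 4)), by positivity, fun φ hφ => ?_⟩
  have k1 := key 1 φ (by norm_num) hφ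
  have k2 := key 2 φ (by norm_num) hφ
  norm_num at k1 k2
  rw [← norm_sL_sq] at k1
  have hS : 0 ≤ ∑ i, ‖sL (sD i φ)‖ ^ 2 := Finset.sum_nonneg fun _ _ => by positivity
  rw [← Fin.sum_univ_two (fun i => ‖sL (sD i φ)‖ ^ 2)] at k1 k2
  constructor
  · refine k1.trans ?_
    gcongr
    exact le_max_left _ _
  · calc _ ≤ _ := k2
      _ ≤ C * 9 * (C * 4 * ‖sL φ‖ ^ 2 * ∑ i, ‖sL (sD i φ)‖ ^ 2) *
          ∑ i, ‖sL (sD i φ)‖ ^ 2 := by gcongr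
      _ = (C * 9 * (C * 4)) * ‖sL φ‖ ^ 2 * (∑ i, ‖sL (sD i φ)‖ ^ 2) ^ 2 := by ring
      _ ≤ _ := by
        gcongr
        exact le_max_right _ _

theorem exists_gagliardo_nirenberg_two :
    ∃ C : ℝ, 0 ≤ C ∧ ∀ (f : LL 2) (df : Fin 2 → LL 2), WeakGrad f df →
      (Integrable (fun x => f x ^ 4) ∧ ∫ x, f x ^ 4 ≤ C * ‖f‖ ^ 2 * ∑ i, ‖df i‖ ^ 2) ∧
      (Integrable (fun x => f x ^ 6) ∧ ∫ x, f x ^ 6 ≤ C * ‖f‖ ^ 2 * (∑ i, ‖df i‖ ^ 2) ^ 2) := by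
  obtain ⟨C, hC, h⟩ := exists_schwartz_gagliardo_nirenberg_two
  refine ⟨C, hC, fun f df hf => ?_⟩
  obtain ⟨φ, hc, h1, h2⟩ := hf.exists_seq_compact
  have h3 : Tendsto (fun n => ∑ i, ‖sL (sD i (φ n))‖ ^ 2) atTop (𝓝 (∑ i, ‖df i‖ ^ 2)) :=
    tendsto_finsetSum _ fun i _ => (h2 i).norm.pow 2
  have h4 := (h1.norm.pow 2).const_mul C
  constructor
  · exact integral_pow_le_of_tendsto (by decide) h1
      (fun n => memLp_one_iff_integrable.1 (schwartz_pow_memLp _ 4 (by norm_num) 1))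
      (fun n => (h _ (hc n)).1) (h4.mul h3)
  · exact integral_pow_le_of_tendsto (by decide) h1
      (fun n => memLp_one_iff_integrable.1 (schwartz_pow_memLp _ 6 (by norm_num) 1))
      (fun n => (h _ (hc n)).2) (h4.mul (h3.pow 2))

/-! ### Sobolev inequalities in dimension three and the supremum bound -/

variable {d : ℕ}

theorem exists_integral_pow_six_le :
    ∃ C : ℝ, 0 ≤ C ∧ ∀ φ : 𝓢(Eu 3, ℝ), HasCompactSupport φ →
      ∫ x, φ x ^ 6 ≤ C * (∑ i, ‖sL (sD i φ)‖ ^ 2) ^ 3 := by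
  have hfr : Module.finrank ℝ (Eu 3) = 3 := by simp
  obtain ⟨C, hC⟩ : ∃ C : NNReal, ∀ u : Eu 3 → ℝ, ContDiff ℝ 1 u → HasCompactSupport u →
      eLpNorm u (6 : NNReal) volume ≤ C * eLpNorm (fderiv ℝ u) (2 : NNReal) volume :=
    ⟨_, fun u hu hc => eLpNorm_le_eLpNorm_fderiv_of_eq_inner (volume : Measure (Eu 3)) hu hc
      (p := 2) (p' := 6) (by norm_num) (by rw [hfr]; norm_num) (by rw [hfr]; norm_num)⟩
  refine ⟨(C : ℝ) ^ 6, by positivity, fun φ hφ => ?_⟩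
  have h := hC φ (φ.smooth 1) hφ
  obtain ⟨i1, i2⟩ := integral_norm_fderiv_sq_le φ
  have hm : MemLp (fderiv ℝ φ) 2 := by
    have : MemLp (fun x => ‖fderiv ℝ φ x‖) 2 := by
      refine (memLp_two_iff_integrable_sq ?_).2 i1
      exact ((φ.smooth 1).continuous_fderiv one_ne_zero).norm.aestronglyMeasurable
    exact (memLp_norm_iff
      ((φ.smooth 1).continuous_fderiv one_ne_zero).aestronglyMeasurable).1 this
  have e1 : eLpNorm φ (6 : NNReal) volume = ENNReal.ofReal ((∫ x, φ x ^ 6) ^ ((6 : ℝ)⁻¹)) := by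
    have := (φ.memLp 6).eLpNorm_eq_integral_rpow_norm (by norm_num) (by norm_num)
    have e : ((6 : NNReal) : ENNReal) = 6 := by norm_num
    rw [e, this]
    have e6 : (6 : ENNReal).toReal = 6 := by norm_num
    rw [e6]
    congr 3
    ext x
    have : (6 : ℝ) = ((6 : ℕ) : ℝ) := by norm_num
    rw [this, Real.rpow_natCast, Real.norm_eq_abs, Even.pow_abs (by decide)]
  have e2 : eLpNorm (fderiv ℝ φ) (2 : NNReal) volume =
      ENNReal.ofReal ((∫ x, ‖fderiv ℝ φ x‖ ^ 2) ^ ((2 : ℝ)⁻¹)) := by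
    have := hm.eLpNorm_eq_integral_rpow_norm (by norm_num) (by norm_num)
    have e : ((2 : NNReal) : ENNReal) = 2 := by norm_num
    rw [e, this]
    have e6 : (2 : ENNReal).toReal = 2 := by norm_num
    rw [e6]
    congr 3
    ext x
    have : (2 : ℝ) = ((2 : ℕ) : ℝ) := by norm_num
    rw [this, Real.rpow_natCast]
  have h0 : 0 ≤ ∫ x, φ x ^ 6 := integral_nonneg fun x => Even.pow_nonneg (by decide) _
  have h0' : 0 ≤ ∫ x, ‖fderiv ℝ φ x‖ ^ 2 := integral_nonneg fun x => by positivity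
  rw [e1, e2, ← ENNReal.ofReal_coe_nnreal, ← ENNReal.ofReal_mul C.coe_nonneg,
    ENNReal.ofReal_le_ofReal_iff (by positivity)] at h
  have h6 := pow_le_pow_left₀ (by positivity) h 6
  have a1 : ((∫ x, φ x ^ 6) ^ ((6 : ℝ)⁻¹)) ^ 6 = ∫ x, φ x ^ 6 := by
    rw [← Real.rpow_natCast, ← Real.rpow_mul h0]
    norm_num
  have a2 : ((∫ x, ‖fderiv ℝ φ x‖ ^ 2) ^ ((2 : ℝ)⁻¹)) ^ 6 = (∫ x, ‖fderiv ℝ φ x‖ ^ 2) ^ 3 := by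
    rw [← Real.rpow_natCast, ← Real.rpow_mul h0', ← Real.rpow_natCast]
    norm_num
  rw [a1, mul_pow, a2] at h6
  refine h6.trans ?_
  gcongr

/-- Integration by parts, passed to the limit from Schwartz functions. It allows `-⟨f, Δf⟩` to stand
for the Dirichlet energy, so that gradients need not be mentioned in the stability argument. -/
theorem WeakLap.sum_norm_sq_grad {f g : LL d} {df : Fin d → LL d} (h : WeakLap f g)
    (hg : WeakGrad f df) : ∑ i, ‖df i‖ ^ 2 = - inner ℝ f g := by
  obtain ⟨φ, df', hw, h1, h2, h3⟩ := h.exists_grad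
  obtain rfl := hw.unique hg
  refine tendsto_nhds_unique (tendsto_finsetSum _ fun i _ => (h3 i).norm.pow 2)
    (((h1.inner h2).neg).congr fun n => ?_)
  rw [inner_sL_sΔ_self, neg_neg]

theorem WeakLap.neg_inner_nonneg {f g : LL d} (h : WeakLap f g) : 0 ≤ - inner ℝ f g := by
  obtain ⟨φ, df, hw, -⟩ := h.exists_grad
  rw [← h.sum_norm_sq_grad hw]
  exact Finset.sum_nonneg fun _ _ => by positivity

theorem WeakLap.inner_comm {f g f' g' : LL d} (h : WeakLap f g) (h' : WeakLap f' g') :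
    inner ℝ f g' = inner ℝ g f' := by
  obtain ⟨φ, h1, h2⟩ := h'.exists_seq
  exact tendsto_nhds_unique ((tendsto_const_nhds.inner h2).congr fun n => h (φ n))
    (tendsto_const_nhds.inner h1)

/-- Cauchy-Schwarz for `φ⁴ = φ · φ³` gives `(∫ φ⁴)² ≤ ‖φ‖² ∫ φ⁶`, and the last factor is bounded by
the Sobolev inequality. The cube of the Dirichlet energy fixes the power of `h` in the continuity
argument. -/
theorem exists_gagliardo_nirenberg_three :
    ∃ C : ℝ, 0 ≤ C ∧ ∀ f g : LL 3, WeakLap f g →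
      Integrable (fun x => f x ^ 4) ∧
        (∫ x, f x ^ 4) ^ 2 ≤ C * ‖f‖ ^ 2 * (- inner ℝ f g) ^ 3 := by
  obtain ⟨C, hC, h⟩ := exists_integral_pow_six_le
  refine ⟨C, hC, fun f g hfg => ?_⟩
  obtain ⟨-, df, hw, -⟩ := hfg.exists_grad
  obtain ⟨φ, hc, h1, h2⟩ := hw.exists_seq_compact
  have h3 : Tendsto (fun n => ∑ i, ‖sL (sD i (φ n))‖ ^ 2) atTop (𝓝 (∑ i, ‖df i‖ ^ 2)) :=
    tendsto_finsetSum _ fun i _ => (h2 i).norm.pow 2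
  have h4 := (((h1.norm.pow 2).const_mul C).mul (h3.pow 3)).sqrt
  have key : ∀ n, ∫ x, φ n x ^ 4 ≤ √(C * ‖sL (φ n)‖ ^ 2 * (∑ i, ‖sL (sD i (φ n))‖ ^ 2) ^ 3) := by
    intro n
    refine Real.le_sqrt_of_sq_le ?_
    have h5 := integral_mul_sq_le ((φ n).memLp 2) (schwartz_pow_memLp (φ n) 3 (by norm_num) 2)
    have e1 : ∫ x, φ n x * φ n x ^ 3 = ∫ x, φ n x ^ 4 := by congr 1; ext x; ring
    have e2 : ∫ x, (φ n x ^ 3) ^ 2 = ∫ x, φ n x ^ 6 := by congr 1; ext x; ring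
    rw [e1, e2, ← norm_sL_sq] at h5
    refine h5.trans ?_
    calc _ ≤ ‖sL (φ n)‖ ^ 2 * (C * (∑ i, ‖sL (sD i (φ n))‖ ^ 2) ^ 3) := by
          gcongr
          exact h _ (hc n)
      _ = _ := by ring
  obtain ⟨k1, k2⟩ := integral_pow_le_of_tendsto (by decide) h1
      (fun n => memLp_one_iff_integrable.1 (schwartz_pow_memLp _ 4 (by norm_num) 1)) key h4
  refine ⟨k1, ?_⟩
  rw [hfg.sum_norm_sq_grad hw] at k2
  have := pow_le_pow_left₀ (integral_nonneg fun x => Even.pow_nonneg (by decide) _) k2 2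
  refine this.trans (le_of_eq (Real.sq_sqrt ?_))
  have := hfg.neg_inner_nonneg
  positivity

-- With `Ψ = (1 - cΔ)Φ`, Fourier inversion writes `Φ(x)` as an integral of `(1 + |ξ|²)⁻¹ 𝓕Ψ(ξ)`
-- against a unimodular factor. The weight is square integrable exactly for `d < 4`, and Plancherel
-- bounds the rest.
open FourierTransform in
theorem exists_schwartz_sq_le (hd : d ≤ 3) :
    ∃ C : ℝ, 0 ≤ C ∧ ∀ (φ : 𝓢(Eu d, ℝ)) (x : Eu d),
      φ x ^ 2 ≤ C * (‖sL φ‖ ^ 2 + ‖sL (sΔ φ)‖ ^ 2) := by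
  let w : Eu d → ℝ := fun ξ => (1 + ‖ξ‖ ^ 2)⁻¹
  have hwc : Continuous w := by
    refine Continuous.inv₀ (by fun_prop) fun ξ => by positivity
  have hw2 : Integrable fun ξ => w ξ ^ 2 := by
    -- The square of the weight decays like `|ξ|⁻⁴`, integrable because `4 > d`; this is where `d ≤
    -- 3` is needed.
    have := integrable_rpow_neg_one_add_norm_sq (E := Eu d) (μ := volume) (r := 4)
      (by simp; exact_mod_cast Nat.lt_succ_of_le hd)
    refine this.congr (Eventually.of_forall fun ξ => ?_)
    simp only [w]
    rw [show (-4 / 2 : ℝ) = -((2 : ℕ) : ℝ) by norm_num, Real.rpow_neg (by positivity),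
      Real.rpow_natCast, inv_pow]
  have hwm : MemLp w 2 := (memLp_two_iff_integrable_sq hwc.aestronglyMeasurable).2 hw2
  set K : ℝ := ∫ ξ, w ξ ^ 2
  have hK : 0 ≤ K := integral_nonneg fun _ => sq_nonneg _
  refine ⟨K * (2 * (1 + besselConst ^ 2)), by positivity, fun φ x => ?_⟩
  let L : ℝ →L[ℝ] ℂ := Complex.ofRealCLM
  let Φ : 𝓢(Eu d, ℂ) := SchwartzMap.postcompCLM L φ
  let Ψ : 𝓢(Eu d, ℂ) := Φ - besselConst • Δ Φ
  have hΦ : ∀ x, Φ x = (φ x : ℂ) := fun x => rfl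
  have hΔΦ : ∀ x, Δ Φ x = ((sΔ φ x : ℝ) : ℂ) := fun x => by
    rw [sΔ_eq, SchwartzMap.laplacian_apply, SchwartzMap.laplacian_apply]
    exact ContDiffAt.laplacian_CLM_comp_left (l := L) (f := (φ : Eu d → ℝ)) (x := x)
      ((φ.smooth 2).contDiffAt)
  have hF : ∀ ξ, 𝓕 Ψ ξ = ((1 + ‖ξ‖ ^ 2 : ℝ) : ℂ) * 𝓕 Φ ξ := by
    intro ξ
    have h1 : 𝓕 (Δ Φ) = -(2 * Real.pi) ^ 2 •
        SchwartzMap.smulLeftCLM ℂ (fun x : Eu d => ‖x‖ ^ 2) (𝓕 Φ) := by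
      rw [SchwartzMap.laplacian_eq_fourierMultiplierCLM, SchwartzMap.fourierMultiplierCLM_apply,
        ← FourierTransform.fourierInv_smul, FourierTransform.fourier_fourierInv_eq]
    have h2 : 𝓕 Ψ = 𝓕 Φ - besselConst • 𝓕 (Δ Φ) := by
      simp only [Ψ, sub_eq_add_neg, FourierTransform.fourier_add]
      rw [← neg_smul, FourierTransform.fourier_smul, neg_smul]
    rw [h2, h1]
    simp only [sub_apply, smul_apply]
    rw [SchwartzMap.smulLeftCLM_apply_apply (by fun_prop)]
    simp only [besselConst]
    have : (Real.pi : ℂ) ≠ 0 := by exact_mod_cast Real.pi_ne_zero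
    simp
    field_simp
  have hinv : Φ x = ∫ ξ, Complex.exp (2 * Real.pi * Complex.I * (inner ℝ ξ x : ℝ)) * 𝓕 Φ ξ := by
    have h1 : Φ x = 𝓕⁻ (𝓕 Φ) x := by rw [FourierTransform.fourierInv_fourier_eq]
    rw [h1, SchwartzMap.fourierInv_coe, Real.fourierInv_eq']
    refine integral_congr_ae (Eventually.of_forall fun ξ => ?_)
    simp only [smul_eq_mul]
    congr 2
    push_cast
    ring
  have h3 : ‖Φ x‖ ≤ ∫ ξ, w ξ * ‖𝓕 Ψ ξ‖ := by
    rw [hinv]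
    refine (norm_integral_le_integral_norm _).trans (le_of_eq ?_)
    refine integral_congr_ae (Eventually.of_forall fun ξ => ?_)
    have e1 : ‖Complex.exp (2 * Real.pi * Complex.I * (inner ℝ ξ x : ℝ))‖ = 1 := by
      rw [show (2 * Real.pi * Complex.I * (inner ℝ ξ x : ℝ) : ℂ) =
        ((2 * Real.pi * inner ℝ ξ x : ℝ) : ℂ) * Complex.I by push_cast; ring]
      exact Complex.norm_exp_ofReal_mul_I _
    simp only [norm_mul, e1, hF, one_mul, w, Complex.norm_real]
    rw [Real.norm_of_nonneg (by positivity)]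
    field_simp
  have h4 := integral_mul_sq_le hwm (((𝓕 Ψ).memLp 2).norm)
  have h5 : ∫ ξ, ‖𝓕 Ψ ξ‖ ^ 2 = ∫ y, ‖Ψ y‖ ^ 2 := SchwartzMap.integral_norm_sq_fourier Ψ
  have h6 : ∫ y, ‖Ψ y‖ ^ 2 = ‖sL (φ - besselConst • sΔ φ)‖ ^ 2 := by
    rw [norm_sL_sq]
    refine integral_congr_ae (Eventually.of_forall fun y => ?_)
    simp only [Ψ, sub_apply, smul_apply, hΦ, hΔΦ]
    rw [← sq_abs (φ y - _), ← Real.norm_eq_abs, ← Complex.norm_real]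
    simp
  have h7 : φ x ^ 2 = ‖Φ x‖ ^ 2 := by simp [hΦ]
  have h8 : ‖sL (φ - besselConst • sΔ φ)‖ ≤ ‖sL φ‖ + besselConst * ‖sL (sΔ φ)‖ := by
    rw [map_sub, map_smul]
    refine (norm_sub_le _ _).trans (le_of_eq ?_)
    rw [norm_smul, Real.norm_of_nonneg besselConst_pos.le]
  have h9 : ‖sL (φ - besselConst • sΔ φ)‖ ^ 2 ≤
      2 * (1 + besselConst ^ 2) * (‖sL φ‖ ^ 2 + ‖sL (sΔ φ)‖ ^ 2) := by
    refine (pow_le_pow_left₀ (norm_nonneg _) h8 2).trans ?_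
    nlinarith [sq_nonneg (‖sL φ‖ - besselConst * ‖sL (sΔ φ)‖), sq_nonneg (besselConst * ‖sL φ‖),
      sq_nonneg (‖sL (sΔ φ)‖), sq_nonneg (‖sL φ‖)]
  calc φ x ^ 2 = ‖Φ x‖ ^ 2 := h7
    _ ≤ (∫ ξ, w ξ * ‖𝓕 Ψ ξ‖) ^ 2 := by gcongr
    _ ≤ K * ‖sL (φ - besselConst • sΔ φ)‖ ^ 2 := by
      rw [← h6, ← h5]
      exact h4
    _ ≤ K * (2 * (1 + besselConst ^ 2) * (‖sL φ‖ ^ 2 + ‖sL (sΔ φ)‖ ^ 2)) := by gcongr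
    _ = _ := by ring

theorem exists_sobolev_sup (hd : d ≤ 3) :
    ∃ C : ℝ, 0 ≤ C ∧ ∀ f g : LL d, WeakLap f g →
      ∀ᵐ x, f x ^ 2 ≤ C * (‖f‖ ^ 2 + ‖g‖ ^ 2) := by
  obtain ⟨C, hC, h⟩ := exists_schwartz_sq_le hd
  refine ⟨C, hC, fun f g hfg => ?_⟩
  obtain ⟨φ, h1, h2⟩ := hfg.exists_seq
  obtain ⟨ns, hns, hae⟩ := exists_ae_tendsto_of_tendsto_sL h1
  filter_upwards [hae] with x hx
  refine le_of_tendsto_of_tendsto' (hx.pow 2)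
    (((((h1.norm.pow 2).add (h2.norm.pow 2)).const_mul C)).comp hns.tendsto_atTop) fun n => ?_
  exact h _ x

/-! ### Testing the weak equations -/

theorem ev_two (i : Fin 2) : (ev i : Plane) = EuclideanSpace.single i 1 := rfl

theorem isTest_schwartz {φ : 𝓢(Eu 2, ℝ)} (h : HasCompactSupport φ) : IsTest φ := ⟨φ.smooth ⊤, h⟩

theorem inner_toLp_sL {f : Plane → ℝ} (hf : MemLp f 2 volume) (φ : 𝓢(Eu 2, ℝ)) :
    inner ℝ (hf.toLp f : LL 2) (sL φ) = ∫ ξ, f ξ * φ ξ := by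
  rw [inner_sL]
  refine integral_congr_ae ?_
  filter_upwards [hf.coeFn_toLp] with x hx
  rw [hx]

/-- Compactly supported test functions are dense in the Schwartz space, and both sides are
continuous there; this connects the definition through test functions with the Hilbert space
framework. -/
theorem InFormDomain.weakGrad {v : Plane → ℝ} {dv : Fin 2 → Plane → ℝ} (h : InFormDomain v dv) :
    WeakGrad (h.memLp.toLp v : LL 2) (fun i => (h.grad_memLp i).toLp (dv i)) := by
  intro i φ
  have h1 : ∀ m, inner ℝ (h.memLp.toLp v : LL 2) (sL (sD i (cutSchwartz m φ))) =
      - inner ℝ ((h.grad_memLp i).toLp (dv i) : LL 2) (sL (cutSchwartz m φ)) := by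
    intro m
    rw [inner_toLp_sL, inner_toLp_sL]
    exact h.weak_grad i _ (isTest_schwartz (hasCompactSupport_cutSchwartz m φ))
  have c1 : Continuous fun φ : 𝓢(Eu 2, ℝ) =>
      inner ℝ (h.memLp.toLp v : LL 2) (sL (sD i φ)) := by fun_prop
  have c2 : Continuous fun φ : 𝓢(Eu 2, ℝ) =>
      - inner ℝ ((h.grad_memLp i).toLp (dv i) : LL 2) (sL φ) := by fun_prop
  exact tendsto_nhds_unique (((c1.tendsto _).comp (tendsto_cutSchwartz φ)).congr h1)
    ((c2.tendsto _).comp (tendsto_cutSchwartz φ))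

theorem tendsto_integral_mul_sL {u f : Plane → ℝ} (hu : MemLp u 2 volume) (hf : MemLp f 2 volume)
    {φ : ℕ → 𝓢(Eu 2, ℝ)} (h : Tendsto (fun n => sL (φ n)) atTop (𝓝 (hf.toLp f))) :
    Tendsto (fun n => ∫ ξ, u ξ * φ n ξ) atTop (𝓝 (∫ ξ, u ξ * f ξ)) := by
  have h1 : Tendsto (fun n => inner ℝ (hu.toLp u : LL 2) (sL (φ n))) atTop
      (𝓝 (inner ℝ (hu.toLp u : LL 2) (hf.toLp f))) := tendsto_const_nhds.inner h
  have h2 : inner ℝ (hu.toLp u : LL 2) (hf.toLp f) = ∫ ξ, u ξ * f ξ := by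
    rw [inner_eq_integral]
    refine integral_congr_ae ?_
    filter_upwards [hu.coeFn_toLp, hf.coeFn_toLp] with x h3 h4
    rw [h3, h4]
  rw [h2] at h1
  exact h1.congr fun n => inner_toLp_sL hu (φ n)

theorem potential_nonneg (ξ : Plane) : 0 ≤ potential ξ := by unfold potential; positivity

theorem norm_sq_plane (ξ : Plane) : ‖ξ‖ ^ 2 = ξ 0 ^ 2 + ξ 1 ^ 2 := by
  simp [EuclideanSpace.real_norm_sq_eq]

theorem norm_sq_le_potential (ξ : Plane) : ‖ξ‖ ^ 2 ≤ potential ξ := by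
  rw [norm_sq_plane, potential]; nlinarith [sq_nonneg (ξ 0)]

theorem potential_le (ξ : Plane) : potential ξ ≤ 4 * ‖ξ‖ ^ 2 := by
  rw [norm_sq_plane, potential]; nlinarith [sq_nonneg (ξ 1)]

theorem continuous_potential : Continuous potential := by unfold potential; fun_prop

/-- A continuous compactly supported function is bounded, so multiplication preserves `L²`. -/
theorem memLp_compact_mul {f ζ : Plane → ℝ} (hf : MemLp f 2 volume)
    (hζ : Continuous ζ) (hc : HasCompactSupport ζ) : MemLp (fun ξ => ζ ξ * f ξ) 2 volume := by
  obtain ⟨C, hC⟩ := hc.exists_bound_of_continuous hζ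
  refine hf.of_le_mul (c := C) (hζ.aestronglyMeasurable.mul hf.1) (Eventually.of_forall fun ξ => ?_)
  rw [norm_mul]
  exact mul_le_mul_of_nonneg_right (hC ξ) (norm_nonneg _)

theorem hasCompactSupport_pderiv {ζ : Plane → ℝ} (h : HasCompactSupport ζ) (i : Fin 2) :
    HasCompactSupport (pderiv i ζ) :=
  h.fderiv_apply (𝕜 := ℝ) _

theorem continuous_pderiv {ζ : Plane → ℝ} (h : ContDiff ℝ ∞ ζ) (i : Fin 2) :
    Continuous (pderiv i ζ) :=
  (h.continuous_fderiv (by simp)).clm_apply continuous_const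

theorem integral_add_three {α : Type*} [MeasurableSpace α] {μ : Measure α} {a b c : α → ℝ}
    (ha : Integrable a μ) (hb : Integrable b μ) (hc : Integrable c μ) :
    ∫ x, (a x + b x + c x) ∂μ = ∫ x, a x ∂μ + ∫ x, b x ∂μ + ∫ x, c x ∂μ := by
  rw [integral_add (f := fun x => a x + b x) (ha.add hb) hc, integral_add ha hb]

theorem integral_add_five {α : Type*} [MeasurableSpace α] {μ : Measure α} {a b c d e : α → ℝ}
    (ha : Integrable a μ) (hb : Integrable b μ) (hc : Integrable c μ) (hd : Integrable d μ)
    (he : Integrable e μ) :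
    ∫ x, (a x + b x + c x + d x + e x) ∂μ =
      ∫ x, a x ∂μ + ∫ x, b x ∂μ + ∫ x, c x ∂μ + ∫ x, d x ∂μ + ∫ x, e x ∂μ := by
  rw [integral_add (f := fun x => a x + b x + c x + d x) (((ha.add hb).add hc).add hd) he,
    integral_add (f := fun x => a x + b x + c x) ((ha.add hb).add hc) hd,
    integral_add_three ha hb hc]

/-- Testing with the product `ζφ`, `φ` Schwartz, is allowed; then `φ → g` together with the
gradient. Compactness of the support of `ζ` makes every coefficient square integrable, so the limit
needs no decay. -/
theorem SolvesP0.localized {v F g : Plane → ℝ} {dv dg : Fin 2 → Plane → ℝ} {ζ : Plane → ℝ}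
    (hv : InFormDomain v dv) (h : SolvesP0 v dv F) (hF : MemLp F 2 volume)
    (hg : InFormDomain g dg) (hζ : IsTest ζ) :
    ∫ ξ, (ζ ξ * (dv 0 ξ * dg 0 ξ + dv 1 ξ * dg 1 ξ + potential ξ * v ξ * g ξ) +
      (pderiv 0 ζ ξ * dv 0 ξ + pderiv 1 ζ ξ * dv 1 ξ) * g ξ) = ∫ ξ, ζ ξ * F ξ * g ξ := by
  obtain ⟨φ, h1, h2⟩ := hg.weakGrad.exists_seq
  have m0 : ∀ i, MemLp (fun ξ => ζ ξ * dv i ξ) 2 volume := fun i =>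
    memLp_compact_mul (hv.grad_memLp i) hζ.1.continuous hζ.2
  have m1 : ∀ i, MemLp (fun ξ => pderiv i ζ ξ * dv i ξ) 2 volume := fun i =>
    memLp_compact_mul (hv.grad_memLp i) (continuous_pderiv hζ.1 i)
      (hasCompactSupport_pderiv hζ.2 i)
  have m2 : MemLp (fun ξ => (ζ ξ * potential ξ) * v ξ) 2 volume :=
    memLp_compact_mul hv.memLp (hζ.1.continuous.mul continuous_potential)
      hζ.2.mul_right
  have m3 : MemLp (fun ξ => ζ ξ * F ξ) 2 volume :=
    memLp_compact_mul hF hζ.1.continuous hζ.2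
  have key : ∀ n, (∫ ξ, (ζ ξ * dv 0 ξ) * sD 0 (φ n) ξ) + (∫ ξ, (ζ ξ * dv 1 ξ) * sD 1 (φ n) ξ)
      + (∫ ξ, (ζ ξ * potential ξ * v ξ) * φ n ξ) + (∫ ξ, (pderiv 0 ζ ξ * dv 0 ξ) * φ n ξ)
      + (∫ ξ, (pderiv 1 ζ ξ * dv 1 ξ) * φ n ξ) = ∫ ξ, (ζ ξ * F ξ) * φ n ξ := by
    intro n
    have ht : IsTest fun ξ => ζ ξ * φ n ξ := ⟨hζ.1.mul ((φ n).smooth ⊤), hζ.2.mul_right⟩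
    have h3 := h _ ht
    have hp : ∀ i ξ, pderiv i (fun ξ => ζ ξ * φ n ξ) ξ =
        ζ ξ * sD i (φ n) ξ + pderiv i ζ ξ * φ n ξ := by
      intro i ξ
      unfold pderiv
      rw [fderiv_fun_mul (hζ.1.differentiable (by simp) ξ) (φ n).differentiableAt]
      simp [sD_apply, ev_two]
      ring
    have i0 : ∀ i, Integrable fun ξ => (ζ ξ * dv i ξ) * sD i (φ n) ξ := fun i =>
      (m0 i).integrable_mul ((sD i (φ n)).memLp 2)
    have i1 : ∀ i, Integrable fun ξ => (pderiv i ζ ξ * dv i ξ) * φ n ξ := fun i =>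
      (m1 i).integrable_mul ((φ n).memLp 2)
    have i2 : Integrable fun ξ => (ζ ξ * potential ξ * v ξ) * φ n ξ :=
      m2.integrable_mul ((φ n).memLp 2)
    rw [← integral_add_five (i0 0) (i0 1) i2 (i1 0) (i1 1)]
    calc _ = ∫ ξ, (dv 0 ξ * pderiv 0 (fun ξ => ζ ξ * φ n ξ) ξ +
            dv 1 ξ * pderiv 1 (fun ξ => ζ ξ * φ n ξ) ξ + potential ξ * v ξ * (ζ ξ * φ n ξ)) := by
          congr 1
          ext ξ
          simp only [hp]
          ring
      _ = _ := h3
      _ = _ := by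
          congr 1
          ext ξ
          ring
  have l0 : ∀ i, Tendsto (fun n => ∫ ξ, (ζ ξ * dv i ξ) * sD i (φ n) ξ) atTop
      (𝓝 (∫ ξ, (ζ ξ * dv i ξ) * dg i ξ)) := fun i =>
    tendsto_integral_mul_sL (m0 i) (hg.grad_memLp i) (h2 i)
  have l1 : ∀ i, Tendsto (fun n => ∫ ξ, (pderiv i ζ ξ * dv i ξ) * φ n ξ) atTop
      (𝓝 (∫ ξ, (pderiv i ζ ξ * dv i ξ) * g ξ)) := fun i =>
    tendsto_integral_mul_sL (m1 i) hg.memLp h1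
  have l2 := tendsto_integral_mul_sL m2 hg.memLp h1
  have l3 := tendsto_integral_mul_sL m3 hg.memLp h1
  have hlim := tendsto_nhds_unique
    ((((((l0 0).add (l0 1)).add l2).add (l1 0)).add (l1 1)).congr key) l3
  have i0 : ∀ i, Integrable fun ξ => (ζ ξ * dv i ξ) * dg i ξ := fun i =>
    (m0 i).integrable_mul (hg.grad_memLp i)
  have i1 : ∀ i, Integrable fun ξ => (pderiv i ζ ξ * dv i ξ) * g ξ := fun i =>
    (m1 i).integrable_mul hg.memLp
  have i2 : Integrable fun ξ => (ζ ξ * potential ξ * v ξ) * g ξ := m2.integrable_mul hg.memLp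
  rw [← integral_add_five (i0 0) (i0 1) i2 (i1 0) (i1 1)] at hlim
  rw [← hlim]
  congr 1
  ext ξ
  ring

theorem exists_abs_pderiv_cutoff_le :
    ∃ C : ℝ, 0 ≤ C ∧ ∀ (n : ℕ) (i : Fin 2) (ξ : Plane), |pderiv i (cutoff n) ξ| ≤ C := by
  obtain ⟨C, hC, h⟩ := exists_norm_iteratedFDeriv_cutoff_le (E := Plane) 1
  refine ⟨C, hC, fun n i ξ => ?_⟩
  have h1 : ‖fderiv ℝ (cutoff n : Plane → ℝ) ξ‖ ≤ C := by
    rw [← norm_iteratedFDeriv_one]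
    exact h n ξ
  calc |pderiv i (cutoff n) ξ| ≤ ‖fderiv ℝ (cutoff n : Plane → ℝ) ξ‖ *
        ‖(EuclideanSpace.single i 1 : Plane)‖ := (fderiv ℝ (cutoff n) ξ).le_opNorm _
    _ ≤ C := by simpa using h1

theorem isTest_cutoff (n : ℕ) : IsTest (cutoff n : Plane → ℝ) :=
  ⟨contDiff_cutoff n, hasCompactSupport_cutoff n⟩

theorem eventually_cutoff_eq_one (ξ : Plane) :
    ∀ᶠ n : ℕ in atTop, cutoff n ξ = 1 ∧ ∀ i, pderiv i (cutoff n) ξ = 0 := by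
  filter_upwards [eventually_ge_atTop ⌈‖ξ‖⌉₊] with n hn
  have h1 : ‖ξ‖ < n + 1 := by
    have := Nat.ceil_le.1 hn
    linarith
  refine ⟨cutoff_eq_one h1.le, fun i => ?_⟩
  have h2 : (cutoff n : Plane → ℝ) =ᶠ[𝓝 ξ] fun _ => 1 := by
    filter_upwards [(isOpen_lt continuous_norm continuous_const).mem_nhds h1] with y hy
    exact cutoff_eq_one (le_of_lt hy)
  rw [pderiv, h2.fderiv_eq]
  simp

theorem InFormDomain.integrable_potential_mul {v g : Plane → ℝ} {dv dg : Fin 2 → Plane → ℝ}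
    (hv : InFormDomain v dv) (hg : InFormDomain g dg) :
    Integrable fun ξ => potential ξ * v ξ * g ξ := by
  have h1 : Integrable fun ξ => (‖ξ‖ * v ξ) * (‖ξ‖ * g ξ) :=
    hv.moment_memLp.integrable_mul hg.moment_memLp
  refine (h1.norm.const_mul 4).mono' ?_ (Eventually.of_forall fun ξ => ?_)
  · exact (continuous_potential.aestronglyMeasurable.mul hv.memLp.1).mul hg.memLp.1
  · have := potential_le ξ
    have h0 := potential_nonneg ξ
    simp only [norm_mul, Real.norm_of_nonneg h0, norm_norm]
    calc potential ξ * ‖v ξ‖ * ‖g ξ‖ ≤ (4 * ‖ξ‖ ^ 2) * ‖v ξ‖ * ‖g ξ‖ := by gcongr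
      _ = _ := by ring

/-- Weak solutions may be tested with arbitrary elements of the form domain. -/
theorem SolvesP0.test {v F g : Plane → ℝ} {dv dg : Fin 2 → Plane → ℝ}
    (hv : InFormDomain v dv) (h : SolvesP0 v dv F) (hF : MemLp F 2 volume)
    (hg : InFormDomain g dg) :
    ∫ ξ, (dv 0 ξ * dg 0 ξ + dv 1 ξ * dg 1 ξ + potential ξ * v ξ * g ξ) = ∫ ξ, F ξ * g ξ := by
  obtain ⟨C, hC, hcut⟩ := exists_abs_pderiv_cutoff_le
  have i0 : Integrable fun ξ => dv 0 ξ * dg 0 ξ + dv 1 ξ * dg 1 ξ + potential ξ * v ξ * g ξ :=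
    (((hv.grad_memLp 0).integrable_mul (hg.grad_memLp 0)).add
      ((hv.grad_memLp 1).integrable_mul (hg.grad_memLp 1))).add (hv.integrable_potential_mul hg)
  have i1 : ∀ i, Integrable fun ξ => dv i ξ * g ξ := fun i =>
    (hv.grad_memLp i).integrable_mul hg.memLp
  have i2 : Integrable fun ξ => F ξ * g ξ := hF.integrable_mul hg.memLp
  have hl : Tendsto (fun n => ∫ ξ, (cutoff n ξ * (dv 0 ξ * dg 0 ξ + dv 1 ξ * dg 1 ξ +
      potential ξ * v ξ * g ξ) + (pderiv 0 (cutoff n) ξ * dv 0 ξ + pderiv 1 (cutoff n) ξ * dv 1 ξ)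
      * g ξ)) atTop
      (𝓝 (∫ ξ, (dv 0 ξ * dg 0 ξ + dv 1 ξ * dg 1 ξ + potential ξ * v ξ * g ξ))) := by
    refine tendsto_integral_of_dominated_convergence
      (fun ξ => ‖dv 0 ξ * dg 0 ξ + dv 1 ξ * dg 1 ξ + potential ξ * v ξ * g ξ‖ +
        C * (‖dv 0 ξ * g ξ‖ + ‖dv 1 ξ * g ξ‖)) (fun n => ?_)
      (i0.norm.add (((i1 0).norm.add (i1 1).norm).const_mul C)) (fun n => ?_) ?_
    · refine (((contDiff_cutoff n).continuous.aestronglyMeasurable).mul i0.1).add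
        (((((continuous_pderiv (contDiff_cutoff n) 0).aestronglyMeasurable).mul
          (hv.grad_memLp 0).1).add ((((continuous_pderiv (contDiff_cutoff n) 1).aestronglyMeasurable).mul
          (hv.grad_memLp 1).1))).mul hg.memLp.1)
    · refine Eventually.of_forall fun ξ => ?_
      refine (norm_add_le _ _).trans (add_le_add ?_ ?_)
      · rw [norm_mul, Real.norm_of_nonneg (cutoff_nonneg n ξ)]
        exact mul_le_of_le_one_left (norm_nonneg _) (cutoff_le_one n ξ)
      · rw [add_mul, mul_add]
        refine (norm_add_le _ _).trans (add_le_add ?_ ?_)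
        · rw [mul_assoc, norm_mul]
          exact mul_le_mul_of_nonneg_right (hcut n 0 ξ) (norm_nonneg _)
        · rw [mul_assoc, norm_mul]
          exact mul_le_mul_of_nonneg_right (hcut n 1 ξ) (norm_nonneg _)
    · refine Eventually.of_forall fun ξ => tendsto_const_nhds.congr' ?_
      filter_upwards [eventually_cutoff_eq_one ξ] with n hn
      rw [hn.1, hn.2, hn.2]
      ring
  have hr : Tendsto (fun n => ∫ ξ, cutoff n ξ * F ξ * g ξ) atTop (𝓝 (∫ ξ, F ξ * g ξ)) := by
    refine tendsto_integral_of_dominated_convergence (fun ξ => ‖F ξ * g ξ‖) (fun n => ?_)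
      i2.norm (fun n => ?_) ?_
    · exact (((contDiff_cutoff n).continuous.aestronglyMeasurable).mul hF.1).mul hg.memLp.1
    · refine Eventually.of_forall fun ξ => ?_
      rw [mul_assoc, norm_mul, Real.norm_of_nonneg (cutoff_nonneg n ξ)]
      exact mul_le_of_le_one_left (norm_nonneg _) (cutoff_le_one n ξ)
    · refine Eventually.of_forall fun ξ => tendsto_const_nhds.congr' ?_
      filter_upwards [eventually_cutoff_eq_one ξ] with n hn
      rw [hn.1, one_mul]
  exact tendsto_nhds_unique
    (hl.congr fun n => SolvesP0.localized hv h hF hg (isTest_cutoff n)) hr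

/-- The weak Laplacian of a weak solution with enough decay. -/
theorem SolvesP0.weakLap {v F : Plane → ℝ} {dv : Fin 2 → Plane → ℝ}
    (hv : InFormDomain v dv) (h : SolvesP0 v dv F)
    (hG : MemLp (fun ξ => potential ξ * v ξ - F ξ) 2 volume) (hF : MemLp F 2 volume) :
    WeakLap (hv.memLp.toLp v : LL 2) (hG.toLp _) := by
  have hpv : MemLp (fun ξ => potential ξ * v ξ) 2 volume := by
    refine (hG.add hF).congr_norm ?_ ?_
    · exact continuous_potential.aestronglyMeasurable.mul hv.memLp.1
    · exact Eventually.of_forall fun ξ => by simp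
  have h1 : ∀ φ : 𝓢(Eu 2, ℝ), HasCompactSupport φ →
      inner ℝ (hv.memLp.toLp v : LL 2) (sL (sΔ φ)) = inner ℝ (hG.toLp _ : LL 2) (sL φ) := by
    intro φ hφ
    have h2 := h φ (isTest_schwartz hφ)
    have hw := hv.weakGrad
    rw [sΔ_eq_sum, map_sum, inner_sum, Fin.sum_univ_two, hw 0, hw 1, inner_toLp_sL, inner_toLp_sL,
      inner_toLp_sL]
    have i0 : ∀ i, Integrable fun ξ => dv i ξ * sD i φ ξ := fun i =>
      (hv.grad_memLp i).integrable_mul ((sD i φ).memLp 2)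
    have i2 : Integrable fun ξ => potential ξ * v ξ * φ ξ := hpv.integrable_mul (φ.memLp 2)
    have i3 : Integrable fun ξ => F ξ * φ ξ := hF.integrable_mul (φ.memLp 2)
    have h3 : ∫ ξ, (dv 0 ξ * sD 0 φ ξ + dv 1 ξ * sD 1 φ ξ + potential ξ * v ξ * φ ξ) =
      ∫ ξ, F ξ * φ ξ := h2
    rw [integral_add_three (i0 0) (i0 1) i2] at h3
    simp_rw [sub_mul]
    rw [integral_sub i2 i3]
    linarith
  intro φ
  have c1 : Continuous fun φ : 𝓢(Eu 2, ℝ) =>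
      inner ℝ (hv.memLp.toLp v : LL 2) (sL (sΔ φ)) := by fun_prop
  have c2 : Continuous fun φ : 𝓢(Eu 2, ℝ) => inner ℝ (hG.toLp _ : LL 2) (sL φ) := by fun_prop
  exact tendsto_nhds_unique (((c1.tendsto _).comp (tendsto_cutSchwartz φ)).congr
    fun n => h1 _ (hasCompactSupport_cutSchwartz n φ))
    ((c2.tendsto _).comp (tendsto_cutSchwartz φ))

/-! ### Weighted estimates -/

/-- The weight `1 + |ξ|²`. -/
def wt (ξ : Plane) : ℝ := 1 + ‖ξ‖ ^ 2

theorem one_le_wt (ξ : Plane) : 1 ≤ wt ξ := by unfold wt; nlinarith [sq_nonneg ‖ξ‖]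

theorem wt_pos (ξ : Plane) : 0 < wt ξ := one_pos.trans_le (one_le_wt ξ)

theorem contDiff_wt : ContDiff ℝ ∞ wt := contDiff_const.add (contDiff_norm_sq ℝ)

theorem continuous_wt : Continuous wt := contDiff_wt.continuous

theorem pderiv_wt (i : Fin 2) (ξ : Plane) : pderiv i wt ξ = 2 * ξ i := by
  unfold pderiv
  have : wt = fun ξ : Plane => 1 + ‖ξ‖ ^ 2 := rfl
  rw [this, fderiv_const_add, fderiv_norm_sq_apply]
  simp [EuclideanSpace.inner_single_right]

theorem sq_coord_le_wt (i : Fin 2) (ξ : Plane) : ξ i ^ 2 ≤ wt ξ := by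
  rw [wt, norm_sq_plane]
  fin_cases i
  · simp; nlinarith [sq_nonneg (ξ 1)]
  · simp; nlinarith [sq_nonneg (ξ 0)]

/-- Fatou's lemma, used to remove the spatial truncation from the weights. -/
theorem integrable_of_tendsto_of_integral_le {α : Type*} [MeasurableSpace α] {μ : Measure α}
    {F : ℕ → α → ℝ} {f : α → ℝ} {B : ℝ} (hF : ∀ n, Integrable (F n) μ) (h0 : ∀ n x, 0 ≤ F n x)
    (hB : ∀ n, ∫ x, F n x ∂μ ≤ B) (hlim : ∀ᵐ x ∂μ, Tendsto (fun n => F n x) atTop (𝓝 (f x))) :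
    Integrable f μ ∧ ∫ x, f x ∂μ ≤ B := by
  have hm : AEStronglyMeasurable f μ :=
    aestronglyMeasurable_of_tendsto_ae atTop (fun n => (hF n).1) hlim
  have hf0 : ∀ᵐ x ∂μ, 0 ≤ f x := hlim.mono fun x hx => ge_of_tendsto' hx fun n => h0 n x
  have hB0 : 0 ≤ B := (integral_nonneg (h0 0)).trans (hB 0)
  have key : ∫⁻ x, ENNReal.ofReal (f x) ∂μ ≤ ENNReal.ofReal B := by
    have h1 : ∫⁻ x, ENNReal.ofReal (f x) ∂μ ≤
        ∫⁻ x, liminf (fun n => ENNReal.ofReal (F n x)) atTop ∂μ := by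
      refine lintegral_mono_ae ?_
      filter_upwards [hlim] with x hx
      rw [((ENNReal.continuous_ofReal.tendsto _).comp hx).liminf_eq.symm]
      rfl
    refine h1.trans ((lintegral_liminf_le' fun n => ?_).trans ?_)
    · exact (hF n).1.aemeasurable.ennreal_ofReal
    · refine (liminf_le_liminf (v := fun _ => ENNReal.ofReal B)
        (Eventually.of_forall fun n => ?_)).trans (by simp)
      change ∫⁻ x, ENNReal.ofReal (F n x) ∂μ ≤ ENNReal.ofReal B
      rw [← ofReal_integral_eq_lintegral_ofReal (hF _) (Eventually.of_forall (h0 n))]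
      exact ENNReal.ofReal_le_ofReal (hB n)
  have hInt : Integrable f μ := by
    refine ⟨hm, ?_⟩
    rw [hasFiniteIntegral_iff_ofReal hf0]
    exact key.trans_lt ENNReal.ofReal_lt_top
  refine ⟨hInt, ?_⟩
  rw [← ofReal_integral_eq_lintegral_ofReal hInt hf0] at key
  exact (ENNReal.ofReal_le_ofReal_iff hB0).1 key

/-- The truncated polynomial weights. -/
def cutWeight (N m : ℕ) (ξ : Plane) : ℝ := wt ξ ^ N * cutoff m ξ ^ 2

theorem isTest_cutWeight (N m : ℕ) : IsTest (cutWeight N m) := by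
  refine ⟨(contDiff_wt.pow N).mul ((contDiff_cutoff m).pow 2), ?_⟩
  have : HasCompactSupport fun ξ : Plane => cutoff m ξ ^ 2 :=
    (hasCompactSupport_cutoff m).comp_left (g := fun y : ℝ => y ^ 2) (by simp)
  exact this.mul_left

theorem cutWeight_nonneg (N m : ℕ) (ξ : Plane) : 0 ≤ cutWeight N m ξ :=
  mul_nonneg (pow_nonneg (wt_pos ξ).le _) (sq_nonneg _)

theorem cutWeight_le (N m : ℕ) (ξ : Plane) : cutWeight N m ξ ≤ wt ξ ^ N :=
  mul_le_of_le_one_right (pow_nonneg (wt_pos ξ).le _)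
    (pow_le_one₀ (cutoff_nonneg m ξ) (cutoff_le_one m ξ))

theorem pderiv_cutWeight (N m : ℕ) (i : Fin 2) (ξ : Plane) :
    pderiv i (cutWeight N m) ξ = N * wt ξ ^ (N - 1) * (2 * ξ i) * cutoff m ξ ^ 2 +
      wt ξ ^ N * (2 * cutoff m ξ * pderiv i (cutoff m) ξ) := by
  have h1 : DifferentiableAt ℝ wt ξ := contDiff_wt.differentiable (by simp) ξ
  have h2 : DifferentiableAt ℝ (cutoff m : Plane → ℝ) ξ :=
    (contDiff_cutoff m).differentiable (by simp) ξ
  have e := pderiv_wt i ξ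
  unfold pderiv at e ⊢
  have : cutWeight N m = fun ξ => wt ξ ^ N * cutoff m ξ ^ 2 := rfl
  rw [this, fderiv_fun_mul (h1.fun_pow N) (h2.fun_pow 2), fderiv_fun_pow _ h1, fderiv_fun_pow _ h2]
  simp [e]
  ring

/-- The cutoff enters `cutWeight` squared so that a derivative still carries one factor of it; the
square of the derivative is then controlled by the truncated weight itself, uniformly in the
truncation `m`. The derivative of the polynomial factor is harmless because `ξᵢ² ≤ wt ξ`. -/
theorem exists_pderiv_cutWeight_sq_le (N : ℕ) :
    ∃ K : ℝ, 0 ≤ K ∧ ∀ (m : ℕ) (i : Fin 2) (ξ : Plane),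
      pderiv i (cutWeight N m) ξ ^ 2 ≤ K * wt ξ ^ N * cutWeight N m ξ := by
  obtain ⟨C, hC, hcut⟩ := exists_abs_pderiv_cutoff_le
  refine ⟨8 * N ^ 2 + 8 * C ^ 2, by positivity, fun m i ξ => ?_⟩
  rw [pderiv_cutWeight, cutWeight]
  set w := wt ξ
  set c := cutoff m ξ
  have hw : 1 ≤ w := one_le_wt ξ
  have hc0 : 0 ≤ c := cutoff_nonneg m ξ
  have hc1 : c ≤ 1 := cutoff_le_one m ξ
  have hd : pderiv i (cutoff m) ξ ^ 2 ≤ C ^ 2 := sq_le_sq' (neg_le_of_abs_le (hcut m i ξ))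
    (le_of_abs_le (hcut m i ξ))
  have hx : ξ i ^ 2 ≤ w := sq_coord_le_wt i ξ
  have hcc : c ^ 4 ≤ c ^ 2 := pow_le_pow_of_le_one hc0 hc1 (by norm_num)
  have hN : (N * w ^ (N - 1)) ^ 2 * w ≤ N ^ 2 * (w ^ N) ^ 2 := by
    rcases N with _ | n
    · simp
    · simp only [Nat.add_sub_cancel]
      have : w ^ n * w ^ n * w ≤ w ^ (n + 1) * w ^ (n + 1) := by
        rw [pow_succ]
        have : 0 ≤ w ^ n := by positivity
        nlinarith [mul_nonneg (mul_nonneg this this) (mul_nonneg (by linarith) (by linarith) : 0 ≤ w * (w - 1))]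
      have h2 : (0 : ℝ) ≤ ((n + 1 : ℕ) : ℝ) ^ 2 := by positivity
      nlinarith [mul_le_mul_of_nonneg_left this h2]
  have h1 : (N * w ^ (N - 1) * (2 * ξ i) * c ^ 2) ^ 2 ≤ 4 * N ^ 2 * (w ^ N * (w ^ N * c ^ 2)) := by
    calc (N * w ^ (N - 1) * (2 * ξ i) * c ^ 2) ^ 2
        = 4 * ((N * w ^ (N - 1)) ^ 2 * ξ i ^ 2) * c ^ 4 := by ring
      _ ≤ 4 * ((N * w ^ (N - 1)) ^ 2 * w) * c ^ 2 := by gcongr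
      _ ≤ 4 * (N ^ 2 * (w ^ N) ^ 2) * c ^ 2 := by gcongr
      _ = _ := by ring
  have h2 : (w ^ N * (2 * c * pderiv i (cutoff m) ξ)) ^ 2 ≤
      4 * C ^ 2 * (w ^ N * (w ^ N * c ^ 2)) := by
    calc (w ^ N * (2 * c * pderiv i (cutoff m) ξ)) ^ 2
        = 4 * (w ^ N) ^ 2 * c ^ 2 * pderiv i (cutoff m) ξ ^ 2 := by ring
      _ ≤ 4 * (w ^ N) ^ 2 * c ^ 2 * C ^ 2 := by gcongr
      _ = _ := by ring
  refine add_sq_le.trans ?_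
  linarith

/-- Test the equation with `ηv`, where `η` is a truncated weight. The terms with `∇η` are absorbed
into half of the gradient energy by `exists_pderiv_cutWeight_sq_le`, and `Fv ≤ wv²/2 + F²/(2w)` is
absorbed into half of the potential energy, since the potential is at least `w - 1`. Letting the
truncation tend to infinity gains one power of the weight for `v`, while the source needs one power
less. -/
theorem exists_weighted_step (N : ℕ) :
    ∃ C : ℝ, 0 ≤ C ∧ ∀ (v F : Plane → ℝ) (dv : Fin 2 → Plane → ℝ), InFormDomain v dv →
      SolvesP0 v dv F → MemLp F 2 volume → Integrable (fun ξ => wt ξ ^ N * v ξ ^ 2) →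
      Integrable (fun ξ => wt ξ ^ N * F ξ ^ 2 / wt ξ) →
      Integrable (fun ξ => wt ξ ^ N * (dv 0 ξ ^ 2 + dv 1 ξ ^ 2) + wt ξ ^ (N + 1) * v ξ ^ 2) ∧
      ∫ ξ, (wt ξ ^ N * (dv 0 ξ ^ 2 + dv 1 ξ ^ 2) + wt ξ ^ (N + 1) * v ξ ^ 2) ≤
        C * ((∫ ξ, wt ξ ^ N * v ξ ^ 2) + ∫ ξ, wt ξ ^ N * F ξ ^ 2 / wt ξ) := by
  obtain ⟨K, hK, hKb⟩ := exists_pderiv_cutWeight_sq_le N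
  refine ⟨2 * (1 + K), by positivity, fun v F dv hv hs hF hi1 hi2 => ?_⟩
  have ht := isTest_cutWeight N
  have m0 : ∀ m i, Integrable fun ξ => cutWeight N m ξ * dv i ξ * dv i ξ := fun m i =>
    (memLp_compact_mul (hv.grad_memLp i) (ht m).1.continuous (ht m).2).integrable_mul
      (hv.grad_memLp i)
  have m1 : ∀ m i, Integrable fun ξ => pderiv i (cutWeight N m) ξ * dv i ξ * v ξ := fun m i =>
    (memLp_compact_mul (hv.grad_memLp i) (continuous_pderiv (ht m).1 i)
      (hasCompactSupport_pderiv (ht m).2 i)).integrable_mul hv.memLp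
  have m2 : ∀ m, Integrable fun ξ => (cutWeight N m ξ * potential ξ) * v ξ * v ξ := fun m =>
    (memLp_compact_mul hv.memLp ((ht m).1.continuous.mul continuous_potential)
      (ht m).2.mul_right).integrable_mul hv.memLp
  have m2' : ∀ m, Integrable fun ξ => (cutWeight N m ξ * wt ξ) * v ξ * v ξ := fun m =>
    (memLp_compact_mul hv.memLp ((ht m).1.continuous.mul continuous_wt)
      (ht m).2.mul_right).integrable_mul hv.memLp
  have m3 : ∀ m, Integrable fun ξ => cutWeight N m ξ * F ξ * v ξ := fun m =>
    (memLp_compact_mul hF (ht m).1.continuous (ht m).2).integrable_mul hv.memLp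
  let G : ℕ → Plane → ℝ := fun m ξ =>
    cutWeight N m ξ * (dv 0 ξ ^ 2 + dv 1 ξ ^ 2 + wt ξ * v ξ ^ 2)
  let Q : ℕ → Plane → ℝ := fun m ξ =>
    cutWeight N m ξ * (dv 0 ξ * dv 0 ξ + dv 1 ξ * dv 1 ξ + potential ξ * v ξ * v ξ) +
      (pderiv 0 (cutWeight N m) ξ * dv 0 ξ + pderiv 1 (cutWeight N m) ξ * dv 1 ξ) * v ξ
  have hG : ∀ m, Integrable (G m) := fun m =>
    (((m0 m 0).add (m0 m 1)).add (m2' m)).congr (Eventually.of_forall fun ξ => by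
      simp only [G, Pi.add_apply]; ring)
  have hQ : ∀ m, Integrable (Q m) := fun m =>
    (((((m0 m 0).add (m0 m 1)).add (m2 m)).add (m1 m 0)).add (m1 m 1)).congr
      (Eventually.of_forall fun ξ => by simp only [Q, Pi.add_apply]; ring)
  have hQF : ∀ m, ∫ ξ, Q m ξ = ∫ ξ, cutWeight N m ξ * F ξ * v ξ := fun m =>
    SolvesP0.localized hv hs hF hv (ht m)
  have hpt : ∀ m ξ, G m ξ ≤ 2 * (Q m ξ - cutWeight N m ξ * F ξ * v ξ) +
      (2 * (1 + K) * (wt ξ ^ N * v ξ ^ 2) + wt ξ ^ N * F ξ ^ 2 / wt ξ) := by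
    intro m ξ
    simp only [G, Q]
    set η := cutWeight N m ξ
    have hη0 : 0 ≤ η := cutWeight_nonneg N m ξ
    have hη1 : η ≤ wt ξ ^ N := cutWeight_le N m ξ
    have hw := wt_pos ξ
    have hp : wt ξ - 1 ≤ potential ξ := by
      have := norm_sq_le_potential ξ
      unfold wt; linarith
    have hcross : ∀ i, -(pderiv i (cutWeight N m) ξ * dv i ξ * v ξ) ≤
        1 / 2 * (η * dv i ξ ^ 2) + 1 / 2 * (K * wt ξ ^ N * v ξ ^ 2) := by
      intro i
      set p := pderiv i (cutWeight N m) ξ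
      have h1 : p ^ 2 ≤ K * wt ξ ^ N * η := hKb m i ξ
      have ha : 0 ≤ η * dv i ξ ^ 2 := by positivity
      have hb : 0 ≤ K * wt ξ ^ N * v ξ ^ 2 := by positivity
      have h2 : (p * dv i ξ * v ξ) ^ 2 ≤ (η * dv i ξ ^ 2) * (K * wt ξ ^ N * v ξ ^ 2) := by
        calc (p * dv i ξ * v ξ) ^ 2 = p ^ 2 * (dv i ξ ^ 2 * v ξ ^ 2) := by ring
          _ ≤ K * wt ξ ^ N * η * (dv i ξ ^ 2 * v ξ ^ 2) := by gcongr
          _ = _ := by ring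
      have h3 : (p * dv i ξ * v ξ) ^ 2 ≤
          (1 / 2 * (η * dv i ξ ^ 2) + 1 / 2 * (K * wt ξ ^ N * v ξ ^ 2)) ^ 2 := by
        nlinarith [sq_nonneg (η * dv i ξ ^ 2 - K * wt ξ ^ N * v ξ ^ 2)]
      have h4 := abs_le_of_sq_le_sq h3 (by positivity)
      linarith [neg_abs_le (p * dv i ξ * v ξ)]
    have hFv : η * F ξ * v ξ ≤ 1 / 2 * (η * wt ξ * v ξ ^ 2) + 1 / 2 * (η * F ξ ^ 2 / wt ξ) := by
      have e : 1 / 2 * (η * wt ξ * v ξ ^ 2) + 1 / 2 * (η * F ξ ^ 2 / wt ξ) - η * F ξ * v ξ =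
          1 / 2 * (η / wt ξ) * (wt ξ * v ξ - F ξ) ^ 2 := by
        field_simp
        ring
      have : 0 ≤ 1 / 2 * (η / wt ξ) * (wt ξ * v ξ - F ξ) ^ 2 := by positivity
      linarith
    have hF2 : η * F ξ ^ 2 / wt ξ ≤ wt ξ ^ N * F ξ ^ 2 / wt ξ := by gcongr
    have hv2 : η * v ξ ^ 2 ≤ wt ξ ^ N * v ξ ^ 2 := by gcongr
    have hpv : η * ((wt ξ - 1) * v ξ ^ 2) ≤ η * (potential ξ * v ξ ^ 2) := by gcongr
    have c0 := hcross 0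
    have c1 := hcross 1
    nlinarith [c0, c1, hFv, hF2, hv2, hpv]
  have hbound : ∀ m, ∫ ξ, G m ξ ≤
      2 * (1 + K) * ((∫ ξ, wt ξ ^ N * v ξ ^ 2) + ∫ ξ, wt ξ ^ N * F ξ ^ 2 / wt ξ) := by
    intro m
    have j1 : Integrable fun ξ => 2 * (Q m ξ - cutWeight N m ξ * F ξ * v ξ) :=
      ((hQ m).sub (m3 m)).const_mul 2
    have j2 : Integrable fun ξ =>
        2 * (1 + K) * (wt ξ ^ N * v ξ ^ 2) + wt ξ ^ N * F ξ ^ 2 / wt ξ :=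
      (hi1.const_mul _).add hi2
    have h1 := integral_mono (hG m) (j1.add j2) (hpt m)
    simp only [Pi.add_apply] at h1
    rw [integral_add j1 j2, integral_const_mul, integral_sub (hQ m) (m3 m), hQF, sub_self, mul_zero,
      zero_add, integral_add (hi1.const_mul _) hi2, integral_const_mul] at h1
    have h2 : 0 ≤ ∫ ξ, wt ξ ^ N * F ξ ^ 2 / wt ξ := integral_nonneg fun ξ => by
      have := wt_pos ξ
      positivity
    nlinarith
  have hfin := integrable_of_tendsto_of_integral_le hG
    (fun m ξ => mul_nonneg (cutWeight_nonneg N m ξ) (by have := wt_pos ξ; positivity)) hbound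
    (f := fun ξ => wt ξ ^ N * (dv 0 ξ ^ 2 + dv 1 ξ ^ 2) + wt ξ ^ (N + 1) * v ξ ^ 2)
    (Eventually.of_forall fun ξ => by
      refine tendsto_const_nhds.congr' ?_
      filter_upwards [eventually_cutoff_eq_one ξ] with n hn
      simp only [G, cutWeight, hn.1]
      ring)
  exact hfin

/-! ### Families of functions with uniform weighted bounds -/

section Families

variable {ι : Type*}

/-- A uniformly bounded family of numbers. -/
def UR (e : ι → ℝ) : Prop := ∃ C : ℝ, ∀ i, |e i| ≤ C

/-- A family of functions with a uniform essential bound. -/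
def US (f : ι → Plane → ℝ) : Prop := ∃ C : ℝ, ∀ i, ∀ᵐ ξ, |f i ξ| ≤ C

/-- A family of functions bounded in `L²` with the weight `(1 + |ξ|²) ^ N`. -/
def UW (N : ℕ) (f : ι → Plane → ℝ) : Prop :=
  ∃ C : ℝ, ∀ i, AEStronglyMeasurable (f i) volume ∧ Integrable (fun ξ => wt ξ ^ N * f i ξ ^ 2) ∧
    ∫ ξ, wt ξ ^ N * f i ξ ^ 2 ≤ C

theorem UR.const (c : ℝ) : UR fun _ : ι => c := ⟨|c|, fun _ => le_rfl⟩

theorem UR.mul {e e' : ι → ℝ} (h : UR e) (h' : UR e') : UR fun i => e i * e' i := by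
  obtain ⟨C, hC⟩ := h
  obtain ⟨C', hC'⟩ := h'
  refine ⟨C * C', fun i => ?_⟩
  rw [abs_mul]
  exact mul_le_mul (hC i) (hC' i) (abs_nonneg _) ((abs_nonneg _).trans (hC i))

theorem UR.add {e e' : ι → ℝ} (h : UR e) (h' : UR e') : UR fun i => e i + e' i := by
  obtain ⟨C, hC⟩ := h
  obtain ⟨C', hC'⟩ := h'
  exact ⟨C + C', fun i => (abs_add_le _ _).trans (add_le_add (hC i) (hC' i))⟩

theorem UR.sub {e e' : ι → ℝ} (h : UR e) (h' : UR e') : UR fun i => e i - e' i := by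
  obtain ⟨C, hC⟩ := h
  obtain ⟨C', hC'⟩ := h'
  exact ⟨C + C', fun i => (abs_sub _ _).trans (add_le_add (hC i) (hC' i))⟩

/-- A pointwise factor `wt ^ m` costs `2 * m` powers because the norm is quadratic. As every order
of decay will be available, polynomial factors are free. -/
theorem UW.dominated {N m : ℕ} {f g : ι → Plane → ℝ} {K : ℝ} (hg : UW (N + 2 * m) g)
    (hf : ∀ i, AEStronglyMeasurable (f i) volume)
    (h : ∀ i, ∀ᵐ ξ, |f i ξ| ≤ K * wt ξ ^ m * |g i ξ|) : UW N f := by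
  obtain ⟨C, hC⟩ := hg
  refine ⟨K ^ 2 * C, fun i => ?_⟩
  obtain ⟨h1, h2, h3⟩ := hC i
  have hle : ∀ᵐ ξ, wt ξ ^ N * f i ξ ^ 2 ≤ K ^ 2 * (wt ξ ^ (N + 2 * m) * g i ξ ^ 2) := by
    filter_upwards [h i] with ξ hξ
    have hw := wt_pos ξ
    have := pow_le_pow_left₀ (abs_nonneg _) hξ 2
    rw [sq_abs, mul_pow, mul_pow, sq_abs] at this
    calc wt ξ ^ N * f i ξ ^ 2 ≤ wt ξ ^ N * (K ^ 2 * (wt ξ ^ m) ^ 2 * g i ξ ^ 2) := by gcongr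
      _ = _ := by ring
  have hint : Integrable fun ξ => wt ξ ^ N * f i ξ ^ 2 := by
    refine (h2.const_mul (K ^ 2)).mono' ?_ ?_
    · exact (continuous_wt.pow N).aestronglyMeasurable.mul ((hf i).pow 2)
    · filter_upwards [hle] with ξ hξ
      rwa [Real.norm_of_nonneg (by have := wt_pos ξ; positivity)]
  refine ⟨hf i, hint, ?_⟩
  refine (integral_mono_ae hint (h2.const_mul _) hle).trans ?_
  rw [integral_const_mul]
  gcongr

theorem UW.mono {N N' : ℕ} {f : ι → Plane → ℝ} (h : UW N' f) (hN : N ≤ N') : UW N f := by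
  obtain ⟨C, hC⟩ := h
  refine ⟨C, fun i => ?_⟩
  obtain ⟨h1, h2, h3⟩ := hC i
  have hle : ∀ ξ, wt ξ ^ N * f i ξ ^ 2 ≤ wt ξ ^ N' * f i ξ ^ 2 := fun ξ =>
    mul_le_mul_of_nonneg_right (pow_le_pow_right₀ (one_le_wt ξ) hN) (sq_nonneg _)
  have hint : Integrable fun ξ => wt ξ ^ N * f i ξ ^ 2 := by
    refine h2.mono' ?_ (Eventually.of_forall fun ξ => ?_)
    · exact (continuous_wt.pow N).aestronglyMeasurable.mul (h1.pow 2)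
    · rw [Real.norm_of_nonneg (by have := wt_pos ξ; positivity)]
      exact hle ξ
  exact ⟨h1, hint, (integral_mono hint h2 hle).trans h3⟩

theorem UW.memLp {N : ℕ} {f : ι → Plane → ℝ} (h : UW N f) (i : ι) : MemLp (f i) 2 volume := by
  obtain ⟨C, hC⟩ := h.mono (Nat.zero_le N)
  obtain ⟨h1, h2, -⟩ := hC i
  exact (memLp_two_iff_integrable_sq h1).2 (by simpa using h2)

theorem UW.aesm {N : ℕ} {f : ι → Plane → ℝ} (h : UW N f) (i : ι) :
    AEStronglyMeasurable (f i) volume := (h.memLp i).1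

theorem UW.add {N : ℕ} {f g : ι → Plane → ℝ} (hf : UW N f) (hg : UW N g) :
    UW N fun i ξ => f i ξ + g i ξ := by
  obtain ⟨C, hC⟩ := hf
  obtain ⟨C', hC'⟩ := hg
  refine ⟨2 * C + 2 * C', fun i => ?_⟩
  obtain ⟨h1, h2, h3⟩ := hC i
  obtain ⟨h1', h2', h3'⟩ := hC' i
  have hle : ∀ ξ, wt ξ ^ N * (f i ξ + g i ξ) ^ 2 ≤
      2 * (wt ξ ^ N * f i ξ ^ 2) + 2 * (wt ξ ^ N * g i ξ ^ 2) := fun ξ => by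
    have hw := wt_pos ξ
    calc wt ξ ^ N * (f i ξ + g i ξ) ^ 2 ≤ wt ξ ^ N * (2 * (f i ξ ^ 2 + g i ξ ^ 2)) := by
          gcongr
          exact add_sq_le
      _ = _ := by ring
  have hint : Integrable fun ξ => wt ξ ^ N * (f i ξ + g i ξ) ^ 2 := by
    refine ((h2.const_mul 2).add (h2'.const_mul 2)).mono' ?_ (Eventually.of_forall fun ξ => ?_)
    · exact (continuous_wt.pow N).aestronglyMeasurable.mul ((h1.add h1').pow 2)
    · rw [Real.norm_of_nonneg (by have := wt_pos ξ; positivity)]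
      exact hle ξ
  refine ⟨h1.add h1', hint, ?_⟩
  refine (integral_mono hint ((h2.const_mul 2).add (h2'.const_mul 2)) hle).trans ?_
  simp only [Pi.add_apply]
  rw [integral_add (h2.const_mul 2) (h2'.const_mul 2), integral_const_mul, integral_const_mul]
  linarith

theorem UW.const_mul {N : ℕ} {f : ι → Plane → ℝ} {e : ι → ℝ} (he : UR e) (hf : UW N f) :
    UW N fun i ξ => e i * f i ξ := by
  obtain ⟨C, hC⟩ := he
  refine UW.dominated (m := 0) (K := C) hf (fun i => (hf.aesm i).const_mul _) fun i =>
    Eventually.of_forall fun ξ => ?_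
  rw [abs_mul, pow_zero, mul_one]
  exact mul_le_mul_of_nonneg_right (hC i) (abs_nonneg _)

theorem UW.sub {N : ℕ} {f g : ι → Plane → ℝ} (hf : UW N f) (hg : UW N g) :
    UW N fun i ξ => f i ξ - g i ξ := by
  have := hf.add (UW.const_mul (UR.const (-1)) hg)
  simpa [sub_eq_add_neg] using this

theorem UW.bdd_mul {N : ℕ} {f g : ι → Plane → ℝ} (hg : US g)
    (hgm : ∀ i, AEStronglyMeasurable (g i) volume) (hf : UW N f) :
    UW N fun i ξ => g i ξ * f i ξ := by
  obtain ⟨C, hC⟩ := hg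
  refine UW.dominated (m := 0) (K := C) hf (fun i => (hgm i).mul (hf.aesm i)) fun i => ?_
  filter_upwards [hC i] with ξ hξ
  rw [abs_mul, pow_zero, mul_one]
  exact mul_le_mul_of_nonneg_right hξ (abs_nonneg _)

theorem US.mul {f g : ι → Plane → ℝ} (hf : US f) (hg : US g) : US fun i ξ => f i ξ * g i ξ := by
  obtain ⟨C, hC⟩ := hf
  obtain ⟨C', hC'⟩ := hg
  refine ⟨C * C', fun i => ?_⟩
  filter_upwards [hC i, hC' i] with ξ h1 h2
  rw [abs_mul]
  exact mul_le_mul h1 h2 (abs_nonneg _) ((abs_nonneg _).trans h1)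

theorem UW.pow_mul {N n : ℕ} {f : ι → Plane → ℝ} (hf : UW (N + 2 * n) f) :
    UW N fun i ξ => ξ 0 ^ n * f i ξ := by
  have hc : Continuous fun ξ : Plane => ξ 0 ^ n := by fun_prop
  refine UW.dominated (m := n) (K := 1) hf
    (fun i => hc.aestronglyMeasurable.mul (hf.aesm i)) fun i => Eventually.of_forall fun ξ => ?_
  have h1 : |ξ 0| ≤ wt ξ := by
    have := sq_coord_le_wt 0 ξ
    have h2 := one_le_wt ξ
    exact abs_le_of_sq_le_sq (by nlinarith) (by linarith)
  rw [abs_mul, abs_pow, one_mul]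
  gcongr

theorem UW.ur_integral_mul {f g : ι → Plane → ℝ} (hf : UW 0 f) (hg : UW 0 g) :
    UR fun i => ∫ ξ, f i ξ * g i ξ := by
  have hf' := hf
  have hg' := hg
  obtain ⟨C, hC⟩ := hf'
  obtain ⟨C', hC'⟩ := hg'
  refine ⟨C + C', fun i => ?_⟩
  have h := integral_mul_sq_le (hf.memLp i) (hg.memLp i)
  have h1 : ∫ ξ, f i ξ ^ 2 ≤ C := by simpa using (hC i).2.2
  have h2 : ∫ ξ, g i ξ ^ 2 ≤ C' := by simpa using (hC' i).2.2
  have h3 : 0 ≤ ∫ ξ, f i ξ ^ 2 := integral_nonneg fun ξ => sq_nonneg _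
  have h4 : 0 ≤ ∫ ξ, g i ξ ^ 2 := integral_nonneg fun ξ => sq_nonneg _
  refine abs_le_of_sq_le_sq ?_ (by linarith)
  nlinarith [mul_le_mul h1 h2 h4 (h3.trans h1)]

/-- Gain of one power of the weight for solutions of `P₀ v = F`. -/
theorem UW.step {N : ℕ} {v F : ι → Plane → ℝ} {dv : ι → Fin 2 → Plane → ℝ}
    (hv : ∀ i, InFormDomain (v i) (dv i)) (hs : ∀ i, SolvesP0 (v i) (dv i) (F i))
    (h : UW N v) (hF : UW (N - 1) F) : UW (N + 1) v ∧ ∀ j, UW N fun i => dv i j := by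
  obtain ⟨C, hC, hstep⟩ := exists_weighted_step N
  have hF' := hF
  have h' := h
  obtain ⟨A, hA⟩ := h'
  obtain ⟨B, hB⟩ := hF'
  have key : ∀ i, Integrable (fun ξ => wt ξ ^ N * (dv i 0 ξ ^ 2 + dv i 1 ξ ^ 2) +
        wt ξ ^ (N + 1) * v i ξ ^ 2) ∧
      ∫ ξ, (wt ξ ^ N * (dv i 0 ξ ^ 2 + dv i 1 ξ ^ 2) + wt ξ ^ (N + 1) * v i ξ ^ 2) ≤
        C * (A + B) := by
    intro i
    -- For `N = 0` the subtraction truncates to zero and the inequality is just `1 / wt ≤ 1`.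
    have hle : ∀ ξ, wt ξ ^ N * F i ξ ^ 2 / wt ξ ≤ wt ξ ^ (N - 1) * F i ξ ^ 2 := by
      intro ξ
      have hw := wt_pos ξ
      rw [div_le_iff₀ hw]
      have : wt ξ ^ N ≤ wt ξ ^ (N - 1) * wt ξ := by
        rw [← pow_succ]
        exact pow_le_pow_right₀ (one_le_wt ξ) (by omega)
      calc wt ξ ^ N * F i ξ ^ 2 ≤ (wt ξ ^ (N - 1) * wt ξ) * F i ξ ^ 2 := by gcongr
        _ = _ := by ring
    have hi : Integrable fun ξ => wt ξ ^ N * F i ξ ^ 2 / wt ξ := by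
      refine (hB i).2.1.mono' ?_ (Eventually.of_forall fun ξ => ?_)
      · exact ((continuous_wt.pow N).aestronglyMeasurable.mul ((hF.aesm i).pow 2)).div₀
          continuous_wt.aestronglyMeasurable
      · rw [Real.norm_of_nonneg (by have := wt_pos ξ; positivity)]
        exact hle ξ
    obtain ⟨h1, h2⟩ := hstep _ _ _ (hv i) (hs i) (hF.memLp i) (hA i).2.1 hi
    refine ⟨h1, h2.trans ?_⟩
    have h3 := (integral_mono hi (hB i).2.1 hle).trans (hB i).2.2
    have h4 := (hA i).2.2
    gcongr
  have sub : ∀ (g : ι → Plane → ℝ) (n : ℕ), (∀ i, AEStronglyMeasurable (g i) volume) →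
      (∀ i ξ, wt ξ ^ n * g i ξ ^ 2 ≤
        wt ξ ^ N * (dv i 0 ξ ^ 2 + dv i 1 ξ ^ 2) + wt ξ ^ (N + 1) * v i ξ ^ 2) → UW n g := by
    intro g n hm hle
    refine ⟨C * (A + B), fun i => ?_⟩
    have hint : Integrable fun ξ => wt ξ ^ n * g i ξ ^ 2 := by
      refine (key i).1.mono' ?_ (Eventually.of_forall fun ξ => ?_)
      · exact (continuous_wt.pow n).aestronglyMeasurable.mul ((hm i).pow 2)
      · rw [Real.norm_of_nonneg (by have := wt_pos ξ; positivity)]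
        exact hle i ξ
    exact ⟨hm i, hint, (integral_mono hint (key i).1 (hle i)).trans (key i).2⟩
  refine ⟨sub v _ (fun i => (hv i).memLp.1) fun i ξ => ?_,
    fun j => sub _ _ (fun i => ((hv i).grad_memLp j).1) fun i ξ => ?_⟩
  · have := wt_pos ξ
    have : 0 ≤ wt ξ ^ N * (dv i 0 ξ ^ 2 + dv i 1 ξ ^ 2) := by positivity
    linarith
  · have hw := wt_pos ξ
    have h1 : 0 ≤ wt ξ ^ (N + 1) * v i ξ ^ 2 := by positivity
    have h2 : 0 ≤ wt ξ ^ N * dv i 0 ξ ^ 2 := by positivity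
    have h3 : 0 ≤ wt ξ ^ N * dv i 1 ξ ^ 2 := by positivity
    rw [mul_add]
    fin_cases j
    · simp only [Fin.zero_eta]; linarith
    · simp only [Fin.mk_one]; linarith

/-- Uniform bounds for solutions of `P₀ v = F`. -/
theorem US.of_solves {v F : ι → Plane → ℝ} {dv : ι → Fin 2 → Plane → ℝ}
    (hv : ∀ i, InFormDomain (v i) (dv i)) (hs : ∀ i, SolvesP0 (v i) (dv i) (F i))
    (h : UW 2 v) (hF : UW 0 F) : US v := by
  obtain ⟨C, hC, hsob⟩ := exists_sobolev_sup (d := 2) (by norm_num)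
  have hp : UW 0 fun i ξ => potential ξ * v i ξ := by
    refine UW.dominated (m := 1) (K := 4) h (fun i =>
      continuous_potential.aestronglyMeasurable.mul (hv i).memLp.1)
      fun i => Eventually.of_forall fun ξ => ?_
    rw [abs_mul, abs_of_nonneg (potential_nonneg ξ), pow_one]
    have := potential_le ξ
    gcongr
    unfold wt
    linarith
  have hG := hp.sub hF
  have hG' := hG
  have h0 := h.mono (Nat.zero_le 2)
  obtain ⟨A, hA⟩ := hG'
  obtain ⟨B, hB⟩ := h0
  refine ⟨√(C * (B + A)), fun i => ?_⟩
  have hw := SolvesP0.weakLap (hv i) (hs i) (hG.memLp i) (hF.memLp i)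
  have hn : ∀ {f : Plane → ℝ} (hf : MemLp f 2 volume), ‖hf.toLp f‖ ^ 2 = ∫ ξ, f ξ ^ 2 := by
    intro f hf
    rw [← real_inner_self_eq_norm_sq, inner_eq_integral]
    refine integral_congr_ae ?_
    filter_upwards [hf.coeFn_toLp] with x hx
    rw [hx, sq]
  filter_upwards [hsob _ _ hw, (hv i).memLp.coeFn_toLp] with ξ h1 h2
  rw [h2, hn, hn] at h1
  refine Real.abs_le_sqrt (h1.trans ?_)
  have h3 : ∫ ξ, v i ξ ^ 2 ≤ B := by simpa using (hB i).2.2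
  have h4 : ∫ ξ, (potential ξ * v i ξ - F i ξ) ^ 2 ≤ A := by simpa using (hA i).2.2
  gcongr

end Families

/-! ### Uniform bounds for the profiles -/

theorem norm_toLp_sq {f : Plane → ℝ} (hf : MemLp f 2 volume) :
    ‖hf.toLp f‖ ^ 2 = ∫ ξ, f ξ ^ 2 := by
  rw [← real_inner_self_eq_norm_sq, inner_eq_integral]
  refine integral_congr_ae ?_
  filter_upwards [hf.coeFn_toLp] with x hx
  rw [hx, sq]

theorem InFormDomain.exists_gagliardo_nirenberg :
    ∃ C : ℝ, 0 ≤ C ∧ ∀ v dv, InFormDomain v dv →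
      (Integrable (fun ξ => v ξ ^ 4) ∧
        ∫ ξ, v ξ ^ 4 ≤ C * (∫ ξ, v ξ ^ 2) * ((∫ ξ, dv 0 ξ ^ 2) + ∫ ξ, dv 1 ξ ^ 2)) ∧
      (Integrable (fun ξ => v ξ ^ 6) ∧
        ∫ ξ, v ξ ^ 6 ≤ C * (∫ ξ, v ξ ^ 2) * ((∫ ξ, dv 0 ξ ^ 2) + ∫ ξ, dv 1 ξ ^ 2) ^ 2) := by
  obtain ⟨C, hC, h⟩ := exists_gagliardo_nirenberg_two
  refine ⟨C, hC, fun v dv hv => ?_⟩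
  have h1 := h _ _ hv.weakGrad
  rw [Fin.sum_univ_two, norm_toLp_sq, norm_toLp_sq, norm_toLp_sq] at h1
  have e : ∀ m : ℕ, (fun ξ => (hv.memLp.toLp v : LL 2) ξ ^ m) =ᵐ[volume] fun ξ => v ξ ^ m :=
    fun m => by
      filter_upwards [hv.memLp.coeFn_toLp] with ξ hξ
      rw [hξ]
  rw [integrable_congr (e 4), integral_congr_ae (e 4), integrable_congr (e 6),
    integral_congr_ae (e 6)] at h1
  exact h1

theorem IsTest.inFormDomain {v : Plane → ℝ} (hv : IsTest v) :
    InFormDomain v fun i => pderiv i v := by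
  have hm : ∀ f : Plane → ℝ, Continuous f → HasCompactSupport f → MemLp f 2 volume :=
    fun f hf hc => hf.memLp_of_hasCompactSupport hc
  have hw := weakGrad_sL (hv.2.toSchwartzMap hv.1)
  refine ⟨hm _ hv.1.continuous hv.2,
    fun i => hm _ (continuous_pderiv hv.1 i) (hasCompactSupport_pderiv hv.2 i),
    hm _ (continuous_norm.mul hv.1.continuous) hv.2.mul_left, fun i φ hφ => ?_⟩
  have := hw i (hφ.2.toSchwartzMap hφ.1)
  rw [inner_sL_sL, inner_sL_sL] at this
  exact this

/-- The form `∫ |∇v|² + (4ρ² + σ²) v²` of the harmonic oscillator. -/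
def formEnergy (v : Plane → ℝ) (dv : Fin 2 → Plane → ℝ) : ℝ :=
  ∫ ξ, (dv 0 ξ ^ 2 + dv 1 ξ ^ 2 + potential ξ * v ξ ^ 2)

theorem InFormDomain.integrable_potential_mul_sq {v : Plane → ℝ} {dv : Fin 2 → Plane → ℝ}
    (hv : InFormDomain v dv) : Integrable fun ξ => potential ξ * v ξ ^ 2 :=
  (hv.integrable_potential_mul hv).congr (Eventually.of_forall fun ξ => by simp only; ring)

theorem InFormDomain.integrable_form {v : Plane → ℝ} {dv : Fin 2 → Plane → ℝ}
    (hv : InFormDomain v dv) :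
    Integrable fun ξ => dv 0 ξ ^ 2 + dv 1 ξ ^ 2 + potential ξ * v ξ ^ 2 :=
  ((hv.grad_memLp 0).integrable_sq.add (hv.grad_memLp 1).integrable_sq).add
    hv.integrable_potential_mul_sq

theorem InFormDomain.formEnergy_eq {v : Plane → ℝ} {dv : Fin 2 → Plane → ℝ}
    (hv : InFormDomain v dv) : formEnergy v dv =
      (∫ ξ, dv 0 ξ ^ 2) + (∫ ξ, dv 1 ξ ^ 2) + ∫ ξ, potential ξ * v ξ ^ 2 :=
  integral_add_three (hv.grad_memLp 0).integrable_sq (hv.grad_memLp 1).integrable_sq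
    hv.integrable_potential_mul_sq

/-- For small coupling the ground states have uniformly bounded form energy. -/
theorem exists_formEnergy_le :
    ∃ c₀ : ℝ, 0 < c₀ ∧ ∃ B : ℝ, ∀ (k : ℕ) (b : ℝ) (p : Profile k b), |b| ≤ c₀ →
      formEnergy (p.v 0) (p.dv 0) ≤ B := by
  obtain ⟨C, hC, hGN⟩ := InFormDomain.exists_gagliardo_nirenberg
  -- At unit mass the quartic term is at most `|b| C / 2` times the form energy, whatever the sign
  -- of `b`. Smallness of the coupling enters here, and the threshold becomes the constant of the
  -- theorem.
  have hE : ∀ v dv b, InFormDomain v dv → ∫ ξ, v ξ ^ 2 = 1 → |b| ≤ (C + 1)⁻¹ →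
      |energy b v dv - formEnergy v dv| ≤ 1 / 2 * formEnergy v dv := by
    intro v dv b hv h1 hb
    obtain ⟨⟨i4, h4⟩, -⟩ := hGN v dv hv
    have e1 : energy b v dv = formEnergy v dv + 1 / 2 * b * ∫ ξ, v ξ ^ 4 := by
      rw [energy, formEnergy, ← integral_const_mul]
      exact integral_add hv.integrable_form (i4.const_mul (1 / 2 * b))
    have hp : 0 ≤ ∫ ξ, potential ξ * v ξ ^ 2 :=
      integral_nonneg fun ξ => mul_nonneg (potential_nonneg ξ) (sq_nonneg _)
    have h0 : 0 ≤ ∫ ξ, v ξ ^ 4 := integral_nonneg fun ξ => by positivity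
    have h2 : ∫ ξ, v ξ ^ 4 ≤ C * formEnergy v dv := by
      rw [hv.formEnergy_eq]
      rw [h1, mul_one] at h4
      exact h4.trans (mul_le_mul_of_nonneg_left (by linarith) hC)
    have h3 : 0 ≤ formEnergy v dv := by
      have := integral_nonneg (μ := volume) (f := fun ξ => dv 0 ξ ^ 2) fun ξ => sq_nonneg _
      have := integral_nonneg (μ := volume) (f := fun ξ => dv 1 ξ ^ 2) fun ξ => sq_nonneg _
      rw [hv.formEnergy_eq]
      linarith
    rw [e1, add_sub_cancel_left, abs_mul, abs_mul, abs_of_nonneg h0]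
    have h5 : |b| * ∫ ξ, v ξ ^ 4 ≤ (C + 1)⁻¹ * (C * formEnergy v dv) := by gcongr
    have h6 : (C + 1)⁻¹ * (C * formEnergy v dv) ≤ formEnergy v dv := by
      rw [inv_mul_le_iff₀ (by positivity)]
      nlinarith
    rw [abs_of_pos (by norm_num : (0 : ℝ) < 1 / 2), mul_assoc]
    linarith
  let ζ : Plane → ℝ := cutoff 0
  have hζ : IsTest ζ := isTest_cutoff 0
  have hpos : 0 < ∫ ξ, ζ ξ ^ 2 := by
    refine Continuous.integral_pos_of_hasCompactSupport_nonneg_nonzero (x := 0)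
      (hζ.1.continuous.pow 2) ?_ (fun ξ => sq_nonneg _) ?_
    · exact hζ.2.comp_left (g := fun y : ℝ => y ^ 2) (by simp)
    · simp [ζ, cutoff_eq_one (n := 0) (x := (0 : Plane)) (by simp)]
  let A := (√(∫ ξ, ζ ξ ^ 2))⁻¹
  let w : Plane → ℝ := fun ξ => A * ζ ξ
  have hw : IsTest w := ⟨contDiff_const.mul hζ.1, hζ.2.mul_left⟩
  have hw1 : ∫ ξ, w ξ ^ 2 = 1 := by
    simp only [w, A, mul_pow, inv_pow]
    rw [integral_const_mul, Real.sq_sqrt hpos.le, inv_mul_cancel₀ hpos.ne']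
  -- The energy lies between 1/2 and 3/2 times the form energy; comparing the minimizer with the
  -- fixed competitor `w` gives the ratio 3.
  refine ⟨(C + 1)⁻¹, by positivity, 3 * formEnergy w fun i => pderiv i w, fun k b p hb => ?_⟩
  have h1 := abs_le.1 (hE _ _ b hw.inFormDomain hw1 hb)
  have h2 := abs_le.1 (hE _ _ b (p.mem 0) p.v0_norm hb)
  have h3 := p.v0_min _ _ hw.inFormDomain hw1
  linarith

section Bounds

variable {ι : Type*}

theorem UW.of_zero {v : ι → Plane → ℝ} {C : ℝ} (h : ∀ i, MemLp (v i) 2 volume)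
    (hC : ∀ i, ∫ ξ, v i ξ ^ 2 ≤ C) : UW 0 v :=
  ⟨C, fun i => ⟨(h i).1, by simpa using (h i).integrable_sq, by simpa using hC i⟩⟩

/-- Decay of solutions whose right-hand side is controlled by the solution itself. -/
theorem UW.of_solves {v F : ι → Plane → ℝ} {dv : ι → Fin 2 → Plane → ℝ}
    (hv : ∀ i, InFormDomain (v i) (dv i)) (hs : ∀ i, SolvesP0 (v i) (dv i) (F i))
    (h0 : UW 0 v) (hF : ∀ N, UW N v → UW N F) :
    US v ∧ ∀ N, UW N v ∧ ∀ j, UW N fun i => dv i j := by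
  have h1 : ∀ N, UW N v := by
    intro N
    induction N with
    | zero => exact h0
    | succ N ih => exact (UW.step hv hs ih ((hF N ih).mono (Nat.sub_le _ _))).1
  exact ⟨US.of_solves hv hs (h1 2) (hF 0 h0), fun N =>
    ⟨h1 N, (UW.step hv hs (h1 N) ((hF N (h1 N)).mono (Nat.sub_le _ _))).2⟩⟩

variable {k : ℕ} {b : ι → ℝ}

/-- The form energy controls one power of the weight and, through Gagliardo-Nirenberg, the `L⁴` and
`L⁶` norms. Testing the equation with `v₀` expresses `E₀` through these. The cubic term is then in
`L²`, which gives weight two and hence a sup bound; once `v₀` is bounded, the right-hand side decays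
as well as `v₀` does and the decay can be iterated. -/
theorem Profile.ground_state_bounds (p : ∀ i, Profile k (b i)) (hb : UR b)
    (hE : UR fun i => formEnergy ((p i).v 0) ((p i).dv 0)) :
    UR (fun i => (p i).E 0) ∧ US (fun i => (p i).v 0) ∧
      ∀ N, UW N (fun i => (p i).v 0) ∧ ∀ j, UW N fun i => (p i).dv 0 j := by
  obtain ⟨B, hB⟩ := hE
  obtain ⟨C, hC, hGN⟩ := InFormDomain.exists_gagliardo_nirenberg
  have hB' : ∀ i, formEnergy ((p i).v 0) ((p i).dv 0) ≤ B := fun i => (le_abs_self _).trans (hB i)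
  have hp : ∀ i, 0 ≤ ∫ ξ, potential ξ * (p i).v 0 ξ ^ 2 := fun i =>
    integral_nonneg fun ξ => mul_nonneg (potential_nonneg ξ) (sq_nonneg _)
  have hd : ∀ i j, 0 ≤ ∫ ξ, (p i).dv 0 j ξ ^ 2 := fun i j => integral_nonneg fun ξ => sq_nonneg _
  have hD : ∀ i, (∫ ξ, (p i).dv 0 0 ξ ^ 2) + ∫ ξ, (p i).dv 0 1 ξ ^ 2 ≤ B := fun i => by
    have := hB' i
    rw [((p i).mem 0).formEnergy_eq] at this
    linarith [hp i]
  have h0 : UW 0 fun i => (p i).v 0 := UW.of_zero (fun i => ((p i).mem 0).memLp)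
    fun i => (p i).v0_norm.le
  have h1 : UW 1 fun i => (p i).v 0 := by
    refine ⟨1 + B, fun i => ?_⟩
    have hi := ((p i).mem 0).memLp.integrable_sq.add ((p i).mem 0).integrable_potential_mul_sq
    have hle : ∀ ξ, wt ξ ^ 1 * (p i).v 0 ξ ^ 2 ≤
        (p i).v 0 ξ ^ 2 + potential ξ * (p i).v 0 ξ ^ 2 := fun ξ => by
      have := norm_sq_le_potential ξ
      rw [wt, pow_one, add_mul, one_mul]
      gcongr
    have hint : Integrable fun ξ => wt ξ ^ 1 * (p i).v 0 ξ ^ 2 := by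
      refine hi.mono' ((continuous_wt.pow 1).aestronglyMeasurable.mul
        (((p i).mem 0).memLp.1.pow 2)) (Eventually.of_forall fun ξ => ?_)
      rw [Real.norm_of_nonneg (by have := wt_pos ξ; positivity)]
      exact hle ξ
    refine ⟨((p i).mem 0).memLp.1, hint, (integral_mono hint hi hle).trans ?_⟩
    simp only [Pi.add_apply]
    rw [integral_add ((p i).mem 0).memLp.integrable_sq ((p i).mem 0).integrable_potential_mul_sq,
      (p i).v0_norm]
    have := hB' i
    rw [((p i).mem 0).formEnergy_eq] at this
    linarith [hd i 0, hd i 1]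
  have h4 : UR fun i => ∫ ξ, (p i).v 0 ξ ^ 4 := by
    refine ⟨C * B, fun i => ?_⟩
    obtain ⟨⟨-, h⟩, -⟩ := hGN _ _ ((p i).mem 0)
    rw [abs_of_nonneg (integral_nonneg fun ξ => by positivity)]
    rw [(p i).v0_norm, mul_one] at h
    exact h.trans (mul_le_mul_of_nonneg_left (hD i) hC)
  have h6 : UW 0 fun i ξ => (p i).v 0 ξ ^ 3 := by
    have hpow : ∀ i, (fun ξ => ((p i).v 0 ξ ^ 3) ^ 2) = fun ξ => (p i).v 0 ξ ^ 6 := fun i => by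
      ext ξ; ring
    refine UW.of_zero (C := C * B ^ 2) (fun i => ?_) fun i => ?_
    · refine (memLp_two_iff_integrable_sq (((p i).mem 0).memLp.1.pow 3)).2 ?_
      exact (congrArg (fun f => Integrable f volume) (hpow i)).mpr (hGN _ _ ((p i).mem 0)).2.1
    · obtain ⟨-, -, h⟩ := hGN _ _ ((p i).mem 0)
      rw [hpow]
      rw [(p i).v0_norm, mul_one] at h
      have := add_nonneg (hd i 0) (hd i 1)
      exact h.trans (mul_le_mul_of_nonneg_left (pow_le_pow_left₀ this (hD i) 2) hC)
  have hE0 : UR fun i => (p i).E 0 := by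
    have hs : UR fun i => formEnergy ((p i).v 0) ((p i).dv 0) + b i * ∫ ξ, (p i).v 0 ξ ^ 4 :=
      UR.add ⟨B, hB⟩ (hb.mul h4)
    convert hs using 2 with i
    have m0 := ((p i).mem 0).memLp
    have hF : MemLp (fun ξ => (p i).E 0 * (p i).v 0 ξ - b i * (p i).v 0 ξ ^ 3) 2 volume :=
      (m0.const_mul _).sub ((h6.memLp i).const_mul _)
    have ht := (p i).eq0.test ((p i).mem 0) hF ((p i).mem 0)
    have e1 : ∫ ξ, ((p i).E 0 * (p i).v 0 ξ - b i * (p i).v 0 ξ ^ 3) * (p i).v 0 ξ =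
        (p i).E 0 - b i * ∫ ξ, (p i).v 0 ξ ^ 4 := by
      calc _ = ∫ ξ, ((p i).E 0 * (p i).v 0 ξ ^ 2 - b i * (p i).v 0 ξ ^ 4) := by
            congr 1; ext ξ; ring
        _ = _ := by
            rw [integral_sub (m0.integrable_sq.const_mul _)
              ((hGN _ _ ((p i).mem 0)).1.1.const_mul _), integral_const_mul, integral_const_mul,
              (p i).v0_norm, mul_one]
    rw [e1] at ht
    have e2 : formEnergy ((p i).v 0) ((p i).dv 0) =
        (p i).E 0 - b i * ∫ ξ, (p i).v 0 ξ ^ 4 := by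
      rw [← ht, formEnergy]
      congr 1; ext ξ; ring
    linarith
  have hF0 := (h0.const_mul hE0).sub (h6.const_mul hb)
  have h2 := (UW.step (fun i => (p i).mem 0) (fun i => (p i).eq0) h1 hF0).1
  have hs := US.of_solves (fun i => (p i).mem 0) (fun i => (p i).eq0) h2 hF0
  refine ⟨hE0, UW.of_solves (fun i => (p i).mem 0) (fun i => (p i).eq0) h0 fun N hN => ?_⟩
  refine (hN.const_mul hE0).sub (UW.const_mul hb ?_)
  have := UW.bdd_mul (hs.mul hs) (fun i => ((p i).mem 0).memLp.1.mul ((p i).mem 0).memLp.1) hN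
  convert this using 3
  ring

/-- Bounds for solutions of the linearized equation, including the multiplier `e`. -/
theorem Profile.linearized_bounds (p : ∀ i, Profile k (b i)) (hb : UR b)
    (hE : UR fun i => formEnergy ((p i).v 0) ((p i).dv 0)) {v G F : ι → Plane → ℝ}
    {dv : ι → Fin 2 → Plane → ℝ} {e : ι → ℝ} (hv : ∀ i, InFormDomain (v i) (dv i))
    (hs : ∀ i, SolvesP0 (v i) (dv i) (F i))
    (hF : ∀ i ξ, F i ξ = (p i).E 0 * v i ξ + e i * (p i).v 0 ξ
      - 3 * b i * ((p i).v 0 ξ * (p i).v 0 ξ * v i ξ) + G i ξ)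
    (h0 : UW 0 v) (hG : ∀ N, UW N G) :
    UR e ∧ US v ∧ ∀ N, UW N v ∧ ∀ j, UW N fun i => dv i j := by
  obtain ⟨hE0, hs0, hw0⟩ := Profile.ground_state_bounds p hb hE
  have hm : ∀ i, AEStronglyMeasurable (fun ξ => (p i).v 0 ξ * (p i).v 0 ξ) volume := fun i =>
    ((p i).mem 0).memLp.1.mul ((p i).mem 0).memLp.1
  have hc : ∀ N, UW N fun i ξ => (p i).v 0 ξ * (p i).v 0 ξ * (p i).v 0 ξ := fun N =>
    UW.bdd_mul (hs0.mul hs0) hm (hw0 N).1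
  have hv2 : ∀ N, UW N v → UW N fun i ξ => (p i).v 0 ξ * (p i).v 0 ξ * v i ξ := fun N hN =>
    UW.bdd_mul (hs0.mul hs0) hm hN
  have he : UR e := by
    -- Testing the linearized equation with `v₀` and the ground state equation with `v` produces
    -- equal left-hand sides; the `E₀` terms cancel and the solvability condition isolates `e` as
    -- this expression.
    have hr : UR fun i => 2 * b i * (∫ ξ, (p i).v 0 ξ * (p i).v 0 ξ * (p i).v 0 ξ * v i ξ) -
        ∫ ξ, G i ξ * (p i).v 0 ξ :=
      ((UR.const 2).mul hb |>.mul ((hc 0).ur_integral_mul h0)).sub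
        ((hG 0).ur_integral_mul (hw0 0).1)
    convert hr using 2 with i
    have m0 := ((p i).mem 0).memLp
    have mv := (hv i).memLp
    have mc := (hc 0).memLp i
    have mv2 := (hv2 0 h0).memLp i
    have mG := (hG 0).memLp i
    have hFi : F i = fun ξ => (p i).E 0 * v i ξ + e i * (p i).v 0 ξ
      - 3 * b i * ((p i).v 0 ξ * (p i).v 0 ξ * v i ξ) + G i ξ := funext (hF i)
    have mF : MemLp (F i) 2 volume := by
      rw [hFi]
      exact (((mv.const_mul _).add (m0.const_mul _)).sub (mv2.const_mul _)).add mG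
    have mF0 : MemLp (fun ξ => (p i).E 0 * (p i).v 0 ξ - b i * (p i).v 0 ξ ^ 3) 2 volume := by
      have := (m0.const_mul ((p i).E 0)).sub (mc.const_mul (b i))
      convert this using 2 with ξ
      simp only [Pi.sub_apply]
      ring
    have t1 := (hs i).test (hv i) mF ((p i).mem 0)
    have t2 := (p i).eq0.test ((p i).mem 0) mF0 (hv i)
    have t3 : ∫ ξ, F i ξ * (p i).v 0 ξ =
        ∫ ξ, ((p i).E 0 * (p i).v 0 ξ - b i * (p i).v 0 ξ ^ 3) * v i ξ := by
      rw [← t1, ← t2]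
      congr 1; ext ξ; ring
    have i1 : Integrable fun ξ => v i ξ * (p i).v 0 ξ := mv.integrable_mul m0
    have i2 : Integrable fun ξ => (p i).v 0 ξ * (p i).v 0 ξ * (p i).v 0 ξ * v i ξ :=
      mc.integrable_mul mv
    have i3 : Integrable fun ξ => G i ξ * (p i).v 0 ξ := mG.integrable_mul m0
    have e1 : ∫ ξ, F i ξ * (p i).v 0 ξ = (p i).E 0 * (∫ ξ, v i ξ * (p i).v 0 ξ) + e i -
        3 * b i * (∫ ξ, (p i).v 0 ξ * (p i).v 0 ξ * (p i).v 0 ξ * v i ξ) +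
        ∫ ξ, G i ξ * (p i).v 0 ξ := by
      calc _ = ∫ ξ, ((p i).E 0 * (v i ξ * (p i).v 0 ξ) + e i * (p i).v 0 ξ ^ 2 -
            3 * b i * ((p i).v 0 ξ * (p i).v 0 ξ * (p i).v 0 ξ * v i ξ) +
            G i ξ * (p i).v 0 ξ) := by
            congr 1; ext ξ; rw [hF]; ring
        _ = _ := by
            have ia : Integrable fun ξ => (p i).E 0 * (v i ξ * (p i).v 0 ξ) := i1.const_mul _
            have ib : Integrable fun ξ => e i * (p i).v 0 ξ ^ 2 := m0.integrable_sq.const_mul _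
            have ic : Integrable fun ξ =>
                3 * b i * ((p i).v 0 ξ * (p i).v 0 ξ * (p i).v 0 ξ * v i ξ) := i2.const_mul _
            have iab : Integrable fun ξ => (p i).E 0 * (v i ξ * (p i).v 0 ξ) +
                e i * (p i).v 0 ξ ^ 2 := ia.add ib
            have iabc : Integrable fun ξ => (p i).E 0 * (v i ξ * (p i).v 0 ξ) +
                e i * (p i).v 0 ξ ^ 2 -
                3 * b i * ((p i).v 0 ξ * (p i).v 0 ξ * (p i).v 0 ξ * v i ξ) := iab.sub ic
            rw [integral_add iabc i3, integral_sub iab ic, integral_add ia ib, integral_const_mul,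
              integral_const_mul, integral_const_mul, (p i).v0_norm, mul_one]
    have e2 : ∫ ξ, ((p i).E 0 * (p i).v 0 ξ - b i * (p i).v 0 ξ ^ 3) * v i ξ =
        (p i).E 0 * (∫ ξ, v i ξ * (p i).v 0 ξ) -
        b i * ∫ ξ, (p i).v 0 ξ * (p i).v 0 ξ * (p i).v 0 ξ * v i ξ := by
      calc _ = ∫ ξ, ((p i).E 0 * (v i ξ * (p i).v 0 ξ) -
            b i * ((p i).v 0 ξ * (p i).v 0 ξ * (p i).v 0 ξ * v i ξ)) := by
            congr 1; ext ξ; ring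
        _ = _ := by
            rw [integral_sub (i1.const_mul _) (i2.const_mul _), integral_const_mul,
              integral_const_mul]
    rw [e1, e2] at t3
    linarith
  refine ⟨he, UW.of_solves hv hs h0 fun N hN => ?_⟩
  have := (((hN.const_mul hE0).add ((hw0 N).1.const_mul he)).sub
    ((hv2 N hN).const_mul ((UR.const 3).mul hb))).add (hG N)
  convert this using 3
  exact hF _ _

/-- The equations are triangular: each corrector solves the same linearized equation with a source
built from the profiles already bounded, so only the `L²` bounds on `v₁`, `v₂` are needed as input.
-/
theorem Profile.bounds (p : ∀ i, Profile k (b i)) (hb : UR b)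
    (hE : UR fun i => formEnergy ((p i).v 0) ((p i).dv 0)) (h1 : UW 0 fun i => (p i).v 1)
    (h2 : UW 0 fun i => (p i).v 2) :
    (∀ j, UR fun i => (p i).E j) ∧ (∀ j, US fun i => (p i).v j) ∧
      ∀ j N, UW N (fun i => (p i).v j) ∧ ∀ l, UW N fun i => (p i).dv j l := by
  obtain ⟨e0, s0, w0⟩ := Profile.ground_state_bounds p hb hE
  obtain ⟨e1, s1, w1⟩ := Profile.linearized_bounds p hb hE (fun i => (p i).mem 1)
    (fun i => (p i).eq1) (e := fun i => (p i).E 1)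
    (G := fun i ξ => 1 / k * (p i).dv 0 0 ξ + 4 / k * (ξ 0 ^ 3 * (p i).v 0 ξ))
    (fun i ξ => by ring) h1 fun N =>
      (((w0 N).2 0).const_mul (UR.const (1 / (k : ℝ)))).add
        ((UW.pow_mul (w0 _).1).const_mul (UR.const (4 / (k : ℝ))))
  obtain ⟨e2, s2, w2⟩ := Profile.linearized_bounds p hb hE (fun i => (p i).mem 2)
    (fun i => (p i).eq2) (e := fun i => (p i).E 2)
    (G := fun i ξ => (p i).E 1 * (p i).v 1 ξ - 3 * b i * ((p i).v 0 ξ * (p i).v 1 ξ * (p i).v 1 ξ)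
      + 1 / k * (p i).dv 1 0 ξ + 4 / k * (ξ 0 ^ 3 * (p i).v 1 ξ)
      - 1 / (k : ℝ) ^ 2 * (ξ 0 ^ 1 * (p i).dv 0 0 ξ)
      - 5 / (k : ℝ) ^ 2 * (ξ 0 ^ 4 * (p i).v 0 ξ))
    (fun i ξ => by ring) h2 fun N =>
      (((((w1 N).1.const_mul e1).sub ((UW.bdd_mul (s0.mul s1)
        (fun i => ((p i).mem 0).memLp.1.mul ((p i).mem 1).memLp.1) (w1 N).1).const_mul
          ((UR.const 3).mul hb))).add (((w1 N).2 0).const_mul (UR.const (1 / (k : ℝ))))).add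
        ((UW.pow_mul (w1 _).1).const_mul (UR.const (4 / (k : ℝ))))).sub
        ((UW.pow_mul ((w0 _).2 0)).const_mul (UR.const (1 / (k : ℝ) ^ 2))) |>.sub
        ((UW.pow_mul (w0 _).1).const_mul (UR.const (5 / (k : ℝ) ^ 2)))
  refine ⟨fun j => ?_, fun j => ?_, fun j => ?_⟩
  · fin_cases j <;> assumption
  · fin_cases j <;> assumption
  · fin_cases j <;> assumption

end Bounds

/-! ### The Laplacian in cylindrical coordinates -/

/-- The function `((s + i b) / |s + i b|) ^ m` along a line. -/
def linePhase (m : ℕ) (b s : ℝ) : ℂ := (((s : ℂ) + Complex.I * b) / (√(s ^ 2 + b ^ 2) : ℝ)) ^ m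

theorem hasDerivAt_sqrt_add {b s : ℝ} (h : 0 < s ^ 2 + b ^ 2) :
    HasDerivAt (fun s => √(s ^ 2 + b ^ 2)) (s / √(s ^ 2 + b ^ 2)) s := by
  have h1 := ((hasDerivAt_pow 2 s).add_const (b ^ 2)).sqrt h.ne'
  convert h1 using 1
  have : √(s ^ 2 + b ^ 2) ≠ 0 := (Real.sqrt_pos.2 h).ne'
  field_simp
  simp [mul_comm]

/-- The polar angle of `s + ib` has derivative `-b / (s² + b²)` in `s`. Working with the normalized
power instead of the angle avoids its branch cut. -/
theorem hasDerivAt_linePhase (m : ℕ) {b s : ℝ} (h : 0 < s ^ 2 + b ^ 2) :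
    HasDerivAt (linePhase m b)
      (-(Complex.I * m * b / (√(s ^ 2 + b ^ 2) : ℝ) ^ 2) * linePhase m b s) s := by
  have hq := (Real.sqrt_pos.2 h).ne'
  have hq2 : ((√(s ^ 2 + b ^ 2) : ℝ) : ℂ) ^ 2 = (s : ℂ) ^ 2 + b ^ 2 := by
    rw [← Complex.ofReal_pow, Real.sq_sqrt h.le]; push_cast; ring
  have hqc : ((√(s ^ 2 + b ^ 2) : ℝ) : ℂ) ≠ 0 := Complex.ofReal_ne_zero.2 hq
  have h1 : HasDerivAt (fun s : ℝ => (s : ℂ) + Complex.I * b) 1 s :=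
    (Complex.ofRealCLM.hasDerivAt (x := s)).add_const _ |>.congr_deriv (by simp)
  have h2 := (hasDerivAt_sqrt_add h).ofReal_comp
  have h3 : HasDerivAt (fun s : ℝ => ((s : ℂ) + Complex.I * b) / (√(s ^ 2 + b ^ 2) : ℝ))
      (-(Complex.I * b / (√(s ^ 2 + b ^ 2) : ℝ) ^ 2) *
        (((s : ℂ) + Complex.I * b) / (√(s ^ 2 + b ^ 2) : ℝ))) s := by
    refine (h1.div h2 hqc).congr_deriv ?_
    push_cast
    field_simp
    linear_combination (1 : ℂ) * hq2 + (b : ℂ) ^ 2 * Complex.I_sq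
  refine (h3.pow m).congr_deriv ?_
  unfold linePhase
  rcases m with _ | m
  · simp
  · simp only [Nat.add_sub_cancel, pow_succ]
    push_cast
    ring

/-- First derivative along a line of a function in polar form. -/
theorem hasDerivAt_line_one {p p' : ℝ → ℝ} (hp : ∀ r, HasDerivAt p (p' r) r) (m : ℕ) {b s : ℝ}
    (h : 0 < s ^ 2 + b ^ 2) :
    HasDerivAt (fun s => linePhase m b s * (p √(s ^ 2 + b ^ 2) : ℂ))
      (linePhase m b s * (-(Complex.I * m * b / (√(s ^ 2 + b ^ 2) : ℝ) ^ 2) * p √(s ^ 2 + b ^ 2)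
        + p' √(s ^ 2 + b ^ 2) * s / (√(s ^ 2 + b ^ 2) : ℝ))) s := by
  have h1 := ((hp _).comp s (hasDerivAt_sqrt_add h)).ofReal_comp
  refine ((hasDerivAt_linePhase m h).mul h1).congr_deriv ?_
  push_cast
  simp only [Function.comp]
  ring

/-- Second derivative along a line of a function in polar form. -/
theorem hasDerivAt_line_two {p p' p'' : ℝ → ℝ} (hp : ∀ r, HasDerivAt p (p' r) r)
    (hp' : ∀ r, HasDerivAt p' (p'' r) r) (m : ℕ) {b s q : ℝ} (h : 0 < s ^ 2 + b ^ 2)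
    (hq : √(s ^ 2 + b ^ 2) = q) :
    HasDerivAt (fun s => linePhase m b s *
      (-(Complex.I * m * b / (√(s ^ 2 + b ^ 2) : ℝ) ^ 2) * p √(s ^ 2 + b ^ 2)
        + p' √(s ^ 2 + b ^ 2) * s / (√(s ^ 2 + b ^ 2) : ℝ)))
      (linePhase m b s * (-(m : ℂ) ^ 2 * b ^ 2 / q ^ 4 * p q - 2 * Complex.I * m * b * s / q ^ 3 * p' q
        + 2 * Complex.I * m * b * s / q ^ 4 * p q + p'' q * s ^ 2 / q ^ 2
        + p' q * (1 / q - s ^ 2 / q ^ 3))) s := by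
  have hq0 : q ≠ 0 := hq ▸ (Real.sqrt_pos.2 h).ne'
  have hqc : (q : ℂ) ≠ 0 := Complex.ofReal_ne_zero.2 hq0
  have hr := hasDerivAt_sqrt_add h
  rw [hq] at hr
  have hr' := hr.ofReal_comp
  have h1 := ((hp q).comp_of_eq s hr hq.symm).ofReal_comp
  have h1' := ((hp' q).comp_of_eq s hr hq.symm).ofReal_comp
  have hE := hasDerivAt_linePhase m h
  rw [hq] at hE
  have hs : HasDerivAt (fun s : ℝ => (s : ℂ)) 1 s := Complex.ofRealCLM.hasDerivAt
  have h2 := (((hasDerivAt_const s (Complex.I * m * b)).div (hr'.pow 2)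
    (by simp only [Pi.pow_apply, hq]; exact pow_ne_zero 2 hqc)).neg.mul h1).add
    ((h1'.mul hs).div hr' (by rw [hq]; exact hqc))
  refine (hE.mul h2).congr_deriv ?_
  simp only [Pi.add_apply, Pi.mul_apply, Pi.neg_apply, Pi.div_apply, Pi.pow_apply,
    Function.comp, hq]
  push_cast
  field_simp
  ring_nf
  simp only [Complex.I_sq]
  ring

/-- The phase factor `e^{imθ}`. -/
def phase (m : ℕ) (x : Space) : ℂ := (((x 0 : ℂ) + Complex.I * x 1) / (radius x : ℝ)) ^ m

theorem radius_nonneg (x : Space) : 0 ≤ radius x := Real.sqrt_nonneg _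

theorem continuous_radius : Continuous radius := by unfold radius; fun_prop

theorem radius_sq (x : Space) : radius x ^ 2 = x 0 ^ 2 + x 1 ^ 2 := Real.sq_sqrt (by positivity)

theorem phase_zero_line (m : ℕ) (x : Space) (t : ℝ) :
    phase m (x + t • ev 0) = linePhase m (x 1) (x 0 + t) := by
  simp [phase, linePhase, radius, ev]

theorem radius_zero_line (x : Space) (t : ℝ) :
    radius (x + t • ev 0) = √((x 0 + t) ^ 2 + x 1 ^ 2) := by
  simp [radius, ev]

/-- A quarter turn, `x₀ + i(x₁ + t) = i((x₁ + t) - ix₀)`, reduces the second direction to the first,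
so one computation along a line serves both. -/
theorem phase_one_line (m : ℕ) (x : Space) (t : ℝ) :
    phase m (x + t • ev 1) = Complex.I ^ m * linePhase m (-x 0) (x 1 + t) := by
  rw [phase, linePhase, ← mul_pow]
  congr 1
  simp only [radius, ev, PiLp.add_apply, PiLp.smul_apply, PiLp.single_apply]
  simp only [Fin.isValue, zero_ne_one, if_false, if_true, smul_eq_mul, mul_zero, add_zero, mul_one,
    neg_sq]
  rw [add_comm ((x 1 + t) ^ 2), mul_div_assoc', mul_add]
  congr 1
  push_cast
  linear_combination (x 0 : ℂ) * Complex.I_sq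

theorem radius_one_line (x : Space) (t : ℝ) :
    radius (x + t • ev 1) = √((x 1 + t) ^ 2 + (-x 0) ^ 2) := by
  simp [radius, ev, add_comm]

theorem phase_two_line (m : ℕ) (x : Space) (t : ℝ) : phase m (x + t • ev 2) = phase m x := by
  simp [phase, radius, ev]

theorem radius_two_line (x : Space) (t : ℝ) : radius (x + t • ev 2) = radius x := by
  simp [radius, ev]

theorem hasDerivAt_schwartz_line (φ : 𝓢(Eu 3, ℝ)) (i : Fin 3) (x : Space) (t : ℝ) :
    HasDerivAt (fun t : ℝ => φ (x + t • ev i)) (sD i φ (x + t • ev i)) t := by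
  have h1 : HasDerivAt (fun t : ℝ => x + t • ev i) (ev i) t := by
    simpa using ((hasDerivAt_id t).smul_const (ev i)).const_add x
  exact (φ.differentiable _).hasFDerivAt.comp_hasDerivAt t h1

/-- The second partial derivative of a Schwartz function, read off along a line. -/
theorem sD_sD_eq {φ : 𝓢(Eu 3, ℝ)} {i : Fin 3} {x : Space} {f f' : ℝ → ℝ} {f'' : ℝ}
    (h : ∀ᶠ t in 𝓝 (0 : ℝ), φ (x + t • ev i) = f t)
    (h1 : ∀ᶠ t in 𝓝 (0 : ℝ), HasDerivAt f (f' t) t) (h2 : HasDerivAt f' f'' 0) :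
    sD i (sD i φ) x = f'' := by
  have h3 : ∀ᶠ t in 𝓝 (0 : ℝ), sD i φ (x + t • ev i) = f' t := by
    filter_upwards [h.eventually_nhds, h1] with t ht ht'
    exact (hasDerivAt_schwartz_line φ i x t).unique (ht'.congr_of_eventuallyEq ht)
  have h4 := hasDerivAt_schwartz_line (sD i φ) i x 0
  rw [zero_smul, add_zero] at h4
  exact h4.unique (h2.congr_of_eventuallyEq h3)

/-- The Laplacian of a function of the form `e^{imθ} P(r, y)`. -/
theorem laplacian_cylindrical (L : ℂ →L[ℝ] ℝ) {φ : 𝓢(Eu 3, ℝ)} {m : ℕ}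
    {P P1 P2 Q1 Q2 : ℝ → ℝ → ℝ}
    (hφ : ∀ x : Space, φ x = L (phase m x * (P (radius x) (x 2) : ℝ)))
    (h1 : ∀ y r, HasDerivAt (fun r => P r y) (P1 r y) r)
    (h2 : ∀ y r, HasDerivAt (fun r => P1 r y) (P2 r y) r)
    (h3 : ∀ r y, HasDerivAt (P r) (Q1 r y) y) (h4 : ∀ r y, HasDerivAt (Q1 r) (Q2 r y) y)
    {x : Space} (hx : radius x ≠ 0) :
    sΔ φ x = L (phase m x * ((P2 (radius x) (x 2) + P1 (radius x) (x 2) / radius x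
      - m ^ 2 / radius x ^ 2 * P (radius x) (x 2) + Q2 (radius x) (x 2) : ℝ) : ℂ)) := by
  have hx0 : 0 < x 0 ^ 2 + x 1 ^ 2 := Real.sqrt_pos.1 ((radius_nonneg x).lt_of_ne' hx)
  have hx1 : 0 < x 1 ^ 2 + (-x 0) ^ 2 := by linarith [neg_sq (x 0)]
  have ev0 : ∀ᶠ t : ℝ in 𝓝 0, 0 < (x 0 + t) ^ 2 + x 1 ^ 2 :=
    (show Continuous fun t : ℝ => (x 0 + t) ^ 2 + x 1 ^ 2 by fun_prop).continuousAt.eventually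
      (lt_mem_nhds (by simpa using hx0))
  have ev1 : ∀ᶠ t : ℝ in 𝓝 0, 0 < (x 1 + t) ^ 2 + (-x 0) ^ 2 :=
    (show Continuous fun t : ℝ => (x 1 + t) ^ 2 + (-x 0) ^ 2 by fun_prop).continuousAt.eventually
      (lt_mem_nhds (by simpa using hx1))
  have r0 : √(x 0 ^ 2 + x 1 ^ 2) = radius x := rfl
  have r1 : √(x 1 ^ 2 + (-x 0) ^ 2) = radius x := by rw [neg_sq, add_comm]; rfl
  have d0 := sD_sD_eq (φ := φ) (i := 0) (x := x)
    (Eventually.of_forall fun t => by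
      rw [hφ, phase_zero_line, radius_zero_line]
      simp [ev])
    (ev0.mono fun t ht => L.hasFDerivAt.comp_hasDerivAt t
      ((hasDerivAt_line_one (h1 (x 2)) m ht).comp_const_add (x 0) t))
    (L.hasFDerivAt.comp_hasDerivAt 0
      ((hasDerivAt_line_two (h1 (x 2)) (h2 (x 2)) m (b := x 1) (s := x 0 + 0)
        (by simpa using hx0) (by simpa using r0)).comp_const_add (x 0) 0))
  have d1 := sD_sD_eq (φ := φ) (i := 1) (x := x)
    (Eventually.of_forall fun t => by
      rw [hφ, phase_one_line, radius_one_line, mul_assoc]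
      simp [ev])
    (ev1.mono fun t ht => L.hasFDerivAt.comp_hasDerivAt t
      (((hasDerivAt_line_one (h1 (x 2)) m ht).comp_const_add (x 1) t).const_mul (Complex.I ^ m)))
    (L.hasFDerivAt.comp_hasDerivAt 0
      (((hasDerivAt_line_two (h1 (x 2)) (h2 (x 2)) m (b := -x 0) (s := x 1 + 0)
        (by simpa using hx1) (by simpa using r1)).comp_const_add (x 1) 0).const_mul
          (Complex.I ^ m)))
  have d2 := sD_sD_eq (φ := φ) (i := 2) (x := x)
    (Eventually.of_forall fun t => by
      rw [hφ, phase_two_line, radius_two_line]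
      simp [ev])
    (Eventually.of_forall fun t => L.hasFDerivAt.comp_hasDerivAt t
      ((((h3 (radius x) (x 2 + t)).comp_const_add (x 2) t).ofReal_comp).const_mul (phase m x)))
    (L.hasFDerivAt.comp_hasDerivAt 0
      ((((h4 (radius x) (x 2 + 0)).comp_const_add (x 2) 0).ofReal_comp).const_mul (phase m x)))
  have p0 := phase_zero_line m x 0
  have p1 := phase_one_line m x 0
  simp only [zero_smul, add_zero] at p0 p1 d0 d1 d2
  rw [sΔ_eq_sum, Fin.sum_univ_three]
  simp only [add_apply]
  rw [d0, d1, d2, ← map_add, ← map_add, ← mul_assoc, ← p0, ← p1, ← mul_add, ← mul_add]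
  congr 2
  have hc : (radius x : ℂ) ≠ 0 := Complex.ofReal_ne_zero.2 hx
  have hs : (radius x : ℂ) ^ 2 = (x 0 : ℂ) ^ 2 + (x 1 : ℂ) ^ 2 := by
    exact_mod_cast radius_sq x
  push_cast
  -- The mixed terms, odd in the product `AB`, cancel between the two horizontal directions, leaving
  -- the polar form of the Laplacian.
  have key : ∀ R A B P P1 P2 Q M J : ℂ, R ≠ 0 → R ^ 2 = A ^ 2 + B ^ 2 →
      (-M ^ 2 * B ^ 2 / R ^ 4 * P - 2 * J * M * B * A / R ^ 3 * P1 + 2 * J * M * B * A / R ^ 4 * P +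
        P2 * A ^ 2 / R ^ 2 + P1 * (1 / R - A ^ 2 / R ^ 3)) +
      (-M ^ 2 * (-A) ^ 2 / R ^ 4 * P - 2 * J * M * (-A) * B / R ^ 3 * P1 +
        2 * J * M * (-A) * B / R ^ 4 * P + P2 * B ^ 2 / R ^ 2 + P1 * (1 / R - B ^ 2 / R ^ 3)) + Q =
      P2 + P1 / R - M ^ 2 / R ^ 2 * P + Q := by
    intro R A B P P1 P2 Q M J hR h
    calc _ = -M ^ 2 / R ^ 4 * P * (A ^ 2 + B ^ 2) + P2 * (A ^ 2 + B ^ 2) / R ^ 2 +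
          P1 * (2 / R - (A ^ 2 + B ^ 2) / R ^ 3) + Q := by ring
      _ = _ := by
          rw [← h]
          field_simp
          ring
  exact key _ _ _ _ _ _ _ _ _ hc hs

/-! ### Functions concentrated near a circle -/

/-- The rescaled variables `((r - k) / ε, y / ε)`. -/
def tubeMap (k ε : ℝ) (x : Space) : Plane := !₂[(radius x - k) / ε, x 2 / ε]

/-- The tube of points at cylindrical distance at most `1/2` from the cylinder `r = k`. -/
def tube (k : ℝ) : Set Space := {x | |radius x - k| ≤ 1 / 2}

theorem mem_tube {k : ℝ} {x : Space} : x ∈ tube k ↔ |radius x - k| ≤ 1 / 2 := Iff.rfl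

theorem measurableSet_tube (k : ℝ) : MeasurableSet (tube k) :=
  (isClosed_le (by have := continuous_radius; fun_prop) continuous_const).measurableSet

theorem continuous_tubeMap (k ε : ℝ) : Continuous (tubeMap k ε) := by
  unfold tubeMap
  have := continuous_radius
  refine (PiLp.continuous_toLp 2 _).comp (continuous_pi fun i => ?_)
  fin_cases i <;> simp <;> fun_prop

theorem measurePreserving_space :
    MeasurePreserving (fun x : Space => (x 2, (x 0, x 1))) volume volume := by
  have h1 := PiLp.volume_preserving_ofLp (Fin 3)
  have h2 := volume_preserving_piFinSuccAbove (fun _ : Fin 3 => ℝ) 2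
  have h3 := (MeasurePreserving.id (volume : Measure ℝ)).prod (volume_preserving_finTwoArrow ℝ)
  have := h3.comp (h2.comp h1)
  exact this

theorem measurePreserving_plane :
    MeasurePreserving (fun x : Plane => (x 0, x 1)) volume volume :=
  (volume_preserving_finTwoArrow ℝ).comp (PiLp.volume_preserving_ofLp (Fin 2))

theorem lintegral_comp_div_sub {g : ℝ → ENNReal} (hg : Measurable g) (a : ℝ) {ε : ℝ}
    (hε : 0 < ε) : ∫⁻ s, g ((s - a) / ε) = ENNReal.ofReal ε * ∫⁻ s, g s := by
  rw [lintegral_sub_right_eq_self (μ := volume) (fun s => g (s / ε)) a]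
  have h := Real.smul_map_volume_mul_left (inv_ne_zero hε.ne')
  have h1 : ∫⁻ s, g s = ENNReal.ofReal |ε⁻¹| * ∫⁻ s, g (s / ε) := by
    conv_lhs => rw [← h]
    rw [lintegral_smul_measure, lintegral_map hg (measurable_const_mul _)]
    simp only [smul_eq_mul, div_eq_inv_mul]
  rw [h1, ← mul_assoc, ← ENNReal.ofReal_mul hε.le, abs_of_pos (inv_pos.2 hε),
    mul_inv_cancel₀ hε.ne', ENNReal.ofReal_one, one_mul]

theorem lintegral_plane {G : Plane → ENNReal} (hG : Measurable G) :
    ∫⁻ ξ, G ξ = ∫⁻ σ, ∫⁻ ρ, G !₂[ρ, σ] := by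
  have hc : Measurable fun p : ℝ × ℝ => (!₂[p.1, p.2] : Plane) := by
    refine ((PiLp.continuous_toLp 2 _).comp (continuous_pi fun i => ?_)).measurable
    fin_cases i <;> simp <;> fun_prop
  have h := measurePreserving_plane.lintegral_comp (hG.comp hc)
  have h1 : ∀ ξ : Plane, (!₂[ξ 0, ξ 1] : Plane) = ξ := fun ξ => by ext i; fin_cases i <;> rfl
  simp only [Function.comp, h1] at h
  rw [h, Measure.volume_eq_prod]
  exact lintegral_prod_symm _ (hG.comp hc).aemeasurable

/-- Polar coordinates in the horizontal plane: on the tube the Jacobian is at most `k + 1/2`, the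
angle contributes `2π`, and the two dilations contribute `ε²`. An upper bound is all that is used.
-/
theorem lintegral_tube_le {k ε : ℝ} (hk : 1 / 2 ≤ k) (hε : 0 < ε) {G : Plane → ENNReal}
    (hG : Measurable G) : ∫⁻ x in tube k, G (tubeMap k ε x) ≤
      ENNReal.ofReal ((k + 1 / 2) * (2 * Real.pi) * ε ^ 2) * ∫⁻ ξ, G ξ := by
  let K : ℝ → ℝ → ENNReal := fun r y =>
    {r : ℝ | |r - k| ≤ 1 / 2}.indicator (fun r => G !₂[(r - k) / ε, y / ε]) r
  have hset : MeasurableSet {r : ℝ | |r - k| ≤ 1 / 2} :=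
    (isClosed_le (by fun_prop) continuous_const).measurableSet
  have hc : Measurable fun p : ℝ × ℝ => (!₂[(p.1 - k) / ε, p.2 / ε] : Plane) := by
    refine ((PiLp.continuous_toLp 2 _).comp (continuous_pi fun i => ?_)).measurable
    fin_cases i <;> simp <;> fun_prop
  have hK : Measurable fun p : ℝ × ℝ => K p.1 p.2 := by
    have := (hG.comp hc).indicator (measurable_fst hset)
    exact this
  have hKle : ∀ r y, K r y ≤ G !₂[(r - k) / ε, y / ε] := fun r y => by
    simp only [K]
    exact Set.indicator_le_self' (fun _ _ => zero_le) r
  have hq : Measurable fun q : ℝ × ℝ => √(q.1 ^ 2 + q.2 ^ 2) := by fun_prop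
  have h1 : ∫⁻ x in tube k, G (tubeMap k ε x) =
      ∫⁻ y, ∫⁻ q : ℝ × ℝ, K √(q.1 ^ 2 + q.2 ^ 2) y := by
    have hm : Measurable fun p : ℝ × (ℝ × ℝ) => K √(p.2.1 ^ 2 + p.2.2 ^ 2) p.1 :=
      hK.comp ((hq.comp measurable_snd).prodMk measurable_fst)
    rw [← lintegral_indicator (measurableSet_tube k)]
    have h := measurePreserving_space.lintegral_comp hm
    rw [Measure.volume_eq_prod, lintegral_prod _ hm.aemeasurable] at h
    rw [← h]
    rfl
  have h2 : ∀ y, ∫⁻ q : ℝ × ℝ, K √(q.1 ^ 2 + q.2 ^ 2) y ≤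
      ENNReal.ofReal ((k + 1 / 2) * (2 * Real.pi)) * ∫⁻ r, G !₂[(r - k) / ε, y / ε] := by
    intro y
    have hKy : Measurable fun r => K r y := hK.comp (measurable_id.prodMk measurable_const)
    rw [← lintegral_comp_polarCoord_symm]
    have hle : ∀ p ∈ polarCoord.target, ENNReal.ofReal p.1 •
        K √((polarCoord.symm p).1 ^ 2 + (polarCoord.symm p).2 ^ 2) y ≤
        ENNReal.ofReal (k + 1 / 2) * (K p.1 y * (Set.Ioo (-Real.pi) Real.pi).indicator 1 p.2) := by
      rintro ⟨r, θ⟩ ⟨hr, hθ⟩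
      have hr' : 0 < r := hr
      have e : √((polarCoord.symm (r, θ)).1 ^ 2 + (polarCoord.symm (r, θ)).2 ^ 2) = r := by
        rw [polarCoord_symm_apply]
        simp only
        rw [show (r * Real.cos θ) ^ 2 + (r * Real.sin θ) ^ 2 =
          r ^ 2 * (Real.sin θ ^ 2 + Real.cos θ ^ 2) by ring, Real.sin_sq_add_cos_sq, mul_one,
          Real.sqrt_sq hr'.le]
      rw [e, Set.indicator_of_mem hθ, Pi.one_apply, mul_one, smul_eq_mul]
      by_cases hm : |r - k| ≤ 1 / 2
      · gcongr
        linarith [(abs_le.1 hm).2]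
      · have : K r y = 0 :=
          Set.indicator_of_notMem (s := {r : ℝ | |r - k| ≤ 1 / 2}) hm _
        rw [this, mul_zero, mul_zero]
    refine (setLIntegral_mono' polarCoord.open_target.measurableSet hle).trans ?_
    refine (setLIntegral_le_lintegral _ _).trans ?_
    have hm1 : Measurable ((Set.Ioo (-Real.pi) Real.pi).indicator (1 : ℝ → ENNReal)) :=
      measurable_one.indicator measurableSet_Ioo
    have hm2 : Measurable fun p : ℝ × ℝ =>
        K p.1 y * (Set.Ioo (-Real.pi) Real.pi).indicator 1 p.2 :=
      (hKy.comp measurable_fst).mul (hm1.comp measurable_snd)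
    rw [lintegral_const_mul _ hm2, Measure.volume_eq_prod, lintegral_prod_mul hKy.aemeasurable hm1.aemeasurable,
      lintegral_indicator_one measurableSet_Ioo, Real.volume_Ioo, ENNReal.ofReal_mul (by linarith),
      mul_assoc, sub_neg_eq_add, ← two_mul, mul_comm (∫⁻ r, K r y)]
    gcongr with r
    exact hKle r y
  rw [h1]
  refine (lintegral_mono h2).trans ?_
  have hGm : Measurable fun p : ℝ × ℝ => G !₂[p.1, p.2] := by
    refine hG.comp ((PiLp.continuous_toLp 2 _).comp (continuous_pi fun i => ?_)).measurable
    fin_cases i <;> simp <;> fun_prop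
  have h3 : ∀ y, ∫⁻ r, G !₂[(r - k) / ε, y / ε] =
      ENNReal.ofReal ε * ∫⁻ ρ, G !₂[ρ, y / ε] := fun y =>
    lintegral_comp_div_sub (g := fun ρ => G !₂[ρ, y / ε])
      (hGm.comp (measurable_id.prodMk measurable_const)) k hε
  have hI : Measurable fun σ => ∫⁻ ρ, G !₂[ρ, σ] :=
    Measurable.lintegral_prod_right' (f := fun p : ℝ × ℝ => G !₂[p.2, p.1])
      (hGm.comp measurable_swap)
  have h4 := lintegral_comp_div_sub hI 0 hε
  simp only [sub_zero] at h4
  simp_rw [h3]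
  have hI' : Measurable fun y => ∫⁻ ρ, G !₂[ρ, y / ε] := hI.comp (measurable_id.div_const ε)
  have hpos : 0 ≤ (k + 1 / 2) * (2 * Real.pi) := by
    have := Real.pi_pos
    positivity
  rw [lintegral_const_mul _ (hI'.const_mul _), lintegral_const_mul _ hI', h4, lintegral_plane hG,
    sq, ENNReal.ofReal_mul (p := (k + 1 / 2) * (2 * Real.pi)) hpos, ENNReal.ofReal_mul hε.le]
  simp only [mul_assoc]
  exact le_rfl

/-- Domination of the image measure transports null sets, measurability and `L²` bounds from the
plane to the tube all at once. -/
theorem map_tube_le {k ε : ℝ} (hk : 1 / 2 ≤ k) (hε : 0 < ε) :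
    (volume.restrict (tube k)).map (tubeMap k ε) ≤
      ENNReal.ofReal ((k + 1 / 2) * (2 * Real.pi) * ε ^ 2) • (volume : Measure Plane) := by
  refine Measure.le_iff.2 fun s hs => ?_
  have h := lintegral_tube_le hk hε (G := s.indicator 1) (measurable_one.indicator hs)
  rw [lintegral_indicator_one hs] at h
  rw [Measure.map_apply (continuous_tubeMap k ε).measurable hs, Measure.smul_apply, smul_eq_mul]
  refine le_trans (le_of_eq ?_) h
  have : (fun x => s.indicator (1 : Plane → ENNReal) (tubeMap k ε x)) =
      (tubeMap k ε ⁻¹' s).indicator 1 := by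
    rfl
  rw [this, lintegral_indicator_one ((continuous_tubeMap k ε).measurable hs)]

theorem ae_tube {k ε : ℝ} (hk : 1 / 2 ≤ k) (hε : 0 < ε) {P : Plane → Prop}
    (h : ∀ᵐ ξ, P ξ) : ∀ᵐ x : Space, x ∈ tube k → P (tubeMap k ε x) := by
  rw [← ae_restrict_iff' (measurableSet_tube k)]
  exact ae_of_ae_map (continuous_tubeMap k ε).measurable.aemeasurable
    ((Measure.absolutelyContinuous_of_le_smul (map_tube_le hk hε)).ae_le h)

theorem integral_tube_sq_le {k ε : ℝ} (hk : 1 / 2 ≤ k) (hε : 0 < ε) {f : Plane → ℝ}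
    (hf : MemLp f 2 volume) : MemLp (fun x => f (tubeMap k ε x)) 2 (volume.restrict (tube k)) ∧
      ∫ x in tube k, f (tubeMap k ε x) ^ 2 ≤
        (k + 1 / 2) * (2 * Real.pi) * ε ^ 2 * ∫ ξ, f ξ ^ 2 := by
  have hT := (continuous_tubeMap k ε).measurable.aemeasurable (μ := volume.restrict (tube k))
  have hm := hf.of_measure_le_smul ENNReal.ofReal_ne_top (map_tube_le hk hε)
  refine ⟨(memLp_map_measure_iff hm.1 hT).1 hm, ?_⟩
  have h1 : AEStronglyMeasurable (fun ξ => f ξ ^ 2)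
    ((volume.restrict (tube k)).map (tubeMap k ε)) := hm.1.pow 2
  rw [← integral_map hT h1]
  have hpos : 0 ≤ (k + 1 / 2) * (2 * Real.pi) * ε ^ 2 := by
    have := Real.pi_pos
    positivity
  have := integral_mono_measure (map_tube_le hk hε)
    (Eventually.of_forall fun ξ => sq_nonneg (f ξ))
    (hf.integrable_sq.smul_measure ENNReal.ofReal_ne_top)
  rwa [integral_smul_measure, ENNReal.toReal_ofReal hpos, smul_eq_mul] at this

/-! ### Lifting functions of the rescaled plane to the tube -/

/-- A bounded measurable coefficient supported in `[-1/2, 1/2]`. -/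
structure IsCoef (c : ℝ → ℝ) : Prop where
  meas : Measurable c
  bdd : ∃ K : ℝ, 0 ≤ K ∧ ∀ s, |c s| ≤ K
  zero : ∀ s, 1 / 2 < |s| → c s = 0

/-- The function `e^{imθ} c(r - k) f((r - k) / ε, y / ε)`. -/
def lift (m : ℕ) (k ε : ℝ) (c : ℝ → ℝ) (f : Plane → ℝ) (x : Space) : ℂ :=
  phase m x * ((c (radius x - k) * f (tubeMap k ε x) : ℝ) : ℂ)

theorem measurable_phase (m : ℕ) : Measurable (phase m) := by
  unfold phase
  have := continuous_radius.measurable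
  have h0 : Measurable fun x : Space => (x 0 : ℂ) + Complex.I * x 1 :=
    Continuous.measurable (by fun_prop)
  exact (h0.div (Complex.measurable_ofReal.comp this)).pow_const m

theorem norm_phase_base (x : Space) : ‖(x 0 : ℂ) + Complex.I * x 1‖ = radius x := by
  rw [radius, ← Complex.norm_add_mul_I, mul_comm]

theorem norm_phase_le (m : ℕ) (x : Space) : ‖phase m x‖ ≤ 1 := by
  rw [phase, norm_pow, norm_div, norm_phase_base, Complex.norm_real,
    Real.norm_of_nonneg (radius_nonneg x)]
  exact pow_le_one₀ (div_nonneg (radius_nonneg x) (radius_nonneg x)) (div_self_le_one _)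

theorem norm_phase {m : ℕ} {x : Space} (hx : radius x ≠ 0) : ‖phase m x‖ = 1 := by
  rw [phase, norm_pow, norm_div, norm_phase_base, Complex.norm_real,
    Real.norm_of_nonneg (radius_nonneg x), div_self hx, one_pow]

theorem lift_eq_zero {m : ℕ} {k ε : ℝ} {c : ℝ → ℝ} (hc : IsCoef c) {f : Plane → ℝ} {x : Space}
    (hx : x ∉ tube k) : lift m k ε c f x = 0 := by
  rw [lift, hc.zero _ (not_le.1 hx)]
  simp

theorem lift_memLp {m : ℕ} {k ε : ℝ} (hk : 1 / 2 ≤ k) (hε : 0 < ε) {c : ℝ → ℝ} (hc : IsCoef c)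
    {f : Plane → ℝ} (hf : MemLp f 2 volume) : MemLp (lift m k ε c f) 2 volume := by
  obtain ⟨K, hK, hcK⟩ := hc.bdd
  have h1 := (integral_tube_sq_le hk hε hf).1
  have h2 : MemLp (lift m k ε c f) 2 (volume.restrict (tube k)) := by
    refine MemLp.of_le_mul (c := K) h1 ?_ (Eventually.of_forall fun x => ?_)
    · refine (measurable_phase m).aestronglyMeasurable.mul
        (Complex.continuous_ofReal.comp_aestronglyMeasurable ?_)
      exact (hc.meas.comp (continuous_radius.measurable.sub_const k)).aestronglyMeasurable.mul h1.1
    · rw [lift, norm_mul, Complex.norm_real, norm_mul]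
      calc _ ≤ 1 * (K * ‖f (tubeMap k ε x)‖) := by
            gcongr
            · exact norm_phase_le m x
            · exact hcK _
        _ = _ := one_mul _
  rw [← memLp_indicator_iff_restrict (measurableSet_tube k)] at h2
  have e : (tube k).indicator (lift m k ε c f) = lift m k ε c f :=
    Set.indicator_eq_self.2 fun x hx => by_contra fun h => hx (lift_eq_zero hc h)
  exact e ▸ h2

theorem integral_lift_sq_le {m : ℕ} {k ε K : ℝ} (hk : 1 / 2 ≤ k) (hε : 0 < ε) {c : ℝ → ℝ}
    (hc : IsCoef c) (hcK : ∀ s, |c s| ≤ K) {f : Plane → ℝ} (hf : MemLp f 2 volume) :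
    ∫ x, ‖lift m k ε c f x‖ ^ 2 ≤
      K ^ 2 * ((k + 1 / 2) * (2 * Real.pi) * ε ^ 2) * ∫ ξ, f ξ ^ 2 := by
  obtain ⟨h1, h2⟩ := integral_tube_sq_le hk hε hf
  have e : ∫ x, ‖lift m k ε c f x‖ ^ 2 = ∫ x in tube k, ‖lift m k ε c f x‖ ^ 2 := by
    symm
    refine setIntegral_eq_integral_of_forall_compl_eq_zero fun x hx => ?_
    rw [lift_eq_zero hc hx]
    simp
  rw [e, mul_assoc]
  refine le_trans ?_ (mul_le_mul_of_nonneg_left h2 (sq_nonneg K))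
  rw [← integral_const_mul]
  refine integral_mono ((lift_memLp hk hε hc hf).integrable_norm_pow (by norm_num)).integrableOn
    (h1.integrable_sq.const_mul _) fun x => ?_
  have : ‖lift m k ε c f x‖ ≤ K * |f (tubeMap k ε x)| := by
    rw [lift, norm_mul, Complex.norm_real, norm_mul]
    calc _ ≤ 1 * (K * ‖f (tubeMap k ε x)‖) := by
          gcongr
          · exact norm_phase_le m x
          · exact hcK _
      _ = _ := one_mul _
  calc _ ≤ (K * |f (tubeMap k ε x)|) ^ 2 := by gcongr
    _ = _ := by rw [mul_pow, sq_abs]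

theorem lift_sub (m : ℕ) (k ε : ℝ) (c : ℝ → ℝ) (f g : Plane → ℝ) (x : Space) :
    lift m k ε c f x - lift m k ε c g x = lift m k ε c (fun ξ => f ξ - g ξ) x := by
  simp only [lift]
  push_cast
  ring

theorem norm_toLp_complex_sq {F : Space → ℂ} (hF : MemLp F 2 volume) :
    ‖hF.toLp F‖ ^ 2 = ∫ x, ‖F x‖ ^ 2 := by
  rw [← inner_self_eq_norm_sq (𝕜 := ℂ), L2.inner_def]
  rw [← integral_re]
  · refine integral_congr_ae ?_
    filter_upwards [hF.coeFn_toLp] with x hx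
    rw [hx, inner_self_eq_norm_sq]
  · exact L2.integrable_inner _ _

/-- Lifting is linear and bounded from `L²` of the plane to `L²` of space, hence continuous. -/
theorem tendsto_lift {m : ℕ} {k ε : ℝ} (hk : 1 / 2 ≤ k) (hε : 0 < ε) {c : ℝ → ℝ} (hc : IsCoef c)
    {f : Plane → ℝ} (hf : MemLp f 2 volume) {φ : ℕ → 𝓢(Eu 2, ℝ)}
    (h : Tendsto (fun n => sL (φ n)) atTop (𝓝 (hf.toLp f))) :
    Tendsto (fun n => (lift_memLp (m := m) hk hε hc ((φ n).memLp 2 volume)).toLp _) atTop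
      (𝓝 ((lift_memLp (m := m) hk hε hc hf).toLp _)) := by
  obtain ⟨K, hK, hcK⟩ := hc.bdd
  rw [tendsto_iff_norm_sub_tendsto_zero] at h ⊢
  have hb : ∀ n, ‖(lift_memLp (m := m) hk hε hc ((φ n).memLp 2 volume)).toLp _ -
      (lift_memLp (m := m) hk hε hc hf).toLp _‖ ≤
      √(K ^ 2 * ((k + 1 / 2) * (2 * Real.pi) * ε ^ 2) * ‖sL (φ n) - hf.toLp f‖ ^ 2) := by
    intro n
    refine Real.le_sqrt_of_sq_le ?_
    have hd : MemLp (fun ξ => φ n ξ - f ξ) 2 volume := ((φ n).memLp 2 volume).sub hf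
    rw [← MemLp.toLp_sub, norm_toLp_complex_sq]
    have e1 : sL (φ n) - hf.toLp f = hd.toLp _ := rfl
    rw [e1, norm_toLp_sq]
    simp only [Pi.sub_apply, lift_sub]
    exact integral_lift_sq_le hk hε hc hcK hd
  refine squeeze_zero (fun n => norm_nonneg _) hb ?_
  have := ((h.pow 2).const_mul (K ^ 2 * ((k + 1 / 2) * (2 * Real.pi) * ε ^ 2))).sqrt
  simpa using this

/-- The Laplacian of a lift involves the function, its radial derivative and its Laplacian, so one
sequence must approximate all of them; compact support makes the lifts Schwartz functions. -/
theorem WeakLap.exists_seq_compact {d : ℕ} {f g : LL d} {df : Fin d → LL d} (h : WeakLap f g)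
    (hd : WeakGrad f df) :
    ∃ φ : ℕ → 𝓢(Eu d, ℝ), (∀ n, HasCompactSupport (φ n)) ∧
      Tendsto (fun n => sL (φ n)) atTop (𝓝 f) ∧ Tendsto (fun n => sL (sΔ (φ n))) atTop (𝓝 g) ∧
      ∀ i, Tendsto (fun n => sL (sD i (φ n))) atTop (𝓝 (df i)) := by
  obtain ⟨φ, df', hd', h1, h2, h3⟩ := h.exists_grad
  obtain rfl := hd'.unique hd
  let G : 𝓢(Eu d, ℝ) → LL d × LL d × (Fin d → LL d) :=
    fun φ => (sL φ, sL (sΔ φ), fun i => sL (sD i φ))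
  have hG : Continuous G := by fun_prop
  have hlim : Tendsto (fun n => G (φ n)) atTop (𝓝 (f, g, df')) :=
    h1.prodMk_nhds (h2.prodMk_nhds (tendsto_pi_nhds.2 h3))
  have hcl : (f, g, df') ∈ closure (G '' {φ | HasCompactSupport φ}) := by
    refine closure_minimal (s := Set.range fun n => G (φ n)) ?_ isClosed_closure
      (mem_closure_of_tendsto hlim (Eventually.of_forall fun n => ⟨n, rfl⟩))
    rintro _ ⟨n, rfl⟩
    exact mem_closure_of_tendsto ((hG.tendsto _).comp (tendsto_cutSchwartz (φ n)))
      (Eventually.of_forall fun m => ⟨_, hasCompactSupport_cutSchwartz m (φ n), rfl⟩)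
  obtain ⟨y, hy, hl⟩ := mem_closure_iff_seq_limit.1 hcl
  choose ψ hψ1 hψ2 using hy
  have hl' : Tendsto (fun n => G (ψ n)) atTop (𝓝 (f, g, df')) := hl.congr fun n => (hψ2 n).symm
  have hl2 := (continuous_snd.tendsto _).comp hl'
  exact ⟨ψ, hψ1, (continuous_fst.tendsto _).comp hl', (continuous_fst.tendsto _).comp hl2,
    fun i => ((continuous_apply i).tendsto _).comp ((continuous_snd.tendsto _).comp hl2)⟩

/-! ### Coefficients -/

theorem IsCoef.of_continuous {c : ℝ → ℝ} (hc : Continuous c) (h0 : ∀ s, 1 / 2 < |s| → c s = 0) :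
    IsCoef c := by
  have hcs : HasCompactSupport c := by
    refine HasCompactSupport.of_support_subset_isCompact (isCompact_Icc (a := -(1 / 2 : ℝ))
      (b := 1 / 2)) fun s hs => ?_
    rw [Set.mem_Icc, ← abs_le]
    exact not_lt.1 fun h => hs (h0 s h)
  obtain ⟨K, hK⟩ := hcs.exists_bound_of_continuous hc
  exact ⟨hc.measurable, ⟨K, (norm_nonneg _).trans (hK 0), hK⟩, h0⟩

theorem IsCoef.add {c d : ℝ → ℝ} (hc : IsCoef c) (hd : IsCoef d) : IsCoef fun s => c s + d s := by
  obtain ⟨K, hK, h⟩ := hc.bdd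
  obtain ⟨K', hK', h'⟩ := hd.bdd
  exact ⟨hc.meas.add hd.meas, ⟨K + K', by positivity,
    fun s => (abs_add_le _ _).trans (add_le_add (h s) (h' s))⟩,
    fun s hs => by rw [hc.zero s hs, hd.zero s hs, add_zero]⟩

/-- Products of coefficients with functions bounded on `[-1/2, 1/2]`. -/
theorem IsCoef.mul_left {c g : ℝ → ℝ} (hc : IsCoef c) (hg : Measurable g) {K : ℝ}
    (hK : ∀ s, |s| ≤ 1 / 2 → |g s| ≤ K) : IsCoef fun s => g s * c s := by
  obtain ⟨C, hC, h⟩ := hc.bdd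
  have hK0 : 0 ≤ K := (abs_nonneg _).trans (hK 0 (by norm_num))
  refine ⟨hg.mul hc.meas, ⟨K * C, by positivity, fun s => ?_⟩, fun s hs => by
    rw [hc.zero s hs, mul_zero]⟩
  by_cases hs : |s| ≤ 1 / 2
  · rw [abs_mul]
    exact mul_le_mul (hK s hs) (h s) (abs_nonneg _) hK0
  · rw [hc.zero s (not_le.1 hs), mul_zero, abs_zero]
    positivity

theorem IsCoef.const_mul {c : ℝ → ℝ} (a : ℝ) (hc : IsCoef c) : IsCoef fun s => a * c s :=
  hc.mul_left measurable_const fun _ _ => le_rfl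

theorem IsCoef.sub {c d : ℝ → ℝ} (hc : IsCoef c) (hd : IsCoef d) : IsCoef fun s => c s - d s := by
  have := hc.add (hd.const_mul (-1))
  simpa [sub_eq_add_neg] using this

/-- On the support `k + s ≥ 1/2`, so division by the radius costs at most a factor two: the tube
stays away from the axis. -/
theorem IsCoef.inv_mul {c : ℝ → ℝ} (hc : IsCoef c) {k : ℝ} (hk : 1 ≤ k) :
    IsCoef fun s => (k + s)⁻¹ * c s := by
  refine hc.mul_left (measurable_const.add measurable_id).inv (K := 2) fun s hs => ?_
  have h1 : 1 / 2 ≤ k + s := by linarith [(abs_le.1 hs).1]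
  rw [abs_inv, abs_of_pos (by linarith)]
  exact inv_le_of_inv_le₀ (by norm_num) (by linarith)

section Cut

variable {χ : ℝ → ℝ}

theorem IsCutoff.eq_zero_of_notMem (hχ : IsCutoff χ) {s : ℝ} (hs : 1 / 2 < |s|) :
    s ∉ tsupport χ := fun h => by
  have := hχ.support h
  rw [Set.mem_Icc, ← abs_le] at this
  linarith

theorem IsCutoff.coef (hχ : IsCutoff χ) : IsCoef χ :=
  IsCoef.of_continuous hχ.smooth.continuous fun _ hs =>
    image_eq_zero_of_notMem_tsupport (hχ.eq_zero_of_notMem hs)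

theorem IsCutoff.coef_deriv (hχ : IsCutoff χ) : IsCoef (deriv χ) :=
  IsCoef.of_continuous (hχ.smooth.continuous_deriv (by simp)) fun s hs =>
    image_eq_zero_of_notMem_tsupport fun h => hχ.eq_zero_of_notMem hs (tsupport_deriv_subset h)

theorem IsCutoff.contDiff_deriv (hχ : IsCutoff χ) : ContDiff ℝ ∞ (deriv χ) :=
  (contDiff_infty_iff_deriv.1 hχ.smooth).2

theorem IsCutoff.coef_deriv_two (hχ : IsCutoff χ) : IsCoef (deriv (deriv χ)) :=
  IsCoef.of_continuous (hχ.contDiff_deriv.continuous_deriv (by simp)) fun s hs =>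
    image_eq_zero_of_notMem_tsupport fun h => hχ.eq_zero_of_notMem hs
      (tsupport_deriv_subset (tsupport_deriv_subset h))

/-- The coefficient of the gradient in the Laplacian of a lift. -/
def gradCoef (χ : ℝ → ℝ) (k ε s : ℝ) : ℝ := 2 / ε * deriv χ s + 1 / ε * ((k + s)⁻¹ * χ s)

/-- The coefficient of order zero in the Laplacian of a lift. -/
def zeroCoef (χ : ℝ → ℝ) (m : ℕ) (k s : ℝ) : ℝ :=
  deriv (deriv χ) s + (k + s)⁻¹ * deriv χ s - (m : ℝ) ^ 2 * ((k + s)⁻¹ * ((k + s)⁻¹ * χ s))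

theorem IsCutoff.gradCoef (hχ : IsCutoff χ) {k : ℝ} (hk : 1 ≤ k) (ε : ℝ) :
    IsCoef (gradCoef χ k ε) :=
  (hχ.coef_deriv.const_mul _).add ((hχ.coef.inv_mul hk).const_mul _)

theorem IsCutoff.zeroCoef (hχ : IsCutoff χ) (m : ℕ) {k : ℝ} (hk : 1 ≤ k) :
    IsCoef (zeroCoef χ m k) :=
  (hχ.coef_deriv_two.add (hχ.coef_deriv.inv_mul hk)).sub
    (((hχ.coef.inv_mul hk).inv_mul hk).const_mul _)

theorem hasDerivAt_rho (φ : 𝓢(Eu 2, ℝ)) (k ε y r : ℝ) :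
    HasDerivAt (fun r => φ !₂[(r - k) / ε, y / ε]) (sD 0 φ !₂[(r - k) / ε, y / ε] / ε) r := by
  have h1 : HasDerivAt (fun r => (!₂[(r - k) / ε, y / ε] : Eu 2)) (ε⁻¹ • ev 0) r := by
    have h2 : HasDerivAt (fun r : ℝ => (!₂[-k / ε, y / ε] : Eu 2) + r • (ε⁻¹ • ev 0))
        (ε⁻¹ • ev 0) r := by
      simpa using ((hasDerivAt_id r).smul_const (ε⁻¹ • (ev 0 : Eu 2))).const_add (!₂[-k / ε, y / ε] : Eu 2)
    convert h2 using 2 with r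
    ext i
    fin_cases i <;> simp [ev]
    ring
  have := (φ.differentiable _).hasFDerivAt.comp_hasDerivAt r h1
  refine this.congr_deriv ?_
  rw [map_smul, smul_eq_mul, sD_apply, inv_mul_eq_div]

theorem hasDerivAt_sigma (φ : 𝓢(Eu 2, ℝ)) (ε a y : ℝ) :
    HasDerivAt (fun y => φ !₂[a, y / ε]) (sD 1 φ !₂[a, y / ε] / ε) y := by
  have h1 : HasDerivAt (fun y => (!₂[a, y / ε] : Eu 2)) (ε⁻¹ • ev 1) y := by
    have h2 : HasDerivAt (fun y : ℝ => (!₂[a, 0] : Eu 2) + y • (ε⁻¹ • ev 1))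
        (ε⁻¹ • ev 1) y := by
      simpa using ((hasDerivAt_id y).smul_const (ε⁻¹ • (ev 1 : Eu 2))).const_add (!₂[a, 0] : Eu 2)
    convert h2 using 2 with y
    ext i
    fin_cases i <;> simp [ev]
    ring
  have := (φ.differentiable _).hasFDerivAt.comp_hasDerivAt y h1
  refine this.congr_deriv ?_
  rw [map_smul, smul_eq_mul, sD_apply, inv_mul_eq_div]

theorem contDiffAt_radius {x : Space} (hx : radius x ≠ 0) : ContDiffAt ℝ ∞ radius x := by
  have h : x 0 ^ 2 + x 1 ^ 2 ≠ 0 := fun h => hx (by rw [radius, h, Real.sqrt_zero])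
  unfold radius
  exact ContDiffAt.sqrt (by fun_prop) h

/-- The radius and the phase are singular only on the axis, and the cutoff makes the lift vanish in
a neighbourhood of it. -/
theorem contDiff_lift (hχ : IsCutoff χ) (m : ℕ) {k : ℝ} (hk : 1 ≤ k) (ε : ℝ) (φ : 𝓢(Eu 2, ℝ)) :
    ContDiff ℝ ∞ (lift m k ε χ φ) := by
  refine contDiff_iff_contDiffAt.2 fun x => ?_
  by_cases hx : radius x = 0
  · have : lift m k ε χ φ =ᶠ[𝓝 x] fun _ => 0 := by
      have : ∀ᶠ y in 𝓝 x, radius y < 1 / 2 :=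
        continuous_radius.continuousAt.eventually (gt_mem_nhds (by rw [hx]; norm_num))
      filter_upwards [this] with y hy
      refine lift_eq_zero hχ.coef fun h => ?_
      have := (abs_le.1 (mem_tube.1 h)).1
      linarith
    exact contDiffAt_const.congr_of_eventuallyEq this
  · have hr := contDiffAt_radius hx
    have hof : ContDiff ℝ ∞ (fun a : ℝ => (a : ℂ)) := Complex.ofRealCLM.contDiff
    have hcoord : ∀ i, ContDiffAt ℝ ∞ (fun x : Space => x i) x := fun i => by fun_prop
    have h1 : ContDiffAt ℝ ∞ (fun x : Space => (x 0 : ℂ) + Complex.I * x 1) x :=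
      (hof.contDiffAt.comp x (hcoord 0)).add
        (contDiffAt_const.mul (hof.contDiffAt.comp x (hcoord 1)))
    have h2 : ContDiffAt ℝ ∞ (phase m) x := by
      unfold phase
      refine ContDiffAt.pow ?_ m
      simp only [div_eq_mul_inv]
      exact h1.mul ((hof.contDiffAt.comp x hr).inv (by simpa using hx))
    have h3 : ContDiffAt ℝ ∞ (tubeMap k ε) x := by
      unfold tubeMap
      rw [contDiffAt_euclidean]
      intro i
      fin_cases i
      · exact (hr.sub contDiffAt_const).div_const ε
      · exact (hcoord 2).div_const ε
    have h4 : ContDiffAt ℝ ∞ (fun x => χ (radius x - k)) x :=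
      hχ.smooth.contDiffAt.comp x (hr.sub contDiffAt_const)
    have h5 : ContDiffAt ℝ ∞ (fun x => φ (tubeMap k ε x)) x :=
      (φ.smooth ⊤).contDiffAt.comp x h3
    exact h2.mul (hof.contDiffAt.comp x (h4.mul h5))

theorem hasCompactSupport_lift {c : ℝ → ℝ} (hc : IsCoef c) (m : ℕ) (k : ℝ) {ε : ℝ} (hε : 0 < ε)
    {φ : Plane → ℝ} (hφ : HasCompactSupport φ) : HasCompactSupport (lift m k ε c φ) := by
  obtain ⟨R, hR⟩ := hφ.isBounded.subset_closedBall 0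
  refine HasCompactSupport.of_support_subset_isCompact
    (isCompact_closedBall (0 : Space) √((|k| + 1 / 2) ^ 2 + (ε * R) ^ 2)) fun x hx => ?_
  have h1 : x ∈ tube k := by_contra fun h => hx (lift_eq_zero hc h)
  have h2 : tubeMap k ε x ∈ tsupport φ := by
    by_contra h
    refine hx ?_
    rw [lift, image_eq_zero_of_notMem_tsupport h]
    simp
  have h3 := hR h2
  rw [mem_closedBall_zero_iff] at h3 ⊢
  refine Real.le_sqrt_of_sq_le ?_
  have h4 : ‖x‖ ^ 2 = radius x ^ 2 + x 2 ^ 2 := by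
    rw [radius_sq, EuclideanSpace.real_norm_sq_eq, Fin.sum_univ_three]
  have h5 : |x 2 / ε| ≤ R := by
    refine le_trans ?_ h3
    have := PiLp.norm_apply_le (tubeMap k ε x) 1
    rwa [Real.norm_eq_abs] at this
  have h6 : |x 2| ≤ ε * R := by
    rw [abs_div, abs_of_pos hε, div_le_iff₀ hε] at h5
    linarith
  have h7 : radius x ≤ |k| + 1 / 2 := by
    have := (abs_le.1 (mem_tube.1 h1)).2
    linarith [le_abs_self k]
  rw [h4, ← sq_abs (x 2)]
  have := radius_nonneg x
  gcongr

/-- The Laplacian of a smooth compactly supported lift. -/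
theorem laplacian_lift (L : ℂ →L[ℝ] ℝ) (hχ : IsCutoff χ) (m : ℕ) {k ε : ℝ} (hk : 1 ≤ k) (hε : 0 < ε)
    {φ : 𝓢(Eu 2, ℝ)} {S : 𝓢(Eu 3, ℝ)}
    (hS : ∀ x, S x = L (lift m k ε χ φ x)) (x : Space) :
    sΔ S x = L (lift m k ε (fun s => 1 / ε ^ 2 * χ s) (sΔ φ) x +
      lift m k ε (gradCoef χ k ε) (sD 0 φ) x + lift m k ε (zeroCoef χ m k) φ x) := by
  have hc2 : IsCoef fun s => 1 / ε ^ 2 * χ s := hχ.coef.const_mul _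
  by_cases hx : radius x = 0
  · have hx' : x ∉ tube k := fun h => by
      have := (abs_le.1 (mem_tube.1 h)).1
      linarith
    rw [lift_eq_zero hc2 hx', lift_eq_zero (hχ.gradCoef hk ε) hx', lift_eq_zero (hχ.zeroCoef m hk) hx',
      add_zero, add_zero, map_zero, sΔ_eq_sum]
    have h0 : ∀ i, sD i (sD i S) x = 0 := fun i => by
      refine sD_sD_eq (f := fun _ => 0) (f' := fun _ => 0) ?_
        (Eventually.of_forall fun t => hasDerivAt_const t 0) (hasDerivAt_const 0 0)
      have hcont : Continuous fun t : ℝ => radius (x + t • ev i) :=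
        continuous_radius.comp (by fun_prop)
      have : ∀ᶠ t : ℝ in 𝓝 0, radius (x + t • ev i) < 1 / 2 :=
        hcont.continuousAt.eventually (gt_mem_nhds (by simp [hx]))
      filter_upwards [this] with t ht
      rw [hS, lift_eq_zero hχ.coef, map_zero]
      intro h
      have := (abs_le.1 (mem_tube.1 h)).1
      linarith
    simp [Fin.sum_univ_three, h0]
  · have hχ1 : ∀ s, HasDerivAt χ (deriv χ s) s := fun s =>
      (hχ.smooth.differentiable (by simp) s).hasDerivAt
    have hχ2 : ∀ s, HasDerivAt (deriv χ) (deriv (deriv χ) s) s := fun s =>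
      (hχ.contDiff_deriv.differentiable (by simp) s).hasDerivAt
    have t1 : ∀ r, HasDerivAt (fun r => χ (r - k)) (deriv χ (r - k)) r := fun r =>
      (hχ1 (r - k)).comp_sub_const r k
    have t2 : ∀ r, HasDerivAt (fun r => deriv χ (r - k)) (deriv (deriv χ) (r - k)) r := fun r =>
      (hχ2 (r - k)).comp_sub_const r k
    have key := laplacian_cylindrical L (φ := S) (m := m)
      (P := fun r y => χ (r - k) * φ !₂[(r - k) / ε, y / ε])
      (P1 := fun r y => deriv χ (r - k) * φ !₂[(r - k) / ε, y / ε] +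
        χ (r - k) * (sD 0 φ !₂[(r - k) / ε, y / ε] / ε))
      (P2 := fun r y => deriv (deriv χ) (r - k) * φ !₂[(r - k) / ε, y / ε] +
        deriv χ (r - k) * (sD 0 φ !₂[(r - k) / ε, y / ε] / ε) +
        (deriv χ (r - k) * (sD 0 φ !₂[(r - k) / ε, y / ε] / ε) +
        χ (r - k) * (sD 0 (sD 0 φ) !₂[(r - k) / ε, y / ε] / ε / ε)))
      (Q1 := fun r y => χ (r - k) * (sD 1 φ !₂[(r - k) / ε, y / ε] / ε))
      (Q2 := fun r y => χ (r - k) * (sD 1 (sD 1 φ) !₂[(r - k) / ε, y / ε] / ε / ε))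
      hS
      (fun y r => (t1 r).mul (hasDerivAt_rho φ k ε y r))
      (fun y r => ((t2 r).mul (hasDerivAt_rho φ k ε y r)).add
        ((t1 r).mul ((hasDerivAt_rho (sD 0 φ) k ε y r).div_const ε)))
      (fun r y => (hasDerivAt_sigma φ ε _ y).const_mul _)
      (fun r y => ((hasDerivAt_sigma (sD 1 φ) ε _ y).div_const ε).const_mul _) hx
    rw [key]
    congr 1
    have hsum : sΔ φ (tubeMap k ε x) =
        sD 0 (sD 0 φ) (tubeMap k ε x) + sD 1 (sD 1 φ) (tubeMap k ε x) := by
      rw [sΔ_eq_sum, Fin.sum_univ_two, add_apply]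
    simp only [lift]
    rw [hsum, ← mul_add, ← mul_add, ← Complex.ofReal_add, ← Complex.ofReal_add]
    congr 2
    simp only [gradCoef, zeroCoef, tubeMap, add_sub_cancel]
    generalize φ !₂[(radius x - k) / ε, x 2 / ε] = a0
    generalize sD 0 φ !₂[(radius x - k) / ε, x 2 / ε] = a1
    generalize sD 0 (sD 0 φ) !₂[(radius x - k) / ε, x 2 / ε] = a2
    generalize sD 1 (sD 1 φ) !₂[(radius x - k) / ε, x 2 / ε] = a3
    field_simp
    ring

/-- `Δ f = g` in the weak sense, for complex functions. -/
def CLap (f g : Lp ℂ 2 (volume : Measure Space)) : Prop :=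
  ∀ L : ℂ →L[ℝ] ℝ, WeakLap (L.compLp f : LL 3) (L.compLp g)

theorem half_le_of_one_le {k : ℝ} (hk : 1 ≤ k) : 1 / 2 ≤ k := by linarith

/-- The weak Laplacian of a lift. -/
theorem lift_cLap (hχ : IsCutoff χ) (m : ℕ) {k ε : ℝ} (hk : 1 ≤ k) (hε : 0 < ε)
    {V D G : Plane → ℝ} {df : Fin 2 → LL 2} (hV : MemLp V 2 volume) (hD : MemLp D 2 volume)
    (hG : MemLp G 2 volume)
    (h : WeakLap (hV.toLp V : LL 2) (hG.toLp G)) (hg : WeakGrad (hV.toLp V : LL 2) df)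
    (hdf : df 0 = hD.toLp D) :
    CLap ((lift_memLp (m := m) (half_le_of_one_le hk) hε hχ.coef hV).toLp _)
      ((lift_memLp (m := m) (half_le_of_one_le hk) hε (hχ.coef.const_mul (1 / ε ^ 2)) hG).toLp _ +
        (lift_memLp (m := m) (half_le_of_one_le hk) hε (hχ.gradCoef hk ε) hD).toLp _ +
        (lift_memLp (m := m) (half_le_of_one_le hk) hε (hχ.zeroCoef m hk) hV).toLp _) := by
  intro L
  obtain ⟨φ, hc, h1, h2, h3⟩ := h.exists_seq_compact hg
  have h3' := h3 0
  rw [hdf] at h3'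
  have hk2 : 1 / 2 ≤ k := by linarith
  have hcl : Continuous fun f : Lp ℂ 2 (volume : Measure Space) => (L.compLp f : LL 3) :=
    (L.compLpL 2 volume).continuous
  -- For the smooth approximants the formula is the classical one; each term converges in `L²`, and
  -- weak Laplacians are closed under such limits.
  refine WeakLap.of_tendsto (fun n => ?_)
    ((hcl.tendsto _).comp (tendsto_lift (m := m) hk2 hε hχ.coef hV h1))
    ((hcl.tendsto _).comp (((tendsto_lift (m := m) hk2 hε (hχ.coef.const_mul (1 / ε ^ 2)) hG h2).add
      (tendsto_lift (m := m) hk2 hε (hχ.gradCoef hk ε) hD h3')).add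
      (tendsto_lift (m := m) hk2 hε (hχ.zeroCoef m hk) hV h1)))
  let S : 𝓢(Eu 3, ℝ) := HasCompactSupport.toSchwartzMap (f := fun x => L (lift m k ε χ (φ n) x))
    ((hasCompactSupport_lift hχ.coef m k hε (hc n)).comp_left (g := L) (map_zero L))
    (L.contDiff.comp (contDiff_lift hχ m hk ε (φ n)))
  have hS : ∀ x, S x = L (lift m k ε χ (φ n) x) := fun x => rfl
  have hΔ := laplacian_lift L hχ m hk hε hS
  have e1 : L.compLp ((lift_memLp (m := m) hk2 hε hχ.coef ((φ n).memLp 2 volume)).toLp _) =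
      sL S := by
    refine Lp.ext ?_
    filter_upwards [L.coeFn_compLp ((lift_memLp (m := m) hk2 hε hχ.coef
      ((φ n).memLp 2 volume)).toLp _), coeFn_sL S,
      (lift_memLp (m := m) hk2 hε hχ.coef ((φ n).memLp 2 volume)).coeFn_toLp] with x a1 a2 a3
    rw [a1, a2, a3, hS]
  have e2 : L.compLp ((lift_memLp (m := m) (k := k) hk2 hε (hχ.coef.const_mul (1 / ε ^ 2))
        ((sΔ (φ n)).memLp 2 volume)).toLp _ +
      (lift_memLp (m := m) hk2 hε (hχ.gradCoef hk ε) ((sD 0 (φ n)).memLp 2 volume)).toLp _ +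
      (lift_memLp (m := m) hk2 hε (hχ.zeroCoef m hk) ((φ n).memLp 2 volume)).toLp _) =
      sL (sΔ S) := by
    rw [← MemLp.toLp_add, ← MemLp.toLp_add]
    refine Lp.ext ?_
    filter_upwards [L.coeFn_compLp (MemLp.toLp _ (((lift_memLp (m := m) (k := k) hk2 hε
      (hχ.coef.const_mul (1 / ε ^ 2)) ((sΔ (φ n)).memLp 2 volume)).add (lift_memLp (m := m) hk2 hε
      (hχ.gradCoef hk ε) ((sD 0 (φ n)).memLp 2 volume))).add (lift_memLp (m := m) hk2 hε
      (hχ.zeroCoef m hk) ((φ n).memLp 2 volume)))), coeFn_sL (sΔ S),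
      (((lift_memLp (m := m) (k := k) hk2 hε
      (hχ.coef.const_mul (1 / ε ^ 2)) ((sΔ (φ n)).memLp 2 volume)).add (lift_memLp (m := m) hk2 hε
      (hχ.gradCoef hk ε) ((sD 0 (φ n)).memLp 2 volume))).add (lift_memLp (m := m) hk2 hε
      (hχ.zeroCoef m hk) ((φ n).memLp 2 volume))).coeFn_toLp] with x a1 a2 a3
    rw [a1, a2, a3, hΔ]
    rfl
  simp only [Function.comp_apply]
  rw [e1, e2]
  exact weakLap_sL S

end Cut

/-! ### The residual of the approximate solution -/

/-- A coefficient vanishing near zero may be divided by `s³`. At `s = ερ` this trades three powers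
of the decaying variable `ρ` for a factor `ε³`, which is how polynomial decay makes the cutoff
errors small. -/
theorem IsCoef.div_cube {c : ℝ → ℝ} (hc : IsCoef c) (h0 : ∀ s, |s| < 1 / 4 → c s = 0) :
    IsCoef fun s => c s / s ^ 3 := by
  obtain ⟨K, hK, h⟩ := hc.bdd
  refine ⟨hc.meas.div (measurable_id.pow_const 3), ⟨64 * K, by positivity, fun s => ?_⟩,
    fun s hs => by rw [hc.zero s hs, zero_div]⟩
  by_cases hs : |s| < 1 / 4
  · rw [h0 s hs, zero_div, abs_zero]
    positivity
  · have h1 : 1 / 4 ≤ |s| := not_lt.1 hs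
    have h2 : (1 / 4) ^ 3 ≤ |s| ^ 3 := pow_le_pow_left₀ (by norm_num) h1 3
    rw [abs_div, abs_pow, div_le_iff₀ (by positivity)]
    calc |c s| ≤ K := h s
      _ = 64 * K * (1 / 4) ^ 3 := by ring
      _ ≤ _ := by gcongr

theorem div_cube_mul {c : ℝ → ℝ} (h0 : ∀ s, |s| < 1 / 4 → c s = 0) (s : ℝ) :
    c s = c s / s ^ 3 * s ^ 3 := by
  by_cases hs : s = 0
  · rw [h0 s (by rw [hs]; norm_num)]
    simp
  · field_simp

section Cut

variable {χ : ℝ → ℝ}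

theorem IsCutoff.eventually_eq_one (hχ : IsCutoff χ) {s : ℝ} (hs : |s| < 1 / 4) :
    χ =ᶠ[𝓝 s] fun _ => 1 := by
  filter_upwards [continuous_abs.continuousAt.eventually (gt_mem_nhds hs)] with t ht
  exact hχ.eq_one t (abs_le.1 ht.le)

theorem IsCutoff.deriv_eventually (hχ : IsCutoff χ) {s : ℝ} (hs : |s| < 1 / 4) :
    deriv χ =ᶠ[𝓝 s] fun _ => 0 := by
  have := (hχ.eventually_eq_one hs).deriv
  rwa [deriv_const'] at this

theorem IsCutoff.deriv_eq_zero (hχ : IsCutoff χ) (s : ℝ) (hs : |s| < 1 / 4) : deriv χ s = 0 :=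
  (hχ.deriv_eventually hs).eq_of_nhds

theorem IsCutoff.deriv_two_eq_zero (hχ : IsCutoff χ) (s : ℝ) (hs : |s| < 1 / 4) :
    deriv (deriv χ) s = 0 := by
  have := (hχ.deriv_eventually hs).deriv
  rw [deriv_const'] at this
  exact this.eq_of_nhds

theorem IsCutoff.coef_sub_cube (hχ : IsCutoff χ) : IsCoef fun s => χ s - χ s ^ 3 := by
  refine IsCoef.of_continuous (hχ.smooth.continuous.sub (hχ.smooth.continuous.pow 3))
    fun s hs => ?_
  rw [hχ.coef.zero s hs]
  norm_num

theorem IsCutoff.sub_cube_eq_zero (hχ : IsCutoff χ) (s : ℝ) (hs : |s| < 1 / 4) :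
    χ s - χ s ^ 3 = 0 := by
  rw [hχ.eq_one s (abs_le.1 hs.le)]
  norm_num

end Cut

variable {k : ℕ} {b : ℝ}

/-- `v₀ + ε v₁ + ε² v₂`. -/
def Profile.sum (p : Profile k b) (ε : ℝ) (ξ : Plane) : ℝ :=
  p.v 0 ξ + ε * p.v 1 ξ + ε ^ 2 * p.v 2 ξ

/-- `∂_ρ (v₀ + ε v₁ + ε² v₂)`. -/
def Profile.dsum (p : Profile k b) (ε : ℝ) (ξ : Plane) : ℝ :=
  p.dv 0 0 ξ + ε * p.dv 1 0 ξ + ε ^ 2 * p.dv 2 0 ξ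

/-- The right-hand side `P₀ v_j` of the profile equations. -/
def Profile.rhs (p : Profile k b) (j : Fin 3) (ξ : Plane) : ℝ :=
  match j with
  | 0 => p.E 0 * p.v 0 ξ - b * p.v 0 ξ ^ 3
  | 1 => p.E 0 * p.v 1 ξ + p.E 1 * p.v 0 ξ - 3 * b * (p.v 0 ξ ^ 2 * p.v 1 ξ)
      + 1 / k * p.dv 0 0 ξ + 4 / k * ξ 0 ^ 3 * p.v 0 ξ
  | 2 => p.E 0 * p.v 2 ξ + p.E 1 * p.v 1 ξ + p.E 2 * p.v 0 ξ
      - 3 * b * (p.v 0 ξ ^ 2 * p.v 2 ξ + p.v 0 ξ * p.v 1 ξ ^ 2)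
      + 1 / k * p.dv 1 0 ξ + 4 / k * ξ 0 ^ 3 * p.v 1 ξ
      - 1 / (k : ℝ) ^ 2 * ξ 0 * p.dv 0 0 ξ - 5 / (k : ℝ) ^ 2 * ξ 0 ^ 4 * p.v 0 ξ

/-- `Δ (v₀ + ε v₁ + ε² v₂)`. -/
def Profile.lap (p : Profile k b) (ε : ℝ) (ξ : Plane) : ℝ :=
  (potential ξ * p.v 0 ξ - p.rhs 0 ξ) + ε * (potential ξ * p.v 1 ξ - p.rhs 1 ξ) +
    ε ^ 2 * (potential ξ * p.v 2 ξ - p.rhs 2 ξ)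

/-- The part of the remainder that does not involve the derivatives of the cutoff or the expansion
of the radius. -/
def Profile.remainderCore (p : Profile k b) (ε : ℝ) (ξ : Plane) : ℝ :=
  1 / (k : ℝ) * p.dv 2 0 ξ - 1 / (k : ℝ) ^ 2 * (ξ 0 ^ 1 * p.dv 1 0 ξ)
    - ε * (1 / (k : ℝ) ^ 2) * (ξ 0 ^ 1 * p.dv 2 0 ξ) + 4 / (k : ℝ) * (ξ 0 ^ 3 * p.v 2 ξ)
    - 5 / (k : ℝ) ^ 2 * (ξ 0 ^ 4 * p.v 1 ξ) - ε * (5 / (k : ℝ) ^ 2) * (ξ 0 ^ 4 * p.v 2 ξ)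
    + p.E 1 * p.v 2 ξ + p.E 2 * p.v 1 ξ + ε * p.E 2 * p.v 2 ξ
    - b * (6 * (p.v 0 ξ * p.v 1 ξ * p.v 2 ξ) + p.v 1 ξ * p.v 1 ξ * p.v 1 ξ
      + ε * (3 * (p.v 0 ξ * p.v 2 ξ * p.v 2 ξ) + 3 * (p.v 1 ξ * p.v 1 ξ * p.v 2 ξ))
      + ε * ε * 3 * (p.v 1 ξ * p.v 2 ξ * p.v 2 ξ) + ε * ε * ε * (p.v 2 ξ * p.v 2 ξ * p.v 2 ξ))

/-- The rescaled remainder. -/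
def Profile.remainder (χ : ℝ → ℝ) (p : Profile k b) (ε : ℝ) (ξ : Plane) : ℝ :=
  χ (ε * ξ 0) * p.remainderCore ε ξ
    + 1 / (k : ℝ) ^ 2 * ((k + ε * ξ 0)⁻¹ * χ (ε * ξ 0)) * (ξ 0 ^ 2 * p.dsum ε ξ)
    + (6 * k + 5 * (ε * ξ 0)) * (1 / (k : ℝ) ^ 2 *
      ((k + ε * ξ 0)⁻¹ * ((k + ε * ξ 0)⁻¹ * χ (ε * ξ 0)))) * (ξ 0 ^ 5 * p.sum ε ξ)
    + 2 * ε * (deriv χ (ε * ξ 0) / (ε * ξ 0) ^ 3 * (ξ 0 ^ 3 * p.dsum ε ξ))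
    + ε * ε * (deriv (deriv χ) (ε * ξ 0) / (ε * ξ 0) ^ 3 * (ξ 0 ^ 3 * p.sum ε ξ))
    + ε * ε * ((k + ε * ξ 0)⁻¹ * (deriv χ (ε * ξ 0) / (ε * ξ 0) ^ 3) * (ξ 0 ^ 3 * p.sum ε ξ))
    + b * ((χ (ε * ξ 0) - χ (ε * ξ 0) ^ 3) / (ε * ξ 0) ^ 3 *
      (ξ 0 ^ 3 * (p.sum ε ξ * p.sum ε ξ * p.sum ε ξ)))

/-- The equations satisfied by the profiles cancel the residual up to the order `ε³`. -/
theorem Profile.residual_eq {χ : ℝ → ℝ} (hχ : IsCutoff χ) (p : Profile k b) (hk : 1 ≤ k)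
    {ε m : ℝ} (hε : ε ≠ 0) (hm : m * ε ^ 2 = (k : ℝ) ^ 2) (ξ : Plane) (hr : (k : ℝ) + ε * ξ 0 ≠ 0) :
    ε ^ 4 * (1 / ε * (1 / ε ^ 2 * χ (ε * ξ 0) * p.lap ε ξ +
        (2 / ε * deriv χ (ε * ξ 0) + 1 / ε * ((k + ε * ξ 0)⁻¹ * χ (ε * ξ 0))) * p.dsum ε ξ +
        (deriv (deriv χ) (ε * ξ 0) + (k + ε * ξ 0)⁻¹ * deriv χ (ε * ξ 0) -
          m ^ 2 * ((k + ε * ξ 0)⁻¹ * ((k + ε * ξ 0)⁻¹ * χ (ε * ξ 0)))) * p.sum ε ξ)) -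
      ((k + ε * ξ 0) ^ 2 + (ε * ξ 1) ^ 2) * (1 / ε * (χ (ε * ξ 0) * p.sum ε ξ)) +
      (2 * (k : ℝ) ^ 2 + ε ^ 2 * (p.E 0 + ε * p.E 1 + ε ^ 2 * p.E 2)) *
        (1 / ε * (χ (ε * ξ 0) * p.sum ε ξ)) -
      b * ε ^ 4 * (1 / ε * (χ (ε * ξ 0) * p.sum ε ξ)) ^ 3 = ε ^ 4 * p.remainder χ ε ξ := by
  have hk0 : (k : ℝ) ≠ 0 := by positivity
  have e1 := div_cube_mul hχ.deriv_eq_zero (ε * ξ 0)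
  have e2 := div_cube_mul hχ.deriv_two_eq_zero (ε * ξ 0)
  have e3 := div_cube_mul (c := fun s => χ s - χ s ^ 3) hχ.sub_cube_eq_zero (ε * ξ 0)
  have hm' : m = (k : ℝ) ^ 2 / ε ^ 2 := by rw [← hm]; field_simp
  unfold Profile.remainder
  simp only at e3
  set q1 := deriv χ (ε * ξ 0) / (ε * ξ 0) ^ 3
  set q2 := deriv (deriv χ) (ε * ξ 0) / (ε * ξ 0) ^ 3
  set q3 := (χ (ε * ξ 0) - χ (ε * ξ 0) ^ 3) / (ε * ξ 0) ^ 3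
  rw [e1, e2]
  set c := χ (ε * ξ 0)
  set S := p.sum ε ξ with hS
  set D := p.dsum ε ξ with hD
  -- The second order expansion of `1/r` at `r = k`, with its exact remainder.
  have ha : ((k : ℝ) + ε * ξ 0)⁻¹ = 1 / k - ε * (ξ 0 / k ^ 2) +
      ε ^ 2 * (1 / (k : ℝ) ^ 2 * ξ 0 ^ 2 * ((k : ℝ) + ε * ξ 0)⁻¹) := by
    field_simp
    ring
  -- The expansion of `2k² - k⁴/r² - r² = -(r - k²/r)²` at `r = k`, with exact remainder. The
  -- quadratic term is the oscillator `4ρ²`; the cubic and quartic ones are the sources in the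
  -- equations of `v₁` and `v₂`.
  have hb : ε ^ 2 * (4 * ξ 0 ^ 2) - m ^ 2 * ε ^ 4 * (((k : ℝ) + ε * ξ 0)⁻¹ * ((k : ℝ) + ε * ξ 0)⁻¹) -
      ((k : ℝ) + ε * ξ 0) ^ 2 + 2 * (k : ℝ) ^ 2 =
      ε ^ 2 * (4 / k * ε * ξ 0 ^ 3 - 5 / (k : ℝ) ^ 2 * ε ^ 2 * ξ 0 ^ 4 +
        ε ^ 3 * ((6 * k + 5 * (ε * ξ 0)) * (1 / (k : ℝ) ^ 2 *
          (((k : ℝ) + ε * ξ 0)⁻¹ * ((k : ℝ) + ε * ξ 0)⁻¹)) * ξ 0 ^ 5)) := by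
    rw [hm']
    field_simp
    ring
  have hc : c * p.lap ε ξ = c * ((4 * ξ 0 ^ 2 + ξ 1 ^ 2) * S -
      (p.rhs 0 ξ + ε * p.rhs 1 ξ + ε ^ 2 * p.rhs 2 ξ)) := by
    rw [hS, Profile.lap, Profile.sum, potential]
    ring
  -- The coefficients of `1`, `ε` and `ε²` cancel identically: this is precisely what the three
  -- profile equations were designed for.
  have hcore : - (p.rhs 0 ξ + ε * p.rhs 1 ξ + ε ^ 2 * p.rhs 2 ξ) +
      ε * (1 / k - ε * (ξ 0 / k ^ 2)) * D +
      (4 / k * ε * ξ 0 ^ 3 - 5 / (k : ℝ) ^ 2 * ε ^ 2 * ξ 0 ^ 4) * S +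
      (p.E 0 + ε * p.E 1 + ε ^ 2 * p.E 2) * S - b * S ^ 3 = ε ^ 3 * p.remainderCore ε ξ := by
    rw [hS, hD, Profile.sum, Profile.dsum, Profile.remainderCore]
    simp only [Profile.rhs]
    ring
  set r := ((k : ℝ) + ε * ξ 0)⁻¹ with hrdef
  have lhs : ε ^ 4 * (1 / ε * (1 / ε ^ 2 * c * p.lap ε ξ +
        (2 / ε * (q1 * (ε * ξ 0) ^ 3) + 1 / ε * (r * c)) * D +
        (q2 * (ε * ξ 0) ^ 3 + r * (q1 * (ε * ξ 0) ^ 3) - m ^ 2 * (r * (r * c))) * S)) -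
      ((k + ε * ξ 0) ^ 2 + (ε * ξ 1) ^ 2) * (1 / ε * (c * S)) +
      (2 * (k : ℝ) ^ 2 + ε ^ 2 * (p.E 0 + ε * p.E 1 + ε ^ 2 * p.E 2)) * (1 / ε * (c * S)) -
      b * ε ^ 4 * (1 / ε * (c * S)) ^ 3 =
      ε * (c * p.lap ε ξ) + ε ^ 2 * (2 * (q1 * (ε * ξ 0) ^ 3) + r * c) * D +
      ε ^ 3 * (q2 * (ε * ξ 0) ^ 3 + r * (q1 * (ε * ξ 0) ^ 3)) * S +
      1 / ε * (- m ^ 2 * ε ^ 4 * (r * r) - ((k : ℝ) + ε * ξ 0) ^ 2 + 2 * (k : ℝ) ^ 2) * (c * S) -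
      ε * ξ 1 ^ 2 * (c * S) + ε * (p.E 0 + ε * p.E 1 + ε ^ 2 * p.E 2) * (c * S) -
      ε * b * c ^ 3 * S ^ 3 := by
    field_simp
    ring
  rw [lhs, hc]
  have hb' : 1 / ε * (- m ^ 2 * ε ^ 4 * (r * r) - ((k : ℝ) + ε * ξ 0) ^ 2 + 2 * (k : ℝ) ^ 2) =
      ε * (4 / k * ε * ξ 0 ^ 3 - 5 / (k : ℝ) ^ 2 * ε ^ 2 * ξ 0 ^ 4 +
        ε ^ 3 * ((6 * k + 5 * (ε * ξ 0)) * (1 / (k : ℝ) ^ 2 * (r * r)) * ξ 0 ^ 5)) -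
      ε * (4 * ξ 0 ^ 2) := by
    have : - m ^ 2 * ε ^ 4 * (r * r) - ((k : ℝ) + ε * ξ 0) ^ 2 + 2 * (k : ℝ) ^ 2 =
      ε ^ 2 * (4 / k * ε * ξ 0 ^ 3 - 5 / (k : ℝ) ^ 2 * ε ^ 2 * ξ 0 ^ 4 +
        ε ^ 3 * ((6 * k + 5 * (ε * ξ 0)) * (1 / (k : ℝ) ^ 2 * (r * r)) * ξ 0 ^ 5)) -
      ε ^ 2 * (4 * ξ 0 ^ 2) := by linear_combination hb
    rw [this]
    field_simp
  rw [hb']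
  linear_combination (ε * c) * hcore + ε ^ 2 * c * D * ha + ε * b * S ^ 3 * e3

/-! ### Uniform weighted bounds for the remainder -/

section Residual

variable {ι : Type*}

theorem US.add {f g : ι → Plane → ℝ} (hf : US f) (hg : US g) : US fun i ξ => f i ξ + g i ξ := by
  obtain ⟨C, hC⟩ := hf
  obtain ⟨C', hC'⟩ := hg
  refine ⟨C + C', fun i => ?_⟩
  filter_upwards [hC i, hC' i] with ξ h1 h2
  exact (abs_add_le _ _).trans (add_le_add h1 h2)

theorem US.const_mul {e : ι → ℝ} {f : ι → Plane → ℝ} (he : UR e) (hf : US f) :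
    US fun i ξ => e i * f i ξ := by
  obtain ⟨C, hC⟩ := he
  obtain ⟨C', hC'⟩ := hf
  refine ⟨C * C', fun i => ?_⟩
  filter_upwards [hC' i] with ξ h1
  rw [abs_mul]
  exact mul_le_mul (hC i) h1 (abs_nonneg _) ((abs_nonneg _).trans (hC i))

theorem IsCoef.comp_mul {c : ℝ → ℝ} (hc : IsCoef c) (ε : ℝ) :
    AEStronglyMeasurable (fun ξ : Plane => c (ε * ξ 0)) volume :=
  (hc.meas.comp (Continuous.measurable (f := fun ξ : Plane => ε * ξ 0)
    (by fun_prop))).aestronglyMeasurable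

theorem IsCoef.uw_mul {c : ℝ → ℝ} (hc : IsCoef c) (ε : ι → ℝ) {N : ℕ} {f : ι → Plane → ℝ}
    (hf : UW N f) : UW N fun i ξ => c (ε i * ξ 0) * f i ξ := by
  obtain ⟨K, -, hK⟩ := hc.bdd
  exact UW.bdd_mul (g := fun i (ξ : Plane) => c (ε i * ξ 0))
    ⟨K, fun i => Eventually.of_forall fun ξ => hK _⟩ (fun i => hc.comp_mul (ε i)) hf

/-- Uniform bounds for a family of profiles. -/
structure BoundedProfiles {k : ℕ} {b : ι → ℝ} (p : ∀ i, Profile k (b i)) (ε : ι → ℝ) : Prop where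
  coupling : UR b
  scale : UR ε
  E : ∀ j, UR fun i => (p i).E j
  sup : ∀ j, US fun i => (p i).v j
  weight : ∀ j N, UW N fun i => (p i).v j
  grad_weight : ∀ j N l, UW N fun i => (p i).dv j l

variable {k : ℕ} {b : ι → ℝ} {p : ∀ i, Profile k (b i)} {ε : ι → ℝ}

theorem BoundedProfiles.us_sum (h : BoundedProfiles p ε) : US fun i => (p i).sum (ε i) := by
  have := ((h.sup 0).add (US.const_mul h.scale (h.sup 1))).add
    (US.const_mul (h.scale.mul h.scale) (h.sup 2))
  convert this using 3
  rw [Profile.sum]; ring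

theorem BoundedProfiles.uw_sum (h : BoundedProfiles p ε) (N : ℕ) :
    UW N fun i => (p i).sum (ε i) := by
  have := ((h.weight 0 N).add (UW.const_mul h.scale (h.weight 1 N))).add
    (UW.const_mul (h.scale.mul h.scale) (h.weight 2 N))
  convert this using 3
  rw [Profile.sum]; ring

theorem BoundedProfiles.uw_dsum (h : BoundedProfiles p ε) (N : ℕ) :
    UW N fun i => (p i).dsum (ε i) := by
  have := ((h.grad_weight 0 N 0).add (UW.const_mul h.scale (h.grad_weight 1 N 0))).add
    (UW.const_mul (h.scale.mul h.scale) (h.grad_weight 2 N 0))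
  convert this using 3
  rw [Profile.dsum]; ring

theorem BoundedProfiles.uw_mul_mul (h : BoundedProfiles p ε) (N : ℕ) (j l m : Fin 3) :
    UW N fun i ξ => (p i).v j ξ * (p i).v l ξ * (p i).v m ξ :=
  UW.bdd_mul ((h.sup j).mul (h.sup l)) (fun i => ((p i).mem j).memLp.1.mul ((p i).mem l).memLp.1)
    (h.weight m N)

theorem BoundedProfiles.uw_remainderCore (h : BoundedProfiles p ε) (N : ℕ) :
    UW N fun i => (p i).remainderCore (ε i) := by
  have c := fun a : ℝ => UR.const (ι := ι) a
  have e := h.scale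
  exact ((((((((((h.grad_weight 2 N 0).const_mul (c _)).sub
    ((h.grad_weight 1 _ 0).pow_mul.const_mul (c _))).sub
    ((h.grad_weight 2 _ 0).pow_mul.const_mul (e.mul (c _)))).add
    ((h.weight 2 _).pow_mul.const_mul (c _))).sub
    ((h.weight 1 _).pow_mul.const_mul (c _))).sub
    ((h.weight 2 _).pow_mul.const_mul (e.mul (c _)))).add
    ((h.weight 2 N).const_mul (h.E 1))).add
    ((h.weight 1 N).const_mul (h.E 2))).add
    ((h.weight 2 N).const_mul (e.mul (h.E 2)))).sub
    ((((((h.uw_mul_mul N 0 1 2).const_mul (c 6)).add (h.uw_mul_mul N 1 1 1)).add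
      ((((h.uw_mul_mul N 0 2 2).const_mul (c 3)).add
        ((h.uw_mul_mul N 1 1 2).const_mul (c 3))).const_mul e)).add
      ((h.uw_mul_mul N 1 2 2).const_mul ((e.mul e).mul (c 3)))).add
      ((h.uw_mul_mul N 2 2 2).const_mul ((e.mul e).mul e))
      |>.const_mul h.coupling)

/-- Each term is a coefficient bounded independently of `ε`, times a power of `ρ`, times a profile,
a derivative of one, or a product of bounded profiles. The growing factor `6k + 5ερ` is bounded on
the support of the cutoff. -/
theorem BoundedProfiles.uw_remainder (h : BoundedProfiles p ε) {χ : ℝ → ℝ} (hχ : IsCutoff χ)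
    (hk : 1 ≤ k) (N : ℕ) : UW N fun i => (p i).remainder χ (ε i) := by
  have c := fun a : ℝ => UR.const (ι := ι) a
  have e := h.scale
  have hk' : (1 : ℝ) ≤ k := by exact_mod_cast hk
  have c1 := (hχ.coef.inv_mul hk').const_mul (1 / (k : ℝ) ^ 2)
  have c2 : IsCoef fun s => (6 * k + 5 * s) *
      (1 / (k : ℝ) ^ 2 * ((k + s)⁻¹ * ((k + s)⁻¹ * χ s))) := by
    refine (((hχ.coef.inv_mul hk').inv_mul hk').const_mul _).mul_left
      (g := fun s => 6 * k + 5 * s) (Continuous.measurable (by fun_prop)) (K := 6 * k + 5)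
      fun s hs => ?_
    have h1 := abs_le.1 hs
    rw [abs_le]
    constructor <;> linarith
  have c3 := hχ.coef_deriv.div_cube hχ.deriv_eq_zero
  have c4 := hχ.coef_deriv_two.div_cube hχ.deriv_two_eq_zero
  have c5 := c3.inv_mul hk'
  have c6 := hχ.coef_sub_cube.div_cube hχ.sub_cube_eq_zero
  have hV3 : ∀ N, UW N fun i ξ =>
      (p i).sum (ε i) ξ * (p i).sum (ε i) ξ * (p i).sum (ε i) ξ := fun N =>
    UW.bdd_mul (h.us_sum.mul h.us_sum)
      (fun i => ((h.uw_sum 0).aesm i).mul ((h.uw_sum 0).aesm i)) (h.uw_sum N)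
  exact ((((((hχ.coef.uw_mul ε (h.uw_remainderCore N)).add
    (c1.uw_mul ε (h.uw_dsum _).pow_mul)).add
    (c2.uw_mul ε (h.uw_sum _).pow_mul)).add
    ((c3.uw_mul ε (h.uw_dsum _).pow_mul).const_mul ((c 2).mul e))).add
    ((c4.uw_mul ε (h.uw_sum _).pow_mul).const_mul (e.mul e))).add
    ((c5.uw_mul ε (h.uw_sum _).pow_mul).const_mul (e.mul e))).add
    ((c6.uw_mul ε (hV3 _).pow_mul).const_mul h.coupling)

theorem BoundedProfiles.memLp_rhs (h : BoundedProfiles p ε) (j : Fin 3) (i : ι) :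
    MemLp ((p i).rhs j) 2 volume := by
  have v : ∀ j, MemLp ((p i).v j) 2 volume := fun j => ((p i).mem j).memLp
  have t : ∀ j l m, MemLp (fun ξ => (p i).v j ξ * (p i).v l ξ * (p i).v m ξ) 2 volume :=
    fun j l m => (h.uw_mul_mul 0 j l m).memLp i
  have d : ∀ j, MemLp ((p i).dv j 0) 2 volume := fun j => ((p i).mem j).grad_memLp 0
  have x : ∀ n j, MemLp (fun ξ : Plane => ξ 0 ^ n * (p i).v j ξ) 2 volume := fun n j =>
    (UW.pow_mul (N := 0) (h.weight j _)).memLp i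
  have x' : ∀ n j, MemLp (fun ξ : Plane => ξ 0 ^ n * (p i).dv j 0 ξ) 2 volume := fun n j =>
    (UW.pow_mul (N := 0) (h.grad_weight j _ 0)).memLp i
  fin_cases j
  · refine MemLp.ae_eq (Eventually.of_forall fun ξ => ?_)
      (((v 0).const_mul ((p i).E 0)).sub ((t 0 0 0).const_mul (b i)))
    simp only [Pi.sub_apply, Profile.rhs]
    ring
  · refine MemLp.ae_eq (Eventually.of_forall fun ξ => ?_)
      ((((((v 1).const_mul ((p i).E 0)).add ((v 0).const_mul ((p i).E 1))).sub
        ((t 0 0 1).const_mul (3 * b i))).add ((d 0).const_mul (1 / (k : ℝ)))).add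
        ((x 3 0).const_mul (4 / (k : ℝ))))
    simp only [Pi.sub_apply, Pi.add_apply, Profile.rhs]
    ring
  · refine MemLp.ae_eq (Eventually.of_forall fun ξ => ?_)
      (((((((((v 2).const_mul ((p i).E 0)).add ((v 1).const_mul ((p i).E 1))).add
        ((v 0).const_mul ((p i).E 2))).sub
        (((t 0 0 2).add (t 0 1 1)).const_mul (3 * b i))).add ((d 1).const_mul (1 / (k : ℝ)))).add
        ((x 3 1).const_mul (4 / (k : ℝ)))).sub ((x' 1 0).const_mul (1 / (k : ℝ) ^ 2))).sub
        ((x 4 0).const_mul (5 / (k : ℝ) ^ 2)))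
    simp only [Pi.sub_apply, Pi.add_apply, Profile.rhs]
    ring

theorem Profile.eq_rhs {b : ℝ} (p : Profile k b) (j : Fin 3) :
    SolvesP0 (p.v j) (p.dv j) (p.rhs j) := by
  fin_cases j
  · exact p.eq0
  · exact p.eq1
  · exact p.eq2

theorem BoundedProfiles.memLp_potential (h : BoundedProfiles p ε) (j : Fin 3) (i : ι) :
    MemLp (fun ξ => potential ξ * (p i).v j ξ) 2 volume := by
  refine (UW.dominated (N := 0) (m := 1) (K := 4) (f := fun i ξ => potential ξ * (p i).v j ξ)
    (h.weight j _) (fun i =>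
    continuous_potential.aestronglyMeasurable.mul ((p i).mem j).memLp.1)
    fun i => Eventually.of_forall fun ξ => ?_).memLp i
  rw [abs_mul, abs_of_nonneg (potential_nonneg ξ), pow_one]
  have := potential_le ξ
  gcongr
  unfold wt
  linarith

theorem WeakLap.add {d : ℕ} {f g f' g' : LL d} (h : WeakLap f g) (h' : WeakLap f' g') :
    WeakLap (f + f') (g + g') := fun φ => by
  rw [inner_add_left, inner_add_left, h φ, h' φ]

theorem WeakLap.smul {d : ℕ} {f g : LL d} (c : ℝ) (h : WeakLap f g) :
    WeakLap (c • f) (c • g) := fun φ => by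
  rw [real_inner_smul_left, real_inner_smul_left, h φ]

theorem WeakGrad.add {d : ℕ} {f f' : LL d} {df df' : Fin d → LL d} (h : WeakGrad f df)
    (h' : WeakGrad f' df') : WeakGrad (f + f') (fun i => df i + df' i) := fun i φ => by
  rw [inner_add_left, inner_add_left, h i φ, h' i φ, neg_add]

theorem WeakGrad.smul {d : ℕ} {f : LL d} {df : Fin d → LL d} (c : ℝ) (h : WeakGrad f df) :
    WeakGrad (c • f) (fun i => c • df i) := fun i φ => by
  rw [real_inner_smul_left, real_inner_smul_left, h i φ, mul_neg]

theorem BoundedProfiles.weakLap (h : BoundedProfiles p ε) (i : ι) :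
    ∃ (hV : MemLp ((p i).sum (ε i)) 2 volume) (hD : MemLp ((p i).dsum (ε i)) 2 volume)
      (hG : MemLp ((p i).lap (ε i)) 2 volume) (df : Fin 2 → LL 2),
      WeakLap (hV.toLp _ : LL 2) (hG.toLp _) ∧ WeakGrad (hV.toLp _ : LL 2) df ∧
      df 0 = hD.toLp _ := by
  have hm : ∀ j, MemLp (fun ξ => potential ξ * (p i).v j ξ - (p i).rhs j ξ) 2 volume := fun j =>
    (h.memLp_potential j i).sub (h.memLp_rhs j i)
  have hw := fun j => SolvesP0.weakLap ((p i).mem j) ((p i).eq_rhs j) (hm j) (h.memLp_rhs j i)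
  have hg := fun j => ((p i).mem j).weakGrad
  have hV : MemLp ((p i).sum (ε i)) 2 volume :=
    (((p i).mem 0).memLp.add (((p i).mem 1).memLp.const_smul (ε i))).add
      (((p i).mem 2).memLp.const_smul (ε i ^ 2))
  have hD : MemLp ((p i).dsum (ε i)) 2 volume :=
    ((((p i).mem 0).grad_memLp 0).add ((((p i).mem 1).grad_memLp 0).const_smul (ε i))).add
      ((((p i).mem 2).grad_memLp 0).const_smul (ε i ^ 2))
  have hG : MemLp ((p i).lap (ε i)) 2 volume :=
    ((hm 0).add ((hm 1).const_smul (ε i))).add ((hm 2).const_smul (ε i ^ 2))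
  exact ⟨hV, hD, hG, _, ((hw 0).add ((hw 1).smul (ε i))).add ((hw 2).smul (ε i ^ 2)),
    ((hg 0).add ((hg 1).smul (ε i))).add ((hg 2).smul (ε i ^ 2)), rfl⟩

end Residual

theorem phase_eq_exp {m : ℕ} {x : Space} (hx : radius x ≠ 0) :
    phase m x = Complex.exp (Complex.I * ((m : ℝ) * angle x : ℝ)) := by
  have hz : (x 0 : ℂ) + Complex.I * x 1 = ⟨x 0, x 1⟩ := by
    apply Complex.ext <;> simp
  have h := Complex.norm_mul_exp_arg_mul_I ⟨x 0, x 1⟩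
  rw [← hz, norm_phase_base, hz] at h
  rw [phase, hz, ← h, mul_div_cancel_left₀ _ (Complex.ofReal_ne_zero.2 hx), ← Complex.exp_nat_mul,
    angle]
  congr 1
  push_cast
  ring

/-- Since `k²/h` equals the integer `m`, the exponential of the discontinuous polar angle is an
honest power. The two formulas may differ on the axis, but there the cutoff vanishes. -/
theorem uApp_eq_lift {k : ℕ} {b : ℝ} (hk : 1 ≤ k) {χ : ℝ → ℝ} (hχ : IsCutoff χ) (p : Profile k b)
    {ε : ℝ} (hε : 0 < ε) {m : ℕ} (hm : m * ε ^ 2 = (k : ℝ) ^ 2) (x : Space) :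
    uApp 1 χ p (ε ^ 2) 0 x = ((1 / ε : ℝ) : ℂ) * lift m k ε χ (p.sum ε) x := by
  have hk' : (1 : ℝ) ≤ k := by exact_mod_cast hk
  have hs : √(ε ^ 2) = ε := Real.sqrt_sq hε.le
  have ht : truncatedProfile χ p (ε ^ 2) !₂[(radius x - k) / √(ε ^ 2), x 2 / √(ε ^ 2)] =
      χ (radius x - k) * p.sum ε (tubeMap k ε x) := by
    rw [truncatedProfile, hs, Profile.sum, tubeMap]
    simp only [Matrix.cons_val_zero]
    rw [mul_div_cancel₀ _ hε.ne']
  rw [uApp, ht, hs, lift]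
  by_cases hx : radius x = 0
  · rw [hx, hχ.coef.zero]
    · simp
    · rw [zero_sub, abs_neg, abs_of_nonneg] <;> linarith
  · rw [phase_eq_exp hx, ← hm]
    have : (m : ℝ) * ε ^ 2 / ε ^ 2 = m := by field_simp
    rw [this]
    simp [mul_assoc]

section Residual

variable {ι : Type*} {k : ℕ} {b : ι → ℝ} {p : ∀ i, Profile k (b i)} {ε : ι → ℝ}

/-- The approximate solution is an approximate stationary state, uniformly for families of
bounded profiles. -/
theorem BoundedProfiles.exists_residual (h : BoundedProfiles p ε) (hk : 1 ≤ k) {χ : ℝ → ℝ}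
    (hχ : IsCutoff χ) (hε : ∀ i, 0 < ε i) {m : ι → ℕ} (hm : ∀ i, m i * ε i ^ 2 = (k : ℝ) ^ 2) :
    ∃ K : ℝ, 0 ≤ K ∧ ∀ i, |frequency (p i) (ε i ^ 2) * ε i ^ 2| ≤ K ∧
      ∃ U W R : Lp ℂ 2 (volume : Measure Space),
        (∀ᵐ x, U x = uApp 1 χ (p i) (ε i ^ 2) 0 x) ∧ CLap U W ∧
        (∀ᵐ x, ‖U x‖ ^ 2 ≤ K / ε i ^ 2) ∧ ‖R‖ ^ 2 ≤ K * ε i ^ 10 ∧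
        ∀ᵐ x, R x = ((ε i ^ 4 : ℝ) : ℂ) * W x - ((‖x‖ ^ 2 : ℝ) : ℂ) * U x +
          ((frequency (p i) (ε i ^ 2) * ε i ^ 2 : ℝ) : ℂ) * U x -
          ((b i * ε i ^ 4 * ‖U x‖ ^ 2 : ℝ) : ℂ) * U x := by
  have hk' : (1 : ℝ) ≤ k := by exact_mod_cast hk
  have hk2 := half_le_of_one_le hk'
  -- This quantity is the frequency multiplied by `h = ε²`.
  obtain ⟨K1, hK1⟩ : UR fun i => 2 * (k : ℝ) ^ 2 +
      ε i * ε i * ((p i).E 0 + ε i * (p i).E 1 + ε i * ε i * (p i).E 2) :=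
    (UR.const _).add ((h.scale.mul h.scale).mul
      (((h.E 0).add (h.scale.mul (h.E 1))).add ((h.scale.mul h.scale).mul (h.E 2))))
  have hfreq : ∀ i, frequency (p i) (ε i ^ 2) * ε i ^ 2 = 2 * (k : ℝ) ^ 2 +
      ε i ^ 2 * ((p i).E 0 + ε i * (p i).E 1 + ε i ^ 2 * (p i).E 2) := fun i => by
    have := (hε i).ne'
    rw [frequency, Real.sqrt_sq (hε i).le]
    field_simp
    ring
  obtain ⟨K2, hK2⟩ := h.us_sum
  obtain ⟨K3, hK3⟩ := h.uw_remainder hχ hk 0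
  obtain ⟨Kχ, hKχ0, hKχ⟩ := hχ.coef.bdd
  have hK30 : ∀ i, ∫ ξ, (p i).remainder χ (ε i) ξ ^ 2 ≤ K3 := fun i => by simpa using (hK3 i).2.2
  -- The remainder already contains the cutoffs, so it is lifted with the plain indicator of the
  -- tube as coefficient.
  let one : ℝ → ℝ := {s : ℝ | |s| ≤ 1 / 2}.indicator 1
  have hone : IsCoef one := by
    refine ⟨measurable_one.indicator (isClosed_le continuous_abs continuous_const).measurableSet,
      ⟨1, zero_le_one, fun s => ?_⟩, fun s hs => Set.indicator_of_notMem
        (s := {s : ℝ | |s| ≤ 1 / 2}) (not_le.2 hs) _⟩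
    by_cases hs : |s| ≤ 1 / 2
    · rw [show one s = 1 from Set.indicator_of_mem (s := {s : ℝ | |s| ≤ 1 / 2}) hs _, abs_one]
    · rw [show one s = 0 from Set.indicator_of_notMem (s := {s : ℝ | |s| ≤ 1 / 2}) hs _, abs_zero]
      exact zero_le_one
  have hone1 : ∀ s, |one s| ≤ 1 := fun s => by
    by_cases hs : |s| ≤ 1 / 2
    · rw [show one s = 1 from Set.indicator_of_mem (s := {s : ℝ | |s| ≤ 1 / 2}) hs _, abs_one]
    · rw [show one s = 0 from Set.indicator_of_notMem (s := {s : ℝ | |s| ≤ 1 / 2}) hs _, abs_zero]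
      exact zero_le_one
  let Ct : ℝ := (k + 1 / 2) * (2 * Real.pi)
  have hCt : 0 ≤ Ct := by
    have := Real.pi_pos
    positivity
  -- The three summands serve in turn the frequency, the sup norm of `U` and the norm of the
  -- residual.
  refine ⟨|K1| + (Kχ * K2) ^ 2 + Ct * |K3|, by positivity, fun i => ⟨?_, ?_⟩⟩
  · have := hK1 i
    rw [hfreq, sq (ε i)]
    linarith [le_abs_self K1, sq_nonneg (Kχ * K2), mul_nonneg hCt (abs_nonneg K3)]
  obtain ⟨hV, hD, hG, df, w1, w2, w3⟩ := h.weakLap i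
  have hmi := hm i
  have hεi := hε i
  have hlap := lift_cLap hχ (m i) hk' hεi hV hD hG w1 w2 w3
  let c : ℝ := 1 / ε i
  let U0 := (lift_memLp (m := m i) hk2 hεi hχ.coef hV).toLp _
  let W0 := (lift_memLp (m := m i) hk2 hεi (hχ.coef.const_mul (1 / ε i ^ 2)) hG).toLp _ +
        (lift_memLp (m := m i) hk2 hεi (hχ.gradCoef hk' (ε i)) hD).toLp _ +
        (lift_memLp (m := m i) hk2 hεi (hχ.zeroCoef (m i) hk') hV).toLp _
  have hmR : MemLp ((p i).remainder χ (ε i)) 2 volume := (h.uw_remainder hχ hk 0).memLp i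
  let R0 := (lift_memLp (m := m i) hk2 hεi hone hmR).toLp _
  have eU : ∀ᵐ x, (c • U0 : Lp ℂ 2 (volume : Measure Space)) x =
      ((1 / ε i : ℝ) : ℂ) * lift (m i) k (ε i) χ ((p i).sum (ε i)) x := by
    filter_upwards [Lp.coeFn_smul c U0, (lift_memLp (m := m i) hk2 hεi hχ.coef hV).coeFn_toLp]
      with x a1 a2
    rw [a1, Pi.smul_apply, Complex.real_smul, a2]
  refine ⟨c • U0, c • W0, (ε i ^ 4) • R0, ?_, fun L => ?_, ?_, ?_, ?_⟩
  · filter_upwards [eU] with x a1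
    rw [a1, uApp_eq_lift hk hχ (p i) hεi hmi]
  · have := (hlap L).smul c
    have e : ∀ f : Lp ℂ 2 (volume : Measure Space), (L.compLp (c • f) : LL 3) = c • L.compLp f :=
      fun f => (L.compLpL 2 volume).map_smul c f
    rw [e, e]
    exact this
  · filter_upwards [eU, ae_tube hk2 hεi (hK2 i)] with x a1 a2
    rw [a1]
    by_cases hx : x ∈ tube k
    · have b1 : ‖((1 / ε i : ℝ) : ℂ) * lift (m i) k (ε i) χ ((p i).sum (ε i)) x‖ ≤
          1 / ε i * (Kχ * K2) := by
        rw [norm_mul, Complex.norm_real, Real.norm_of_nonneg (by positivity), lift, norm_mul,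
          Complex.norm_real, norm_mul]
        refine mul_le_mul_of_nonneg_left ?_ (by positivity)
        calc _ ≤ 1 * (Kχ * K2) := mul_le_mul (norm_phase_le _ _)
              (mul_le_mul (hKχ _) (a2 hx) (abs_nonneg _) hKχ0) (by positivity) zero_le_one
          _ = _ := one_mul _
      calc _ ≤ (1 / ε i * (Kχ * K2)) ^ 2 := by gcongr
        _ = (Kχ * K2) ^ 2 / ε i ^ 2 := by rw [mul_pow, div_pow, one_pow]; ring
        _ ≤ _ := by
          gcongr
          linarith [abs_nonneg K1, mul_nonneg hCt (abs_nonneg K3)]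
    · rw [lift_eq_zero hχ.coef hx, mul_zero, norm_zero, zero_pow two_ne_zero]
      positivity
  · rw [norm_smul, mul_pow, norm_toLp_complex_sq, Real.norm_of_nonneg (by positivity)]
    have b1 := integral_lift_sq_le (m := m i) hk2 hεi hone hone1 hmR
    have b2 : ∫ x, ‖lift (m i) k (ε i) one ((p i).remainder χ (ε i)) x‖ ^ 2 ≤
        Ct * ε i ^ 2 * |K3| := by
      refine b1.trans ?_
      rw [one_pow, one_mul]
      have := (hK30 i).trans (le_abs_self K3)
      gcongr
    -- The power ten is `2 · 4` from the pointwise order of the residual plus two from the area of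
    -- the cross-section of the tube.
    calc _ ≤ (ε i ^ 4) ^ 2 * (Ct * ε i ^ 2 * |K3|) := by gcongr
      _ = (Ct * |K3|) * ε i ^ 10 := by ring
      _ ≤ _ := by
        gcongr
        linarith [abs_nonneg K1, sq_nonneg (Kχ * K2)]
  · have eW : ∀ᵐ x, (c • W0 : Lp ℂ 2 (volume : Measure Space)) x = ((1 / ε i : ℝ) : ℂ) *
        (lift (m i) k (ε i) (fun s => 1 / ε i ^ 2 * χ s) ((p i).lap (ε i)) x +
          lift (m i) k (ε i) (gradCoef χ k (ε i)) ((p i).dsum (ε i)) x +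
          lift (m i) k (ε i) (zeroCoef χ (m i) k) ((p i).sum (ε i)) x) := by
      filter_upwards [Lp.coeFn_smul c W0, Lp.coeFn_add
          ((lift_memLp (m := m i) hk2 hεi (hχ.coef.const_mul (1 / ε i ^ 2)) hG).toLp _ +
            (lift_memLp (m := m i) hk2 hεi (hχ.gradCoef hk' (ε i)) hD).toLp _)
          ((lift_memLp (m := m i) hk2 hεi (hχ.zeroCoef (m i) hk') hV).toLp _),
        Lp.coeFn_add
          ((lift_memLp (m := m i) hk2 hεi (hχ.coef.const_mul (1 / ε i ^ 2)) hG).toLp _)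
          ((lift_memLp (m := m i) hk2 hεi (hχ.gradCoef hk' (ε i)) hD).toLp _),
        (lift_memLp (m := m i) hk2 hεi (hχ.coef.const_mul (1 / ε i ^ 2)) hG).coeFn_toLp,
        (lift_memLp (m := m i) hk2 hεi (hχ.gradCoef hk' (ε i)) hD).coeFn_toLp,
        (lift_memLp (m := m i) hk2 hεi (hχ.zeroCoef (m i) hk') hV).coeFn_toLp]
        with x a1 a2 a3 a4 a5 a6
      rw [a1, Pi.smul_apply, Complex.real_smul, a2, Pi.add_apply, a3, Pi.add_apply, a4, a5, a6]
    filter_upwards [eU, eW, Lp.coeFn_smul (ε i ^ 4) R0,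
      (lift_memLp (m := m i) hk2 hεi hone hmR).coeFn_toLp] with x a1 a2 a3 a4
    rw [a1, a2, a3, Pi.smul_apply, Complex.real_smul, a4]
    by_cases hx : x ∈ tube k
    · have hx1 := mem_tube.1 hx
      have hr : radius x ≠ 0 := by
        have := (abs_le.1 hx1).1
        intro h0
        linarith
      have hρ : ε i * (tubeMap k (ε i) x) 0 = radius x - k := by
        exact mul_div_cancel₀ _ hεi.ne'
      have hσ : ε i * (tubeMap k (ε i) x) 1 = x 2 := by
        exact mul_div_cancel₀ _ hεi.ne'
      have hr' : (k : ℝ) + ε i * (tubeMap k (ε i) x) 0 = radius x := by rw [hρ]; ring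
      have hn : ‖x‖ ^ 2 = (k + ε i * (tubeMap k (ε i) x) 0) ^ 2 +
          (ε i * (tubeMap k (ε i) x) 1) ^ 2 := by
        rw [hr', hσ, radius_sq, EuclideanSpace.real_norm_sq_eq, Fin.sum_univ_three]
      have key := Profile.residual_eq hχ (p i) hk hεi.ne' hmi (tubeMap k (ε i) x)
        (by rw [hr']; exact hr)
      have hone' : one (radius x - k) = 1 :=
        Set.indicator_of_mem (s := {s : ℝ | |s| ≤ 1 / 2}) hx1 _
      have hnorm : ‖((1 / ε i : ℝ) : ℂ) * lift (m i) k (ε i) χ ((p i).sum (ε i)) x‖ ^ 2 =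
          (1 / ε i * (χ (radius x - k) * (p i).sum (ε i) (tubeMap k (ε i) x))) ^ 2 := by
        rw [lift, norm_mul, norm_mul, norm_phase hr, one_mul, Complex.norm_real, Complex.norm_real,
          ← norm_mul, Real.norm_eq_abs, sq_abs]
      rw [hnorm, hfreq, hn]
      simp only [lift, gradCoef, zeroCoef]
      rw [hone', one_mul, ← hρ]
      have key' := congrArg (fun t : ℝ => phase (m i) x * (t : ℂ)) key
      simp only at key'
      rw [show ((ε i ^ 4 : ℝ) : ℂ) * (phase (m i) x * (((p i).remainder χ (ε i)
        (tubeMap k (ε i) x) : ℝ) : ℂ)) = phase (m i) x * ((ε i ^ 4 * (p i).remainder χ (ε i)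
        (tubeMap k (ε i) x) : ℝ) : ℂ) by push_cast; ring, ← key']
      push_cast
      ring
    · rw [lift_eq_zero hone hx, lift_eq_zero hχ.coef hx,
        lift_eq_zero (hχ.coef.const_mul (1 / ε i ^ 2)) hx,
        lift_eq_zero (hχ.gradCoef hk' (ε i)) hx, lift_eq_zero (hχ.zeroCoef (m i) hk') hx]
      simp

end Residual

/-! ### States of finite energy -/

/-- The space `L²(ℝ³; ℂ)`. -/
abbrev CL := Lp ℂ 2 (volume : Measure Space)

/-- Real functions are mapped to complex functions. -/
def complexify (φ : 𝓢(Space, ℝ)) : 𝓢(Space, ℂ) := SchwartzMap.postcompCLM Complex.ofRealCLM φ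

theorem complexify_apply (φ : 𝓢(Space, ℝ)) (x : Space) : complexify φ x = (φ x : ℂ) := rfl

theorem laplacian_complexify (φ : 𝓢(Space, ℝ)) (x : Space) :
    Δ (complexify φ) x = (Δ φ x : ℂ) := by
  rw [SchwartzMap.laplacian_apply, SchwartzMap.laplacian_apply]
  exact ContDiffAt.laplacian_CLM_comp_left (l := Complex.ofRealCLM) (f := (φ : Space → ℝ)) (x := x)
    ((φ.smooth 2).contDiffAt)

theorem integral_complexify_smul (L : ℂ →L[ℝ] ℝ) (f : CL) (φ : 𝓢(Space, ℝ)) :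
    L (∫ x, (φ x : ℂ) • f x) = inner ℝ (L.compLp f : LL 3) (sL φ) := by
  have hi : Integrable fun x => (φ x : ℂ) • f x :=
    ((complexify φ).memLp 2 volume).integrable_mul (Lp.memLp f)
  rw [← L.integral_comp_comm hi, inner_sL]
  refine integral_congr_ae ?_
  filter_upwards [L.coeFn_compLp f] with x hx
  rw [hx, Complex.coe_smul, map_smul, smul_eq_mul, mul_comm]

/-- Real test functions, complexified, suffice: a real-linear functional `L` commutes with
integration against them. -/
theorem CLap.of_distribution {f g : CL} (h : Δ (f : 𝓢'(Space, ℂ)) = (g : 𝓢'(Space, ℂ))) :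
    CLap f g := by
  intro L φ
  have h1 := congrArg (fun T : 𝓢'(Space, ℂ) => T (complexify φ)) h
  simp only [TemperedDistribution.laplacian_apply_apply, Lp.toTemperedDistribution_apply,
    laplacian_complexify, complexify_apply] at h1
  rw [← integral_complexify_smul, ← integral_complexify_smul, ← h1, sΔ_eq]

/-- Quantifying over all real-linear functionals makes complex scalars harmless: `L` composed with
multiplication by `c` is again such a functional. -/
theorem CLap.smul {f g : CL} (h : CLap f g) (c : ℂ) : CLap (c • f) (c • g) := by
  intro L
  let M : ℂ →L[ℝ] ℝ := L.comp ((ContinuousLinearMap.mul ℝ ℂ) c)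
  have e : ∀ f : CL, (L.compLp (c • f) : LL 3) = M.compLp f := fun f => by
    refine Lp.ext ?_
    filter_upwards [L.coeFn_compLp (c • f), M.coeFn_compLp f, Lp.coeFn_smul c f] with x h1 h2 h3
    rw [h1, h2, h3]
    rfl
  rw [e, e]
  exact h M

theorem CLap.add {f g f' g' : CL} (h : CLap f g) (h' : CLap f' g') : CLap (f + f') (g + g') := by
  intro L
  have e : ∀ f g : CL, (L.compLp (f + g) : LL 3) = L.compLp f + L.compLp g := fun f g =>
    (L.compLpL 2 volume).map_add f g
  rw [e, e]
  exact (h L).add (h' L)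

theorem inner_re_im (f g : CL) : inner ℝ f g =
    inner ℝ (Complex.reCLM.compLp f : LL 3) (Complex.reCLM.compLp g) +
      inner ℝ (Complex.imCLM.compLp f : LL 3) (Complex.imCLM.compLp g) := by
  rw [L2.inner_def, L2.inner_def, L2.inner_def, ← integral_add (L2.integrable_inner _ _)
    (L2.integrable_inner _ _)]
  refine integral_congr_ae ?_
  filter_upwards [Complex.reCLM.coeFn_compLp f, Complex.reCLM.coeFn_compLp g,
    Complex.imCLM.coeFn_compLp f, Complex.imCLM.coeFn_compLp g] with x h1 h2 h3 h4
  rw [h1, h2, h3, h4, Complex.inner]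
  simp

theorem CLap.inner_comm {f g f' g' : CL} (h : CLap f g) (h' : CLap f' g') :
    inner ℝ f g' = inner ℝ g f' := by
  rw [inner_re_im, inner_re_im, (h _).inner_comm (h' _), (h _).inner_comm (h' _)]

theorem CLap.neg_inner_nonneg {f g : CL} (h : CLap f g) : 0 ≤ - inner ℝ f g := by
  have h1 := (h Complex.reCLM).neg_inner_nonneg
  have h2 := (h Complex.imCLM).neg_inner_nonneg
  rw [inner_re_im]
  linarith

theorem norm_sq_re_im (f : CL) : ‖f‖ ^ 2 =
    ‖(Complex.reCLM.compLp f : LL 3)‖ ^ 2 + ‖(Complex.imCLM.compLp f : LL 3)‖ ^ 2 := by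
  rw [← real_inner_self_eq_norm_sq, inner_re_im, real_inner_self_eq_norm_sq,
    real_inner_self_eq_norm_sq]

theorem norm_sq_ae (f : CL) : ∀ᵐ x, ‖f x‖ ^ 2 =
    (Complex.reCLM.compLp f : LL 3) x ^ 2 + (Complex.imCLM.compLp f : LL 3) x ^ 2 := by
  filter_upwards [Complex.reCLM.coeFn_compLp f, Complex.imCLM.coeFn_compLp f] with x h1 h2
  rw [h1, h2, Complex.sq_norm, Complex.normSq_apply]
  simp [sq]

theorem CLap.exists_gagliardo_nirenberg :
    ∃ C : ℝ, 0 ≤ C ∧ ∀ f g : CL, CLap f g → Integrable (fun x => ‖f x‖ ^ 4) ∧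
      (∫ x, ‖f x‖ ^ 4) ^ 2 ≤ C * ‖f‖ ^ 2 * (- inner ℝ f g) ^ 3 := by
  obtain ⟨C, hC, h⟩ := exists_gagliardo_nirenberg_three
  -- Splitting into real and imaginary parts gives `(2a + 2b)² ≤ 8(a² + b²)`, and each of the two
  -- squares obeys the real inequality.
  refine ⟨16 * C, by positivity, fun f g hfg => ?_⟩
  have hre := hfg Complex.reCLM
  have him := hfg Complex.imCLM
  obtain ⟨i1, h1⟩ := h _ _ hre
  obtain ⟨i2, h2⟩ := h _ _ him
  have n1 := hre.neg_inner_nonneg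
  have n2 := him.neg_inner_nonneg
  have hn := norm_sq_re_im f
  have hi := inner_re_im f g
  have hle : ∀ᵐ x, ‖f x‖ ^ 4 ≤ 2 * (Complex.reCLM.compLp f : LL 3) x ^ 4 +
      2 * (Complex.imCLM.compLp f : LL 3) x ^ 4 := by
    filter_upwards [norm_sq_ae f] with x hx
    rw [show ‖f x‖ ^ 4 = (‖f x‖ ^ 2) ^ 2 by ring, hx]
    nlinarith [sq_nonneg ((Complex.reCLM.compLp f : LL 3) x ^ 2 -
      (Complex.imCLM.compLp f : LL 3) x ^ 2)]
  have hint : Integrable fun x => ‖f x‖ ^ 4 := by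
    refine ((i1.const_mul 2).add (i2.const_mul 2)).mono' ((Lp.aestronglyMeasurable f).norm.pow 4) ?_
    filter_upwards [hle] with x hx
    rw [Real.norm_of_nonneg (by positivity)]
    exact hx
  refine ⟨hint, ?_⟩
  have h3 : ∫ x, ‖f x‖ ^ 4 ≤ 2 * (∫ x, (Complex.reCLM.compLp f : LL 3) x ^ 4) +
      2 * ∫ x, (Complex.imCLM.compLp f : LL 3) x ^ 4 := by
    refine (integral_mono_ae hint ((i1.const_mul 2).add (i2.const_mul 2)) hle).trans (le_of_eq ?_)
    simp only [Pi.add_apply]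
    rw [integral_add (i1.const_mul 2) (i2.const_mul 2), integral_const_mul, integral_const_mul]
  have h0 : 0 ≤ ∫ x, ‖f x‖ ^ 4 := integral_nonneg fun x => by positivity
  set Q := ∫ x, ‖f x‖ ^ 4
  set a := ∫ x, (Complex.reCLM.compLp f : LL 3) x ^ 4
  set b := ∫ x, (Complex.imCLM.compLp f : LL 3) x ^ 4
  set X := inner ℝ (Complex.reCLM.compLp f : LL 3) (Complex.reCLM.compLp g)
  set Y := inner ℝ (Complex.imCLM.compLp f : LL 3) (Complex.imCLM.compLp g)
  rw [hi]
  have s1 : C * ‖(Complex.reCLM.compLp f : LL 3)‖ ^ 2 * (-X) ^ 3 ≤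
      C * ‖f‖ ^ 2 * (-(X + Y)) ^ 3 := by
    have : (-X) ≤ -(X + Y) := by linarith
    have : ‖(Complex.reCLM.compLp f : LL 3)‖ ^ 2 ≤ ‖f‖ ^ 2 := by
      rw [hn]; linarith [sq_nonneg ‖(Complex.imCLM.compLp f : LL 3)‖]
    gcongr
  have s2 : C * ‖(Complex.imCLM.compLp f : LL 3)‖ ^ 2 * (-Y) ^ 3 ≤
      C * ‖f‖ ^ 2 * (-(X + Y)) ^ 3 := by
    have : (-Y) ≤ -(X + Y) := by linarith
    have : ‖(Complex.imCLM.compLp f : LL 3)‖ ^ 2 ≤ ‖f‖ ^ 2 := by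
      rw [hn]; linarith [sq_nonneg ‖(Complex.reCLM.compLp f : LL 3)‖]
    gcongr
  calc Q ^ 2 ≤ (2 * a + 2 * b) ^ 2 := pow_le_pow_left₀ h0 h3 2
    _ ≤ 8 * (a ^ 2 + b ^ 2) := by nlinarith [sq_nonneg (a - b)]
    _ ≤ _ := by linarith

theorem CLap.exists_sup :
    ∃ C : ℝ, 0 ≤ C ∧ ∀ f g : CL, CLap f g → ∀ᵐ x, ‖f x‖ ^ 2 ≤ C * (‖f‖ ^ 2 + ‖g‖ ^ 2) := by
  obtain ⟨C, hC, h⟩ := exists_sobolev_sup (d := 3) le_rfl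
  refine ⟨C, hC, fun f g hfg => ?_⟩
  filter_upwards [h _ _ (hfg Complex.reCLM), h _ _ (hfg Complex.imCLM), norm_sq_ae f] with x h1 h2 h3
  rw [h3, norm_sq_re_im f, norm_sq_re_im g]
  linarith

theorem inner_I_smul (a b : CL) : inner ℝ a (Complex.I • b) = - inner ℝ (Complex.I • a) b := by
  rw [L2.inner_def, L2.inner_def, ← integral_neg]
  refine integral_congr_ae ?_
  filter_upwards [Lp.coeFn_smul Complex.I a, Lp.coeFn_smul Complex.I b] with x h1 h2
  rw [h1, h2, Complex.inner, Complex.inner]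
  simp
  ring

theorem inner_I_smul_self (a : CL) : inner ℝ a (Complex.I • a) = 0 := by
  have := inner_I_smul a a
  rw [real_inner_comm a (Complex.I • a)] at this
  linarith

/-- `f` belongs to the domain of the harmonic oscillator, with `Δ f = l` and `|x|² f = p`. -/
structure IsState (f l p : CL) : Prop where
  lap : CLap f l
  pot : ∀ᵐ x, p x = ((‖x‖ ^ 2 : ℝ) : ℂ) * f x

theorem IsState.smul {f l p : CL} (h : IsState f l p) (c : ℂ) :
    IsState (c • f) (c • l) (c • p) := by
  refine ⟨h.lap.smul c, ?_⟩
  filter_upwards [h.pot, Lp.coeFn_smul c f, Lp.coeFn_smul c p] with x h1 h2 h3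
  rw [h2, h3, Pi.smul_apply, Pi.smul_apply, h1, smul_eq_mul, smul_eq_mul]
  ring

theorem IsState.add {f l p f' l' p' : CL} (h : IsState f l p) (h' : IsState f' l' p') :
    IsState (f + f') (l + l') (p + p') := by
  refine ⟨h.lap.add h'.lap, ?_⟩
  filter_upwards [h.pot, h'.pot, Lp.coeFn_add f f', Lp.coeFn_add p p'] with x h1 h2 h3 h4
  rw [h3, h4, Pi.add_apply, Pi.add_apply, h1, h2]
  ring

theorem IsState.sub {f l p f' l' p' : CL} (h : IsState f l p) (h' : IsState f' l' p') :
    IsState (f - f') (l - l') (p - p') := by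
  have := h.add (h'.smul (-1))
  simpa only [neg_smul, one_smul, ← sub_eq_add_neg] using this

theorem IsState.pot_comm {f l p f' l' p' : CL} (h : IsState f l p) (h' : IsState f' l' p') :
    inner ℝ f p' = inner ℝ p f' := by
  rw [L2.inner_def, L2.inner_def]
  refine integral_congr_ae ?_
  filter_upwards [h.pot, h'.pot] with x h1 h2
  rw [h1, h2, Complex.inner, Complex.inner]
  simp
  ring

theorem IsState.pot_nonneg {f l p : CL} (h : IsState f l p) : 0 ≤ inner ℝ f p := by
  rw [L2.inner_def]
  refine integral_nonneg_of_ae ?_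
  filter_upwards [h.pot] with x h1
  rw [h1, Complex.inner, Pi.zero_apply, mul_assoc, Complex.re_ofReal_mul, Complex.mul_conj,
    Complex.ofReal_re]
  have := Complex.normSq_nonneg (f x)
  positivity

/-- The value of the operator `-h² Δ + |x|² - Λ`. -/
def ham (h Λ : ℝ) (f l p : CL) : CL := p - h ^ 2 • l - Λ • f

theorem ham_add (h Λ : ℝ) (f l p f' l' p' : CL) :
    ham h Λ (f + f') (l + l') (p + p') = ham h Λ f l p + ham h Λ f' l' p' := by
  simp only [ham, smul_add]
  abel

theorem IsState.ham_comm {f l p f' l' p' : CL} (h Λ : ℝ) (hf : IsState f l p)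
    (hf' : IsState f' l' p') :
    inner ℝ f (ham h Λ f' l' p') = inner ℝ (ham h Λ f l p) f' := by
  simp only [ham, inner_sub_left, inner_sub_right, real_inner_smul_left, real_inner_smul_right,
    hf.pot_comm hf', hf.lap.inner_comm hf'.lap]

theorem ham_smul (h Λ : ℝ) (c : ℂ) (f l p : CL) :
    ham h Λ (c • f) (c • l) (c • p) = c • ham h Λ f l p := by
  simp only [ham, smul_sub, smul_comm c]

/-- The Hamiltonian is symmetric and commutes with multiplication by `i`, which is skew for the real
inner product. This is conservation of mass for the linear part. -/
theorem IsState.inner_I_ham {f l p : CL} (h Λ : ℝ) (hf : IsState f l p) :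
    inner ℝ f (Complex.I • ham h Λ f l p) = 0 := by
  have h1 := hf.ham_comm h Λ (hf.smul Complex.I)
  rw [ham_smul, real_inner_comm] at h1
  have h2 := inner_I_smul f (ham h Λ f l p)
  have h3 := inner_I_smul (ham h Λ f l p) f
  rw [real_inner_comm] at h1
  have h4 : inner ℝ (Complex.I • f) (ham h Λ f l p) = inner ℝ (ham h Λ f l p) (Complex.I • f) :=
    real_inner_comm _ _
  linarith

/-! ### Expansion of the quartic energy -/

/-- Squaring `‖z + w‖² = ‖z‖² + 2⟨z, w⟩ + ‖w‖²` leaves an error quadratic in `w` with coefficient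
`‖z‖²`, plus a pure quartic; Young's inequality removes the cubic term. -/
theorem abs_norm_pow_four_sub_le (z w : ℂ) :
    |‖z + w‖ ^ 4 - ‖z‖ ^ 4 - 4 * (‖z‖ ^ 2 * inner ℝ z w)| ≤ 10 * (‖z‖ ^ 2 * ‖w‖ ^ 2) + 2 * ‖w‖ ^ 4 := by
  have h1 : ‖z + w‖ ^ 2 = ‖z‖ ^ 2 + 2 * inner ℝ z w + ‖w‖ ^ 2 := norm_add_sq_real z w
  have h2 : |inner ℝ z w| ≤ ‖z‖ * ‖w‖ := abs_real_inner_le_norm z w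
  have h3 : inner ℝ z w ^ 2 ≤ ‖z‖ ^ 2 * ‖w‖ ^ 2 := by
    rw [← mul_pow, ← sq_abs]
    exact pow_le_pow_left₀ (abs_nonneg _) h2 2
  have e : ‖z + w‖ ^ 4 - ‖z‖ ^ 4 - 4 * (‖z‖ ^ 2 * inner ℝ z w) =
      2 * (‖z‖ ^ 2 * ‖w‖ ^ 2) + (2 * inner ℝ z w + ‖w‖ ^ 2) ^ 2 := by
    rw [show ‖z + w‖ ^ 4 = (‖z + w‖ ^ 2) ^ 2 by ring, h1]
    ring
  rw [e, abs_of_nonneg (by positivity)]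
  nlinarith [sq_nonneg (2 * inner ℝ z w - ‖w‖ ^ 2)]

/-- The component of the cubic difference along `w` is killed by the factor `i`. What remains is
`(‖z + w‖² - ‖z‖²)⟨w, iz⟩`, which is at least quadratic in `w`. -/
theorem abs_inner_cubic_sub_le (z w : ℂ) :
    |inner ℝ w (Complex.I * ((‖z + w‖ ^ 2 : ℝ) * (z + w) - (‖z‖ ^ 2 : ℝ) * z))| ≤
      3 * (‖z‖ ^ 2 * ‖w‖ ^ 2) + ‖w‖ ^ 4 := by
  have h1 : ‖z + w‖ ^ 2 = ‖z‖ ^ 2 + 2 * inner ℝ z w + ‖w‖ ^ 2 := norm_add_sq_real z w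
  have h2 : |inner ℝ z w| ≤ ‖z‖ * ‖w‖ := abs_real_inner_le_norm z w
  have h3 : |inner ℝ w (Complex.I * z)| ≤ ‖w‖ * ‖z‖ := by
    refine (abs_real_inner_le_norm _ _).trans (le_of_eq ?_)
    rw [norm_mul, Complex.norm_I, one_mul]
  have e : inner ℝ w (Complex.I * ((‖z + w‖ ^ 2 : ℝ) * (z + w) - (‖z‖ ^ 2 : ℝ) * z)) =
      (2 * inner ℝ z w + ‖w‖ ^ 2) * inner ℝ w (Complex.I * z) := by
    rw [h1]
    generalize ‖z‖ ^ 2 = a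
    generalize ‖w‖ ^ 2 = a'
    simp only [Complex.inner]
    simp
    ring
  rw [e, abs_mul]
  have h4 : |2 * inner ℝ z w + ‖w‖ ^ 2| ≤ 2 * (‖z‖ * ‖w‖) + ‖w‖ ^ 2 := by
    refine (abs_add_le _ _).trans ?_
    rw [abs_mul, abs_of_pos (by norm_num : (0 : ℝ) < 2), abs_of_nonneg (sq_nonneg ‖w‖)]
    linarith
  calc _ ≤ (2 * (‖z‖ * ‖w‖) + ‖w‖ ^ 2) * (‖w‖ * ‖z‖) := by gcongr
    _ ≤ _ := by
      have := norm_nonneg z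
      have := norm_nonneg w
      nlinarith [sq_nonneg (‖z‖ * ‖w‖ - ‖w‖ ^ 2), sq_nonneg (‖z‖ * ‖w‖ + ‖w‖ ^ 2)]

theorem norm_sq_eq_integral (f : CL) : ‖f‖ ^ 2 = ∫ x, ‖f x‖ ^ 2 := by
  have := norm_toLp_complex_sq (Lp.memLp f)
  rwa [Lp.toLp_coeFn] at this

theorem exists_cubic {f : CL} {B : ℝ} (hB : ∀ᵐ x, ‖f x‖ ^ 2 ≤ B) :
    ∃ c : CL, ∀ᵐ x, c x = ((‖f x‖ ^ 2 : ℝ) : ℂ) * f x := by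
  have hm : MemLp (fun x => ((‖f x‖ ^ 2 : ℝ) : ℂ) * f x) 2 volume := by
    refine MemLp.of_le_mul (c := B) (Lp.memLp f) ?_ ?_
    · exact (Complex.continuous_ofReal.comp_aestronglyMeasurable
        ((Lp.aestronglyMeasurable f).norm.pow 2)).mul (Lp.aestronglyMeasurable f)
    · filter_upwards [hB] with x hx
      rw [norm_mul, Complex.norm_real, Real.norm_of_nonneg (by positivity)]
      gcongr
  exact ⟨hm.toLp _, hm.coeFn_toLp⟩

theorem quartic_expansion {f w c : CL} {B : ℝ} (hB : ∀ᵐ x, ‖f x‖ ^ 2 ≤ B)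
    (hc : ∀ᵐ x, c x = ((‖f x‖ ^ 2 : ℝ) : ℂ) * f x) (hf : Integrable fun x => ‖f x‖ ^ 4)
    (hw : Integrable fun x => ‖w x‖ ^ 4) (hfw : Integrable fun x => ‖(f + w) x‖ ^ 4) :
    |(∫ x, ‖(f + w) x‖ ^ 4) - (∫ x, ‖f x‖ ^ 4) - 4 * inner ℝ c w| ≤
      10 * B * ‖w‖ ^ 2 + 2 * ∫ x, ‖w x‖ ^ 4 := by
  have i1 : Integrable fun x => inner ℝ (c x) (w x) := L2.integrable_inner _ _
  have i2 : Integrable fun x => ‖w x‖ ^ 2 := (Lp.memLp w).integrable_norm_pow (by norm_num)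
  have i3 : Integrable fun x => ‖(f + w) x‖ ^ 4 - ‖f x‖ ^ 4 := hfw.sub hf
  rw [L2.inner_def, norm_sq_eq_integral, ← integral_const_mul, ← integral_const_mul,
    ← integral_const_mul, ← integral_sub hfw hf, ← integral_sub i3 (i1.const_mul 4),
    ← integral_add (i2.const_mul _) (hw.const_mul 2)]
  refine abs_integral_le_integral_abs.trans ?_
  refine integral_mono_ae (i3.sub (i1.const_mul 4)).abs
    ((i2.const_mul _).add (hw.const_mul 2)) ?_
  filter_upwards [hB, hc, Lp.coeFn_add f w] with x h1 h2 h3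
  have h4 := abs_norm_pow_four_sub_le (f x) (w x)
  have h5 : inner ℝ (c x) (w x) = ‖f x‖ ^ 2 * inner ℝ (f x) (w x) := by
    rw [h2, ← Complex.real_smul, real_inner_smul_left]
  simp only [h5, h3, Pi.add_apply]
  refine h4.trans ?_
  have := mul_le_mul_of_nonneg_right h1 (sq_nonneg ‖w x‖)
  linarith

theorem abs_inner_cubic_le {f w c c' : CL} {B : ℝ} (hB : ∀ᵐ x, ‖f x‖ ^ 2 ≤ B)
    (hc : ∀ᵐ x, c x = ((‖f x‖ ^ 2 : ℝ) : ℂ) * f x)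
    (hc' : ∀ᵐ x, c' x = ((‖(f + w) x‖ ^ 2 : ℝ) : ℂ) * (f + w) x)
    (hw : Integrable fun x => ‖w x‖ ^ 4) :
    |inner ℝ w (Complex.I • (c' - c))| ≤ 3 * B * ‖w‖ ^ 2 + ∫ x, ‖w x‖ ^ 4 := by
  have i2 : Integrable fun x => ‖w x‖ ^ 2 := (Lp.memLp w).integrable_norm_pow (by norm_num)
  rw [L2.inner_def, norm_sq_eq_integral, ← integral_const_mul, ← integral_add (i2.const_mul _) hw]
  refine abs_integral_le_integral_abs.trans ?_
  refine integral_mono_ae (L2.integrable_inner _ _).abs ((i2.const_mul _).add hw) ?_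
  filter_upwards [hB, hc, hc', Lp.coeFn_add f w, Lp.coeFn_smul Complex.I (c' - c),
    Lp.coeFn_sub c' c] with x h1 h2 h3 h4 h5 h6
  rw [h5, Pi.smul_apply, h6, Pi.sub_apply, h2, h3, h4, Pi.add_apply, smul_eq_mul]
  refine (abs_inner_cubic_sub_le (f x) (w x)).trans ?_
  have := mul_le_mul_of_nonneg_right h1 (sq_nonneg ‖w x‖)
  linarith

/-! ### Conservation of the energy -/

/-- The energy with coupling `g` at the frequency `Λ` of the state `f`. -/
def stateEnergy (h Λ g : ℝ) (f l p : CL) : ℝ :=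
  inner ℝ f (ham h Λ f l p) + g / 2 * ∫ x, ‖f x‖ ^ 4

theorem CLap.integrable_norm_pow_four {f g : CL} (h : CLap f g) : Integrable fun x => ‖f x‖ ^ 4 := by
  obtain ⟨C, -, hC⟩ := CLap.exists_gagliardo_nirenberg
  exact (hC f g h).1

/-- The quadratic part of the energy expands exactly, by symmetry of the Hamiltonian; the only error
is that of the quartic term. -/
theorem stateEnergy_expansion {h Λ g : ℝ} {f l p w l' p' c : CL} {B : ℝ} (hf : IsState f l p)
    (hw : IsState w l' p') (hB : ∀ᵐ x, ‖f x‖ ^ 2 ≤ B)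
    (hc : ∀ᵐ x, c x = ((‖f x‖ ^ 2 : ℝ) : ℂ) * f x) :
    |stateEnergy h Λ g (f + w) (l + l') (p + p') - stateEnergy h Λ g f l p -
      2 * inner ℝ (ham h Λ f l p + g • c) w - inner ℝ w (ham h Λ w l' p')| ≤
      |g| * (5 * B * ‖w‖ ^ 2 + ∫ x, ‖w x‖ ^ 4) := by
  have h1 := quartic_expansion hB hc hf.lap.integrable_norm_pow_four
    hw.lap.integrable_norm_pow_four (hf.add hw).lap.integrable_norm_pow_four
  have e : stateEnergy h Λ g (f + w) (l + l') (p + p') - stateEnergy h Λ g f l p -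
      2 * inner ℝ (ham h Λ f l p + g • c) w - inner ℝ w (ham h Λ w l' p') =
      g / 2 * ((∫ x, ‖(f + w) x‖ ^ 4) - (∫ x, ‖f x‖ ^ 4) - 4 * inner ℝ c w) := by
    rw [stateEnergy, stateEnergy, ham_add, inner_add_left, inner_add_right, inner_add_right,
      inner_add_left, real_inner_smul_left, hf.ham_comm h Λ hw,
      real_inner_comm (ham h Λ f l p) w]
    ring
  rw [e, abs_mul, abs_div, abs_of_pos (by norm_num : (0 : ℝ) < 2)]
  calc _ ≤ |g| / 2 * (10 * B * ‖w‖ ^ 2 + 2 * ∫ x, ‖w x‖ ^ 4) := by gcongr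
    _ = _ := by ring

/-- A solution of `i h v' = (-h² Δ + |x|² - Λ) v + g |v|² v` on `[0, T]`, where `l = Δ v`,
`p = |x|² v` and `c = |v|² v`. -/
structure IsOrbit (h Λ g T : ℝ) (v l p c dv : ℝ → CL) : Prop where
  cont : ContinuousOn v (Set.Icc 0 T)
  cont_lap : ContinuousOn l (Set.Icc 0 T)
  cont_pot : ContinuousOn p (Set.Icc 0 T)
  state : ∀ t ∈ Set.Icc 0 T, IsState (v t) (l t) (p t)
  cubic : ∀ t ∈ Set.Icc 0 T, ∀ᵐ x, c t x = ((‖v t x‖ ^ 2 : ℝ) : ℂ) * v t x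
  deriv : ∀ t ∈ Set.Icc 0 T, HasDerivWithinAt v (dv t) (Set.Icc 0 T) t
  eq : ∀ t ∈ Set.Icc 0 T, h • Complex.I • dv t = ham h Λ (v t) (l t) (p t) + g • c t

section Orbit

variable {h Λ g T : ℝ} {v l p c dv : ℝ → CL}

/-- The functions and their Laplacians are continuous on a compact interval, hence bounded in `L²`,
and the Sobolev embedding applies. The bound is qualitative and serves only to differentiate the
energy. -/
theorem IsOrbit.exists_sup (H : IsOrbit h Λ g T v l p c dv) :
    ∃ B : ℝ, ∀ t ∈ Set.Icc 0 T, ∀ᵐ x, ‖v t x‖ ^ 2 ≤ B := by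
  obtain ⟨C, hC, hs⟩ := CLap.exists_sup
  obtain ⟨V, hV⟩ := isCompact_Icc.exists_bound_of_continuousOn H.cont
  obtain ⟨L, hL⟩ := isCompact_Icc.exists_bound_of_continuousOn H.cont_lap
  refine ⟨C * (V ^ 2 + L ^ 2), fun t ht => ?_⟩
  filter_upwards [hs _ _ (H.state t ht).lap] with x hx
  have := hV t ht
  have := hL t ht
  refine hx.trans ?_
  gcongr

theorem integral_sub_norm_pow_four_le {f g : CL} {B : ℝ} (hf : ∀ᵐ x, ‖f x‖ ^ 2 ≤ B)
    (hg : ∀ᵐ x, ‖g x‖ ^ 2 ≤ B) : ∫ x, ‖(f - g) x‖ ^ 4 ≤ 4 * B * ‖f - g‖ ^ 2 := by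
  rw [norm_sq_eq_integral, ← integral_const_mul]
  refine integral_mono_of_nonneg (ae_of_all _ fun x => by positivity)
    (((Lp.memLp (f - g)).integrable_norm_pow (by norm_num)).const_mul _) ?_
  filter_upwards [hf, hg, Lp.coeFn_sub f g] with x h1 h2 h3
  have h4 : ‖(f - g) x‖ ≤ ‖f x‖ + ‖g x‖ := by
    rw [h3]
    exact norm_sub_le _ _
  have h5 : ‖(f - g) x‖ ^ 2 ≤ 4 * B := by
    refine (pow_le_pow_left₀ (norm_nonneg _) h4 2).trans ?_
    nlinarith [sq_nonneg (‖f x‖ - ‖g x‖)]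
  show ‖(f - g) x‖ ^ 4 ≤ 4 * B * ‖(f - g) x‖ ^ 2
  calc ‖(f - g) x‖ ^ 4 = ‖(f - g) x‖ ^ 2 * ‖(f - g) x‖ ^ 2 := by ring
    _ ≤ _ := by gcongr

/-- Only `v` is differentiable; `Δv` and `|x|²v` are merely continuous. This is enough: in the
expansion around time `t` the quadratic term pairs an increment of size `O(s - t)` with one that
tends to zero, so only the linear term counts. Its gradient is `ihv'`, which is orthogonal to `v'`.
-/
theorem IsOrbit.hasDerivWithinAt_energy (H : IsOrbit h Λ g T v l p c dv) {t : ℝ}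
    (ht : t ∈ Set.Icc 0 T) :
    HasDerivWithinAt (fun s => stateEnergy h Λ g (v s) (l s) (p s)) 0 (Set.Icc 0 T) t := by
  obtain ⟨B, hB⟩ := H.exists_sup
  set N := ham h Λ (v t) (l t) (p t) + g • c t with hN
  have hNd : inner ℝ N (dv t) = 0 := by
    rw [hN, ← H.eq t ht, real_inner_smul_left, real_inner_comm, inner_I_smul_self, mul_zero]
  have hlin : HasDerivWithinAt (fun s => 2 * inner ℝ N (v s)) 0 (Set.Icc 0 T) t := by
    have := ((hasDerivWithinAt_const t (Set.Icc 0 T) N).inner ℝ (H.deriv t ht)).const_mul 2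
    simpa [hNd] using this
  set D : ℝ → CL := fun s => ham h Λ (v s - v t) (l s - l t) (p s - p t) with hD
  have hrem : HasDerivWithinAt
      (fun s => stateEnergy h Λ g (v s) (l s) (p s) - 2 * inner ℝ N (v s)) 0 (Set.Icc 0 T) t := by
    rw [hasDerivWithinAt_iff_isLittleO]
    have hO : (fun s => v s - v t) =O[𝓝[Set.Icc 0 T] t] fun s => s - t :=
      (H.deriv t ht).hasFDerivWithinAt.isBigO_sub
    have hv0 : Tendsto (fun s => v s - v t) (𝓝[Set.Icc 0 T] t) (𝓝 0) := by
      have : Tendsto v (𝓝[Set.Icc 0 T] t) (𝓝 (v t)) := H.cont t ht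
      simpa using this.sub_const (v t)
    have hl0 : Tendsto (fun s => l s - l t) (𝓝[Set.Icc 0 T] t) (𝓝 0) := by
      have : Tendsto l (𝓝[Set.Icc 0 T] t) (𝓝 (l t)) := H.cont_lap t ht
      simpa using this.sub_const (l t)
    have hp0 : Tendsto (fun s => p s - p t) (𝓝[Set.Icc 0 T] t) (𝓝 0) := by
      have : Tendsto p (𝓝[Set.Icc 0 T] t) (𝓝 (p t)) := H.cont_pot t ht
      simpa using this.sub_const (p t)
    have hD0 : Tendsto (fun s => ‖D s‖ + |g| * (9 * B) * ‖v s - v t‖) (𝓝[Set.Icc 0 T] t)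
        (𝓝 0) := by
      have h1 : Tendsto D (𝓝[Set.Icc 0 T] t) (𝓝 0) := by
        have := (hp0.sub (hl0.const_smul (h ^ 2))).sub (hv0.const_smul Λ)
        rw [smul_zero, smul_zero, sub_zero, sub_zero] at this
        exact this
      simpa using h1.norm.add (hv0.norm.const_mul (|g| * (9 * B)))
    have ho : (fun s => ‖v s - v t‖ * (‖D s‖ + |g| * (9 * B) * ‖v s - v t‖))
        =o[𝓝[Set.Icc 0 T] t] fun s => (s - t) * 1 :=
      hO.norm_left.mul_isLittleO ((Asymptotics.isLittleO_one_iff ℝ).2 hD0)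
    simp only [mul_one] at ho
    refine Asymptotics.IsBigO.trans_isLittleO (Asymptotics.IsBigO.of_bound 1 ?_) ho
    filter_upwards [self_mem_nhdsWithin] with s hs
    have hw := (H.state s hs).sub (H.state t ht)
    have key := stateEnergy_expansion (h := h) (Λ := Λ) (g := g) (H.state t ht) hw (hB t ht)
      (H.cubic t ht)
    rw [add_sub_cancel, add_sub_cancel, add_sub_cancel, ← hN] at key
    have h4 := integral_sub_norm_pow_four_le (hB s hs) (hB t ht)
    have h5 : |inner ℝ (v s - v t) (D s)| ≤ ‖v s - v t‖ * ‖D s‖ := abs_real_inner_le_norm _ _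
    rw [one_mul, smul_zero, sub_zero, Real.norm_eq_abs,
      Real.norm_of_nonneg (mul_nonneg (norm_nonneg _) ?_)]
    · have h6 : |g| * (5 * B * ‖v s - v t‖ ^ 2 + ∫ x, ‖(v s - v t) x‖ ^ 4) ≤
          |g| * (9 * B * ‖v s - v t‖ ^ 2) := by
        gcongr
        linarith
      have h7 : inner ℝ N (v s - v t) = inner ℝ N (v s) - inner ℝ N (v t) := inner_sub_right _ _ _
      rw [h7] at key
      have k1 := abs_le.1 (key.trans h6)
      have k2 := abs_le.1 h5
      rw [abs_le]
      constructor <;> nlinarith [k1.1, k1.2, k2.1, k2.2]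
    · have hB0 : 0 ≤ B := by
        obtain ⟨x, hx⟩ := (hB t ht).exists
        exact (sq_nonneg _).trans hx
      positivity
  have := hrem.add hlin
  rw [add_zero] at this
  refine this.congr_of_mem (fun s _ => ?_) ht
  simp

theorem IsOrbit.energy_eq (H : IsOrbit h Λ g T v l p c dv) {t : ℝ} (ht : t ∈ Set.Icc 0 T) :
    stateEnergy h Λ g (v t) (l t) (p t) = stateEnergy h Λ g (v 0) (l 0) (p 0) := by
  refine constant_of_derivWithin_zero (f := fun s => stateEnergy h Λ g (v s) (l s) (p s))
    (fun s hs => (H.hasDerivWithinAt_energy hs).differentiableWithinAt)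
    (fun s hs => (H.hasDerivWithinAt_energy ⟨hs.1, hs.2.le⟩).derivWithin
      (uniqueDiffOn_Icc (hs.1.trans_lt hs.2) s ⟨hs.1, hs.2.le⟩)) t ht

/-! ### Comparison with an approximate solution -/

variable {U W R : CL} {B : ℝ}

theorem smul_eq_neg_I_smul (h : ℝ) (f : CL) : h • f = -(Complex.I • (h • Complex.I • f)) := by
  have h1 : Complex.I • (h • Complex.I • f) = h • Complex.I • Complex.I • f := smul_comm _ _ _
  rw [h1, smul_smul, Complex.I_mul_I, neg_one_smul, smul_neg, neg_neg]

theorem ham_add_eq_neg_residual {P cU : CL} (hU : IsState U W P)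
    (hcU : ∀ᵐ x, cU x = ((‖U x‖ ^ 2 : ℝ) : ℂ) * U x)
    (hR : ∀ᵐ x, R x = (h ^ 2 : ℝ) * W x - (‖x‖ ^ 2 : ℝ) * U x + (Λ : ℂ) * U x -
      (g * ‖U x‖ ^ 2 : ℝ) * U x) : ham h Λ U W P + g • cU = -R := by
  refine Lp.ext ?_
  filter_upwards [hR, hcU, hU.pot, Lp.coeFn_neg R, Lp.coeFn_add (ham h Λ U W P) (g • cU),
    Lp.coeFn_smul g cU, Lp.coeFn_sub (P - h ^ 2 • W) (Λ • U), Lp.coeFn_sub P (h ^ 2 • W),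
    Lp.coeFn_smul (h ^ 2) W, Lp.coeFn_smul Λ U] with x a1 a2 a3 a4 a5 a6 a7 a8 a9 a10
  rw [a5, Pi.add_apply, ham, a7, Pi.sub_apply, a8, Pi.sub_apply, a9, a10, a6, a4, Pi.neg_apply,
    a1, Pi.smul_apply, Pi.smul_apply, Pi.smul_apply, a2, a3, Complex.real_smul, Complex.real_smul,
    Complex.real_smul]
  push_cast
  ring

/-- The orbit keeps the energy of `U`. In the expansion around `U` the linear term is the pairing
with the residual, and the quadratic form is `h²‖∇w‖²` plus a nonnegative potential part minus
`Λ‖w‖²`. Conservation of energy thus bounds the gradient of the deviation by lower order quantities.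
-/
theorem IsOrbit.neg_inner_le (H : IsOrbit h Λ g T v l p c dv) (h0 : v 0 = U) (hW : CLap U W)
    (hB : ∀ᵐ x, ‖U x‖ ^ 2 ≤ B)
    (hR : ∀ᵐ x, R x = (h ^ 2 : ℝ) * W x - (‖x‖ ^ 2 : ℝ) * U x + (Λ : ℂ) * U x -
      (g * ‖U x‖ ^ 2 : ℝ) * U x) {t : ℝ} (ht : t ∈ Set.Icc 0 T) :
    -(h ^ 2 * inner ℝ (v t - U) (l t - W)) ≤ Λ * ‖v t - U‖ ^ 2 + 2 * (‖R‖ * ‖v t - U‖) +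
      |g| * (5 * B * ‖v t - U‖ ^ 2 + ∫ x, ‖(v t - U) x‖ ^ 4) := by
  have hmem0 : (0 : ℝ) ∈ Set.Icc 0 T := ⟨le_rfl, ht.1.trans ht.2⟩
  have hU : IsState U W (p 0) := ⟨hW, h0 ▸ (H.state 0 hmem0).pot⟩
  obtain ⟨cU, hcU⟩ := exists_cubic hB
  have hw := (H.state t ht).sub hU
  have hres := ham_add_eq_neg_residual hU hcU hR
  have hRw : |inner ℝ R (v t - U)| ≤ ‖R‖ * ‖v t - U‖ := abs_real_inner_le_norm _ _
  have key := stateEnergy_expansion (h := h) (Λ := Λ) (g := g) hU hw hB hcU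
  have hE : stateEnergy h Λ g (v t) (l t) (p t) = stateEnergy h Λ g U W (p 0) := by
    rw [H.energy_eq ht]
    -- Both `l 0` and `W` are weak Laplacians of the same function; symmetry identifies their
    -- pairings with it, which is all the energy sees.
    have hl : inner ℝ (v 0) (l 0) = inner ℝ U W := by
      have := (H.state 0 hmem0).lap.inner_comm hW
      rw [h0] at this ⊢
      rw [this, real_inner_comm]
    simp only [stateEnergy, ham, inner_sub_right, real_inner_smul_right, hl]
    rw [h0]
  rw [add_sub_cancel, add_sub_cancel, add_sub_cancel, hE, hres, sub_self, inner_neg_left] at key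
  have hh : inner ℝ (v t - U) (ham h Λ (v t - U) (l t - W) (p t - p 0)) =
      inner ℝ (v t - U) (p t - p 0) - h ^ 2 * inner ℝ (v t - U) (l t - W) -
        Λ * ‖v t - U‖ ^ 2 := by
    rw [ham, inner_sub_right, inner_sub_right, real_inner_smul_right, real_inner_smul_right,
      real_inner_self_eq_norm_sq]
  rw [hh] at key
  have k1 := (abs_le.1 key).1
  have k2 := (abs_le.1 hRw).2
  have := hw.pot_nonneg
  linarith

/-- Subtracting the equation of `U` leaves `Hw`, the difference of the cubic terms and the residual.
After multiplication by `i` the first is orthogonal to `w`, and the second is quadratic in `w` by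
`abs_inner_cubic_le`. -/
theorem IsOrbit.abs_inner_deriv_le (H : IsOrbit h Λ g T v l p c dv) (h0 : v 0 = U) (hW : CLap U W)
    (hB : ∀ᵐ x, ‖U x‖ ^ 2 ≤ B)
    (hR : ∀ᵐ x, R x = (h ^ 2 : ℝ) * W x - (‖x‖ ^ 2 : ℝ) * U x + (Λ : ℂ) * U x -
      (g * ‖U x‖ ^ 2 : ℝ) * U x) {t : ℝ} (ht : t ∈ Set.Icc 0 T) :
    |h * inner ℝ (v t - U) (dv t)| ≤ ‖R‖ * ‖v t - U‖ +
      |g| * (3 * B * ‖v t - U‖ ^ 2 + ∫ x, ‖(v t - U) x‖ ^ 4) := by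
  have hmem0 : (0 : ℝ) ∈ Set.Icc 0 T := ⟨le_rfl, ht.1.trans ht.2⟩
  have hU : IsState U W (p 0) := ⟨hW, h0 ▸ (H.state 0 hmem0).pot⟩
  obtain ⟨cU, hcU⟩ := exists_cubic hB
  have hw := (H.state t ht).sub hU
  have hres := ham_add_eq_neg_residual hU hcU hR
  have e1 : h • Complex.I • dv t = ham h Λ (v t - U) (l t - W) (p t - p 0) + g • (c t - cU) - R := by
    rw [H.eq t ht, ← sub_eq_zero]
    have e2 : ham h Λ (v t) (l t) (p t) = ham h Λ (v t - U) (l t - W) (p t - p 0) +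
        ham h Λ U W (p 0) := by
      rw [← ham_add]
      simp only [sub_add_cancel]
    rw [e2, smul_sub, ← neg_eq_iff_eq_neg.2 hres]
    abel
  have e2 : h * inner ℝ (v t - U) (dv t) = -(g * inner ℝ (v t - U) (Complex.I • (c t - cU))) +
      inner ℝ (v t - U) (Complex.I • R) := by
    have e3 : Complex.I • (g • (c t - cU)) = g • Complex.I • (c t - cU) := smul_comm _ _ _
    rw [← real_inner_smul_right, smul_eq_neg_I_smul, e1, smul_sub, smul_add, e3, inner_neg_right,
      inner_sub_right, inner_add_right, hw.inner_I_ham, real_inner_smul_right]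
    ring
  have e4 : |inner ℝ (v t - U) (Complex.I • R)| ≤ ‖R‖ * ‖v t - U‖ := by
    refine (abs_real_inner_le_norm _ _).trans (le_of_eq ?_)
    rw [norm_smul, Complex.norm_I, one_mul, mul_comm]
  have e5 := abs_inner_cubic_le (w := v t - U) (c' := c t) hB hcU
    (by rw [add_sub_cancel]; exact H.cubic t ht) hw.lap.integrable_norm_pow_four
  rw [e2]
  refine (abs_add_le _ _).trans ?_
  rw [abs_neg, abs_mul]
  have := mul_le_mul_of_nonneg_left e5 (abs_nonneg g)
  linarith

end Orbit

/-! ### The continuity argument -/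

/-- At the first time when the value `c` is reached, the weak bound holds on the whole past, so the
improved strict bound contradicts equality. -/
theorem lt_of_continuity_argument {f : ℝ → ℝ} {T c : ℝ} (hf : ContinuousOn f (Set.Icc 0 T))
    (h0 : f 0 < c) (h : ∀ t ∈ Set.Icc 0 T, (∀ s ∈ Set.Icc 0 t, f s ≤ c) → f t < c) :
    ∀ t ∈ Set.Icc 0 T, f t < c := by
  by_contra! hne
  obtain ⟨t₁, ht₁, hc₁⟩ := hne
  set S := {t ∈ Set.Icc 0 T | c ≤ f t} with hS
  have hcl : IsClosed S := by
    have := hf.preimage_isClosed_of_isClosed isClosed_Icc (isClosed_Ici (a := c))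
    exact this
  have hbd : BddBelow S := ⟨0, fun t ht => ht.1.1⟩
  have hs : sInf S ∈ S := hcl.csInf_mem ⟨t₁, ht₁, hc₁⟩ hbd
  set s := sInf S with hsdef
  have hlt : ∀ τ ∈ Set.Icc 0 s, τ ≠ s → f τ < c := fun τ hτ hne => by
    by_contra! hcon
    exact hne (le_antisymm hτ.2 (csInf_le hbd ⟨⟨hτ.1, hτ.2.trans hs.1.2⟩, hcon⟩))
  obtain ⟨τ, hτ, hfτ⟩ := intermediate_value_Icc hs.1.1
    (hf.mono (Set.Icc_subset_Icc le_rfl hs.1.2)) ⟨h0.le, hs.2⟩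
  have hτs : τ = s := by
    by_contra hne
    exact (hlt τ hτ hne).ne hfτ
  rw [hτs] at hfτ
  have := h s hs.1 fun σ hσ => by
    by_cases hσs : σ = s
    · rw [hσs, hfτ]
    · exact (hlt σ hσ hσs).le
  exact this.ne hfτ

/-- Gronwall's inequality gives `η(e^{Lt} - 1)`, and the constant is dropped. -/
theorem le_of_deriv_le {A A' : ℝ → ℝ} {T L η : ℝ} (hL : 0 < L) (hη : 0 ≤ η)
    (hd : ∀ t ∈ Set.Icc 0 T, HasDerivWithinAt A (A' t) (Set.Icc 0 T) t) (h0 : A 0 = 0)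
    (hA : ∀ t ∈ Set.Icc 0 T, 0 ≤ A t) (hA' : ∀ t ∈ Set.Icc 0 T, |A' t| ≤ L * (A t + η)) :
    ∀ t ∈ Set.Icc 0 T, A t ≤ η * Real.exp (L * t) := by
  intro t ht
  have hb := norm_le_gronwallBound_of_norm_deriv_right_le (f := A) (f' := A') (δ := 0) (K := L)
    (ε := L * η) (a := 0) (b := T) (fun t ht => (hd t ht).continuousWithinAt)
    (fun t ht => ((hd t ⟨ht.1, ht.2.le⟩).mono_of_mem_nhdsWithin
      (Icc_mem_nhdsGE_of_mem ht))) (by rw [h0, norm_zero]) (fun t ht => by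
      rw [Real.norm_eq_abs, Real.norm_of_nonneg (hA t ⟨ht.1, ht.2.le⟩)]
      have := hA' t ⟨ht.1, ht.2.le⟩
      linarith) t ht
  rw [Real.norm_of_nonneg (hA t ht), gronwallBound_of_K_ne_0 hL.ne'] at hb
  simp only [sub_zero, zero_mul, zero_add, mul_div_cancel_left₀ _ hL.ne'] at hb
  linarith

/-- The pointwise-in-time algebra of the bootstrap, where `A`, `Y`, `Q`, `r` stand for `‖w‖²`,
`h²‖∇w‖²`, `∫|w|⁴` and the norm of the residual. Both estimates become linear in `A` up to an error
of order `h³`. -/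
theorem growth_estimates {K h A Y Q r a : ℝ} (hK : 1 ≤ K) (h0 : 0 < h) (h1 : h ≤ 1) (hA : 0 ≤ A)
    (hY : 0 ≤ Y) (hQ : 0 ≤ Q) (hr : 0 ≤ r) (hr2 : r ^ 2 ≤ K * h ^ 5) (hYh : Y ≤ h ^ 2)
    (hQ2 : Q ^ 2 * h ^ 6 ≤ K * A * Y ^ 3) (ha : a ^ 2 = A) (ha0 : 0 ≤ a)
    (hY1 : Y ≤ K * (A + r * a + h ^ 2 * Q)) :
    Y ≤ 5 * K ^ 3 * A + 2 * K ^ 2 * h ^ 3 ∧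
      K * (A + r * a / h + h * Q) ≤ 5 * K ^ 4 * (A + h ^ 3) := by
  have hK0 : 0 ≤ K := by linarith
  -- The bootstrap assumption `Y ≤ h²` turns the cubic Gagliardo-Nirenberg bound into one linear in
  -- `Y`; by Young's inequality half of `Y` can then be absorbed.
  have hX2 : (h * Q) ^ 2 ≤ K * A * Y := by
    have h2 : Y ^ 2 ≤ h ^ 4 := by
      calc Y ^ 2 ≤ (h ^ 2) ^ 2 := pow_le_pow_left₀ hY hYh 2
        _ = h ^ 4 := by ring
    have : (h * Q) ^ 2 * h ^ 4 ≤ K * A * Y * h ^ 4 := by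
      calc (h * Q) ^ 2 * h ^ 4 = Q ^ 2 * h ^ 6 := by ring
        _ ≤ K * A * Y ^ 3 := hQ2
        _ = K * A * Y * Y ^ 2 := by ring
        _ ≤ K * A * Y * h ^ 4 := by gcongr
    exact le_of_mul_le_mul_right this (by positivity)
  have hX : K * (h * Q) ≤ (K ^ 3 * A + Y) / 2 := by
    refine le_of_sq_le_sq ?_ (by positivity)
    calc (K * (h * Q)) ^ 2 = K ^ 2 * (h * Q) ^ 2 := by ring
      _ ≤ K ^ 2 * (K * A * Y) := by gcongr
      _ = K ^ 3 * A * Y := by ring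
      _ ≤ _ := by nlinarith [sq_nonneg (K ^ 3 * A - Y)]
  have hra : r * a / h ≤ A / 2 + K * h ^ 3 / 2 := by
    have h3 : (r / h) ^ 2 ≤ K * h ^ 3 := by
      rw [div_pow, div_le_iff₀ (by positivity)]
      calc r ^ 2 ≤ K * h ^ 5 := hr2
        _ = _ := by ring
    have h4 : r * a / h = (r / h) * a := by ring
    rw [h4]
    nlinarith [sq_nonneg (r / h - a)]
  have hra0 : 0 ≤ r * a / h := by positivity
  have hra' : r * a ≤ r * a / h := by
    rw [le_div_iff₀ h0]
    exact mul_le_of_le_one_right (by positivity) h1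
  have hK3 : K ≤ K ^ 3 := le_self_pow₀ hK (by norm_num)
  have hK2 : K ^ 2 ≤ K ^ 3 := pow_le_pow_right₀ hK (by norm_num)
  have hh3 : 0 < h ^ 3 := by positivity
  have hQQ : h ^ 2 * Q ≤ h * Q := by
    have : 0 ≤ h * Q := by positivity
    calc h ^ 2 * Q = h * (h * Q) := by ring
      _ ≤ 1 * (h * Q) := by gcongr
      _ = _ := one_mul _
  have m1 := mul_le_mul_of_nonneg_left hra hK0
  have m2 := mul_le_mul_of_nonneg_left hra' hK0
  have m3 := mul_le_mul_of_nonneg_left hQQ hK0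
  have m4 := mul_le_mul_of_nonneg_right hK3 hA
  have hYA : Y ≤ 5 * K ^ 3 * A + 2 * K ^ 2 * h ^ 3 := by nlinarith
  refine ⟨hYA, ?_⟩
  have hK4 : K ^ 3 ≤ K ^ 4 := pow_le_pow_right₀ hK (by norm_num)
  have m5 := mul_le_mul_of_nonneg_right hK4 hA
  have m6 := mul_le_mul_of_nonneg_right (hK2.trans hK4) hh3.le
  nlinarith

/-- The continuity argument runs on `max A Y < h²`. While it holds, Gronwall gives `A ≤ h³e^{Lt}`
with `L = 5K⁴`. The time bound is `log(1/h)/(2L)`, so `A` is at most `h^{5/2}` and `Y` at most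
`7K³h^{5/2}`, both below `h²` when `7K³√h < 1`. -/
theorem bootstrap {K : ℝ} (hK : 1 ≤ K) {h T r : ℝ} {A A' Y Q : ℝ → ℝ} (h0 : 0 < h)
    (h1 : 7 * K ^ 3 * √h < 1) (hT : T ≤ 1 / (10 * K ^ 4) * Real.log (1 / h)) (hr : 0 ≤ r)
    (hr2 : r ^ 2 ≤ K * h ^ 5) (hAd : ∀ t ∈ Set.Icc 0 T, HasDerivWithinAt A (A' t) (Set.Icc 0 T) t)
    (hYc : ContinuousOn Y (Set.Icc 0 T)) (hA0 : A 0 = 0) (hY0 : Y 0 = 0)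
    (hA : ∀ t ∈ Set.Icc 0 T, 0 ≤ A t) (hY : ∀ t ∈ Set.Icc 0 T, 0 ≤ Y t)
    (hQ : ∀ t ∈ Set.Icc 0 T, 0 ≤ Q t)
    (hQ2 : ∀ t ∈ Set.Icc 0 T, Q t ^ 2 * h ^ 6 ≤ K * A t * Y t ^ 3)
    (hYb : ∀ t ∈ Set.Icc 0 T, Y t ≤ K * (A t + r * √(A t) + h ^ 2 * Q t))
    (hAb : ∀ t ∈ Set.Icc 0 T, |A' t| ≤ K * (A t + r * √(A t) / h + h * Q t)) :
    ∀ t ∈ Set.Icc 0 T, A t ≤ h ^ 2 := by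
  have hs0 : 0 < √h := Real.sqrt_pos.2 h0
  have hsq : √h ^ 2 = h := Real.sq_sqrt h0.le
  have hK3 : 1 ≤ K ^ 3 := one_le_pow₀ hK
  have hs1 : √h ≤ 1 := by nlinarith
  have hh1 : h ≤ 1 := by nlinarith
  have hmax := lt_of_continuity_argument (f := fun t => max (A t) (Y t)) (T := T) (c := h ^ 2)
    (ContinuousOn.sup (fun t ht => (hAd t ht).continuousWithinAt) hYc)
    (by simp only [hA0, hY0, max_self]; positivity) ?_
  · exact fun t ht => (le_max_left _ _).trans (hmax t ht).le
  intro t ht hle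
  have hsub : Set.Icc 0 t ⊆ Set.Icc 0 T := Set.Icc_subset_Icc le_rfl ht.2
  have est := fun s (hs : s ∈ Set.Icc 0 t) => growth_estimates hK h0 hh1 (hA s (hsub hs))
    (hY s (hsub hs)) (hQ s (hsub hs)) hr hr2 ((le_max_right _ _).trans (hle s hs))
    (hQ2 s (hsub hs)) (Real.sq_sqrt (hA s (hsub hs))) (Real.sqrt_nonneg _) (hYb s (hsub hs))
  have hAt := le_of_deriv_le (L := 5 * K ^ 4) (η := h ^ 3) (by positivity) (by positivity)
    (fun s hs => (hAd s (hsub hs)).mono hsub) hA0 (fun s hs => hA s (hsub hs))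
    (fun s hs => (hAb s (hsub hs)).trans (est s hs).2) t ⟨ht.1, le_rfl⟩
  -- The factor `1 / (10 K⁴)` is half the reciprocal of the growth rate, so the exponential loses
  -- only half a power of `h`.
  have hexp : Real.exp (5 * K ^ 4 * t) ≤ 1 / √h := by
    have : 5 * K ^ 4 * t ≤ Real.log (1 / √h) := by
      rw [one_div, Real.log_inv, Real.log_sqrt h0.le]
      have h2 := ht.2.trans hT
      rw [one_div h, Real.log_inv] at h2
      calc 5 * K ^ 4 * t ≤ 5 * K ^ 4 * (1 / (10 * K ^ 4) * -Real.log h) := by gcongr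
        _ = _ := by
          field_simp
          ring
    calc _ ≤ Real.exp (Real.log (1 / √h)) := Real.exp_le_exp.2 this
      _ = _ := Real.exp_log (by positivity)
  have hA5 : A t ≤ h ^ 2 * √h := by
    refine hAt.trans ?_
    calc h ^ 3 * Real.exp (5 * K ^ 4 * t) ≤ h ^ 3 * (1 / √h) := by gcongr
      _ = h ^ 2 * √h := by
        field_simp
        rw [hsq]
  have hYt := (est t ⟨ht.1, le_rfl⟩).1
  have hh3 : h ^ 3 ≤ h ^ 2 * √h := by
    calc h ^ 3 = h ^ 2 * (√h * √h) := by rw [← sq, hsq]; ring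
      _ ≤ h ^ 2 * (√h * 1) := by gcongr
      _ = _ := by ring
  have hK2 : K ^ 2 ≤ K ^ 3 := pow_le_pow_right₀ hK (by norm_num)
  have hfin : 7 * K ^ 3 * (h ^ 2 * √h) < h ^ 2 := by
    calc 7 * K ^ 3 * (h ^ 2 * √h) = h ^ 2 * (7 * K ^ 3 * √h) := by ring
      _ < h ^ 2 * 1 := by gcongr
      _ = _ := mul_one _
  have hp : 0 < h ^ 2 * √h := by positivity
  refine max_lt ?_ ?_
  · nlinarith
  · have m1 : 5 * K ^ 3 * A t ≤ 5 * K ^ 3 * (h ^ 2 * √h) := by gcongr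
    have m2 : 2 * K ^ 2 * h ^ 3 ≤ 2 * K ^ 3 * (h ^ 2 * √h) := by gcongr
    linarith

/-! ### Stability of the approximate solution -/

/-- With coupling `bh²` and `|U|² ≤ K₀/h`, the nonlinear potential created by `U` is `O(h)`; the
factor `1/h` of the evolution leaves a growth rate bounded in `h`, as `bootstrap` requires. -/
theorem IsOrbit.exists_stability {K₀ c₀ : ℝ} (hK₀ : 0 ≤ K₀) (hc₀ : 0 ≤ c₀) :
    ∃ K : ℝ, 1 ≤ K ∧ ∀ (h T Λ b : ℝ) (v l p c dv : ℝ → CL) (U W R : CL), 0 < h →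
      7 * K ^ 3 * √h < 1 → T ≤ 1 / (10 * K ^ 4) * Real.log (1 / h) → |b| ≤ c₀ → |Λ| ≤ K₀ →
      IsOrbit h Λ (b * h ^ 2) T v l p c dv → v 0 = U → CLap U W → (∀ᵐ x, ‖U x‖ ^ 2 ≤ K₀ / h) →
      ‖R‖ ^ 2 ≤ K₀ * h ^ 5 →
      (∀ᵐ x, R x = (h ^ 2 : ℝ) * W x - (‖x‖ ^ 2 : ℝ) * U x + (Λ : ℂ) * U x -
        (b * h ^ 2 * ‖U x‖ ^ 2 : ℝ) * U x) →
      ∀ t ∈ Set.Icc 0 T, ‖v t - U‖ ^ 2 ≤ h ^ 2 := by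
  obtain ⟨C, hC, hGN⟩ := CLap.exists_gagliardo_nirenberg
  have hcK : 0 ≤ c₀ * K₀ := by positivity
  -- A single constant dominates every coefficient below: 2 for the residual terms, `K₀` for the
  -- frequency and the size of `R`, `6c₀K₀` and `2c₀` for the nonlinear terms, `C` for
  -- Gagliardo-Nirenberg.
  set K := 2 + K₀ + 6 * (c₀ * K₀) + 2 * c₀ + C with hKdef
  have hK : 1 ≤ K := by linarith
  refine ⟨K, hK, fun h T Λ b v l p c dv U W R h0 hs hT hb hΛ H hv0 hW hB hR hres => ?_⟩
  have hK3 : 1 ≤ K ^ 3 := one_le_pow₀ hK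
  have hs0 : 0 < √h := Real.sqrt_pos.2 h0
  have hsq : √h ^ 2 = h := Real.sq_sqrt h0.le
  have hs1 : √h ≤ 1 := by nlinarith
  have hh1 : h ≤ 1 := by nlinarith
  have hg : |b * h ^ 2| = |b| * h ^ 2 := by rw [abs_mul, abs_of_nonneg (sq_nonneg h)]
  have hlap : ∀ t ∈ Set.Icc 0 T, CLap (v t - U) (l t - W) := fun t ht => by
    have := (H.state t ht).lap.add (hW.smul (-1))
    simpa only [neg_smul, one_smul, ← sub_eq_add_neg] using this
  have hsqrt : ∀ t, √(‖v t - U‖ ^ 2) = ‖v t - U‖ := fun t => Real.sqrt_sq (norm_nonneg _)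
  have hQ0 : ∀ t, 0 ≤ ∫ x, ‖(v t - U) x‖ ^ 4 := fun t => integral_nonneg fun x => by positivity
  refine bootstrap (A := fun t => ‖v t - U‖ ^ 2) (A' := fun t => 2 * inner ℝ (v t - U) (dv t))
    (Y := fun t => -(h ^ 2 * inner ℝ (v t - U) (l t - W)))
    (Q := fun t => ∫ x, ‖(v t - U) x‖ ^ 4) (r := ‖R‖) hK h0 hs hT (norm_nonneg _) ?_
    (fun t ht => ((H.deriv t ht).sub_const U).norm_sq) ?_ (by simp [hv0]) (by simp [hv0])
    (fun t _ => sq_nonneg _) ?_ (fun t _ => hQ0 t) ?_ ?_ ?_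
  · refine hR.trans ?_
    gcongr
    linarith
  · exact (continuousOn_const.mul ((H.cont.sub continuousOn_const).inner
      (H.cont_lap.sub continuousOn_const))).neg
  · intro t ht
    have := (hlap t ht).neg_inner_nonneg
    have := mul_nonneg (sq_nonneg h) this
    show 0 ≤ -(h ^ 2 * inner ℝ (v t - U) (l t - W))
    linarith
  · intro t ht
    have h1 := (hGN _ _ (hlap t ht)).2
    have h2 := (hlap t ht).neg_inner_nonneg
    show (∫ x, ‖(v t - U) x‖ ^ 4) ^ 2 * h ^ 6 ≤ K * ‖v t - U‖ ^ 2 *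
      (-(h ^ 2 * inner ℝ (v t - U) (l t - W))) ^ 3
    calc _ ≤ (C * ‖v t - U‖ ^ 2 * (-inner ℝ (v t - U) (l t - W)) ^ 3) * h ^ 6 := by gcongr
      _ ≤ (K * ‖v t - U‖ ^ 2 * (-inner ℝ (v t - U) (l t - W)) ^ 3) * h ^ 6 := by
        gcongr
        linarith
      _ = _ := by ring
  · intro t ht
    have h1 := H.neg_inner_le hv0 hW hB hres ht
    rw [hg] at h1
    have hA := sq_nonneg ‖v t - U‖
    have hQ := hQ0 t
    simp only [hsqrt]
    set A := ‖v t - U‖ ^ 2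
    set Q := ∫ x, ‖(v t - U) x‖ ^ 4
    have hra : 0 ≤ ‖R‖ * ‖v t - U‖ := by positivity
    set ra := ‖R‖ * ‖v t - U‖
    have e1 : |b| * h ^ 2 * (5 * (K₀ / h) * A + Q) = |b| * (5 * K₀ * h * A + h ^ 2 * Q) := by
      field_simp
    have e2 : |b| * (5 * K₀ * h * A + h ^ 2 * Q) ≤ c₀ * (5 * K₀ * 1 * A + h ^ 2 * Q) := by
      gcongr
    have e3 : Λ * A ≤ K₀ * A := by
      gcongr
      exact (le_abs_self Λ).trans hΛ
    have hhQ : 0 ≤ h ^ 2 * Q := by positivity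
    have m1 : (2 + 2 * c₀ + C + c₀ * K₀) * A ≥ 0 := by positivity
    have m2 : (K₀ + 6 * (c₀ * K₀) + 2 * c₀ + C) * ra ≥ 0 := by positivity
    have m3 : (2 + K₀ + 6 * (c₀ * K₀) + c₀ + C) * (h ^ 2 * Q) ≥ 0 := by positivity
    rw [e1] at h1
    rw [hKdef]
    linarith
  · intro t ht
    have h1 := H.abs_inner_deriv_le hv0 hW hB hres ht
    rw [hg, abs_mul, abs_of_pos h0] at h1
    have hA := sq_nonneg ‖v t - U‖
    have hQ := hQ0 t
    simp only [hsqrt]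
    rw [abs_mul, abs_of_pos (by norm_num : (0 : ℝ) < 2)]
    set A := ‖v t - U‖ ^ 2
    set Q := ∫ x, ‖(v t - U) x‖ ^ 4
    have h2 : |inner ℝ (v t - U) (dv t)| ≤
        (‖R‖ * ‖v t - U‖ + |b| * h ^ 2 * (3 * (K₀ / h) * A + Q)) / h := by
      rw [le_div_iff₀ h0]
      linarith
    have e1 : (‖R‖ * ‖v t - U‖ + |b| * h ^ 2 * (3 * (K₀ / h) * A + Q)) / h =
        ‖R‖ * ‖v t - U‖ / h + |b| * (3 * K₀ * A + h * Q) := by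
      field_simp
    have e2 : |b| * (3 * K₀ * A + h * Q) ≤ c₀ * (3 * K₀ * A + h * Q) := by
      gcongr
    have hra : 0 ≤ ‖R‖ * ‖v t - U‖ / h := by positivity
    have hhQ : 0 ≤ h * Q := by positivity
    have m1 : (2 + K₀ + 2 * c₀ + C) * A ≥ 0 := by positivity
    have m2 : (K₀ + 6 * (c₀ * K₀) + 2 * c₀ + C) * (‖R‖ * ‖v t - U‖ / h) ≥ 0 := by positivity
    have m3 : (2 + K₀ + 6 * (c₀ * K₀) + C) * (h * Q) ≥ 0 := by positivity
    rw [e1] at h2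
    rw [hKdef]
    linarith

/-! ### Passage to the rotating frame -/

/-- The factor that turns solutions into orbits of the rotating frame. -/
def rotationFactor (κ ν t : ℝ) : ℂ := ((κ⁻¹ : ℝ) : ℂ) * Complex.exp (Complex.I * (ν * t : ℝ))

theorem norm_rotationFactor {κ : ℝ} (hκ : 0 < κ) (ν t : ℝ) : ‖rotationFactor κ ν t‖ = κ⁻¹ := by
  rw [rotationFactor, norm_mul, mul_comm Complex.I, Complex.norm_exp_ofReal_mul_I, mul_one,
    Complex.norm_real, Real.norm_of_nonneg (by positivity)]

theorem hasDerivAt_rotationFactor (κ ν t : ℝ) :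
    HasDerivAt (rotationFactor κ ν) (Complex.I * ν * rotationFactor κ ν t) t := by
  have h1 : HasDerivAt (fun t : ℝ => Complex.I * (ν * t : ℝ)) (Complex.I * ν) t := by
    have := ((hasDerivAt_id t).const_mul ν).ofReal_comp.const_mul Complex.I
    simpa using this
  have h2 := h1.cexp.const_mul (((κ⁻¹ : ℝ) : ℂ))
  refine h2.congr_deriv ?_
  rw [rotationFactor]
  ring

/-- Rotation at rate `ν` adds `-νh` to the Hamiltonian, and division by `κ` replaces the coupling
`a` by `aκ²`; the amplitude is thereby normalized to one. -/
theorem IsStrongSolution.exists_orbit {h a T κ : ℝ} {u : ℝ → CL} (hu : IsStrongSolution h a T u)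
    (hκ : 0 < κ) (ν : ℝ) : ∃ l p c dv : ℝ → CL,
      IsOrbit h (ν * h) (a * κ ^ 2 * h ^ 2) T (fun t => rotationFactor κ ν t • u t) l p c dv := by
  obtain ⟨l, p, du, hu, hl, hp, H⟩ := hu
  obtain ⟨C, hC, hsup⟩ := CLap.exists_sup
  have hlap : ∀ t ∈ Set.Icc 0 T, IsState (u t) (l t) (p t) := fun t ht =>
    ⟨CLap.of_distribution (H t ht).1, (H t ht).2.1⟩
  have hz : ContinuousOn (rotationFactor κ ν) (Set.Icc 0 T) := fun t _ =>
    (hasDerivAt_rotationFactor κ ν t).continuousAt.continuousWithinAt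
  have hex : ∀ t, ∃ c : CL, t ∈ Set.Icc 0 T → ∀ᵐ x, c x =
      ((‖(rotationFactor κ ν t • u t) x‖ ^ 2 : ℝ) : ℂ) * (rotationFactor κ ν t • u t) x := fun t => by
    by_cases ht : t ∈ Set.Icc 0 T
    · obtain ⟨c, hc⟩ := exists_cubic (hsup _ _ ((hlap t ht).smul (rotationFactor κ ν t)).lap)
      exact ⟨c, fun _ => hc⟩
    · exact ⟨0, fun h => absurd h ht⟩
  choose c hc using hex
  refine ⟨fun t => rotationFactor κ ν t • l t, fun t => rotationFactor κ ν t • p t, c,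
    fun t => rotationFactor κ ν t • du t + (Complex.I * ν * rotationFactor κ ν t) • u t, hz.smul hu,
    hz.smul hl, hz.smul hp, fun t ht => (hlap t ht).smul _, hc, fun t ht =>
      (hasDerivAt_rotationFactor κ ν t).hasDerivWithinAt.smul (H t ht).2.2.1, fun t ht => ?_⟩
  set z := rotationFactor κ ν t with hzdef
  -- The phase has modulus one, so the factor `κ²` in the coupling exactly compensates the amplitude
  -- in the cubic term.
  have hzn : κ ^ 2 * ‖z‖ ^ 2 = 1 := by
    rw [norm_rotationFactor hκ]
    field_simp
  refine Lp.ext ?_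
  filter_upwards [(H t ht).2.2.2, hc t ht, Lp.coeFn_smul h (Complex.I •
      (z • du t + (Complex.I * ν * z) • u t)), Lp.coeFn_smul Complex.I
      (z • du t + (Complex.I * ν * z) • u t), Lp.coeFn_add (z • du t) ((Complex.I * ν * z) • u t),
    Lp.coeFn_smul z (du t), Lp.coeFn_smul (Complex.I * ν * z) (u t),
    Lp.coeFn_add (ham h (ν * h) (z • u t) (z • l t) (z • p t)) ((a * κ ^ 2 * h ^ 2) • c t),
    Lp.coeFn_smul (a * κ ^ 2 * h ^ 2) (c t),
    Lp.coeFn_sub (z • p t - h ^ 2 • z • l t) ((ν * h) • z • u t),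
    Lp.coeFn_sub (z • p t) (h ^ 2 • z • l t), Lp.coeFn_smul (h ^ 2) (z • l t),
    Lp.coeFn_smul (ν * h) (z • u t), Lp.coeFn_smul z (u t), Lp.coeFn_smul z (l t),
    Lp.coeFn_smul z (p t)] with x e0 e1 e2 e3 e4 e5 e6 e7 e8 e9 e10 e11 e12 e13 e14 e15
  rw [e2, Pi.smul_apply, e3, Pi.smul_apply, e4, Pi.add_apply, e5, e6, Pi.smul_apply, Pi.smul_apply,
    e7, Pi.add_apply, ham, e9, Pi.sub_apply, e10, Pi.sub_apply, e11, e12, e8, Pi.smul_apply,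
    Pi.smul_apply, Pi.smul_apply, e1, e13, e14, e15]
  simp only [Pi.smul_apply, Complex.real_smul, smul_eq_mul, norm_mul, mul_pow]
  have hzc : ((κ : ℂ) ^ 2) * ((‖z‖ : ℂ) ^ 2) = 1 := by exact_mod_cast hzn
  push_cast at e0 ⊢
  have e0' : Complex.I * h * du t x = (a : ℂ) * (h : ℂ) ^ 2 * ((‖u t x‖ : ℂ) ^ 2) * u t x +
      p t x - (h : ℂ) ^ 2 * l t x := by linear_combination e0
  linear_combination z * e0' + h * ν * z * u t x * Complex.I_sq -
    (a : ℂ) * h ^ 2 * (‖u t x‖ : ℂ) ^ 2 * z * u t x * hzc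

theorem uApp_eq_rotation {k : ℕ} {b κ : ℝ} (hκ : 0 < κ) (χ : ℝ → ℝ) (p : Profile k b) (h t : ℝ)
    (x : Space) : uApp 1 χ p h 0 x = rotationFactor κ (frequency p h) t * uApp κ χ p h t x := by
  have e1 : Complex.exp (Complex.I * (frequency p h * t : ℝ)) *
      Complex.exp (-Complex.I * (frequency p h * t : ℝ)) = 1 := by
    rw [← Complex.exp_add]
    simp
  have e2 : ((1 / √h : ℝ) : ℂ) = ((κ⁻¹ : ℝ) : ℂ) * ((κ / √h : ℝ) : ℂ) := by
    rw [← Complex.ofReal_mul]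
    congr 1
    field_simp
  rw [uApp, uApp, rotationFactor, e2, mul_zero, Complex.ofReal_zero, mul_zero, Complex.exp_zero, mul_one]
  linear_combination -((κ⁻¹ : ℝ) : ℂ) * ((κ / √h : ℝ) : ℂ) *
    Complex.exp (Complex.I * ((k : ℝ) ^ 2 / h * angle x : ℝ)) *
    ((truncatedProfile χ p h !₂[(radius x - k) / √h, x 2 / √h] : ℝ) : ℂ) * e1

/-! ### Constants uniform over all admissible profiles -/

theorem integral_sq_le_of_eLpNorm_le {f : Plane → ℝ} {M : ℝ} (hf : MemLp f 2 volume)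
    (hM : eLpNorm f 2 volume ≤ ENNReal.ofReal M) : ∫ ξ, f ξ ^ 2 ≤ |M| ^ 2 := by
  rw [← norm_toLp_sq hf]
  refine pow_le_pow_left₀ (norm_nonneg _) ?_ 2
  rw [Lp.norm_toLp]
  exact ENNReal.toReal_le_of_le_ofReal (abs_nonneg M)
    (hM.trans (ENNReal.ofReal_le_ofReal (le_abs_self M)))

/-- The family estimates are applied to the set of all admissible triples of coupling, profile and
`n` at once, so that the constant, and later `δ`, is chosen before any of them. -/
theorem exists_uniform_residual : ∃ c₀ : ℝ, 0 < c₀ ∧ ∀ (k : ℕ), 1 ≤ k → ∀ χ : ℝ → ℝ, IsCutoff χ →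
    ∀ M : ℝ, ∃ K : ℝ, 0 ≤ K ∧ ∀ (b : ℝ) (p : Profile k b) (n : ℕ), |b| ≤ c₀ →
      eLpNorm (p.v 1) 2 volume ≤ ENNReal.ofReal M → eLpNorm (p.v 2) 2 volume ≤ ENNReal.ofReal M →
      1 ≤ n → ∀ h : ℝ, h = (n : ℝ)⁻¹ → |frequency p h * h| ≤ K ∧ ∃ U W R : CL,
        (∀ᵐ x, U x = uApp 1 χ p h 0 x) ∧ CLap U W ∧ (∀ᵐ x, ‖U x‖ ^ 2 ≤ K / h) ∧
        ‖R‖ ^ 2 ≤ K * h ^ 5 ∧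
        ∀ᵐ x, R x = (h ^ 2 : ℝ) * W x - (‖x‖ ^ 2 : ℝ) * U x + ((frequency p h * h : ℝ) : ℂ) * U x -
          (b * h ^ 2 * ‖U x‖ ^ 2 : ℝ) * U x := by
  obtain ⟨c₀, hc₀, B, hB⟩ := exists_formEnergy_le
  refine ⟨c₀, hc₀, fun k hk χ hχ M => ?_⟩
  let ι := {q : (Σ b : ℝ, Profile k b) × ℕ // |q.1.1| ≤ c₀ ∧
    eLpNorm (q.1.2.v 1) 2 volume ≤ ENNReal.ofReal M ∧
    eLpNorm (q.1.2.v 2) 2 volume ≤ ENNReal.ofReal M ∧ 1 ≤ q.2}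
  let b : ι → ℝ := fun i => i.1.1.1
  let p : ∀ i : ι, Profile k (b i) := fun i => i.1.1.2
  let ε : ι → ℝ := fun i => √((i.1.2 : ℝ)⁻¹)
  have hn : ∀ i : ι, (1 : ℝ) ≤ i.1.2 := fun i => by exact_mod_cast i.2.2.2.2
  have hε2 : ∀ i : ι, ε i ^ 2 = (i.1.2 : ℝ)⁻¹ := fun i => Real.sq_sqrt (by positivity)
  have hε0 : ∀ i : ι, 0 < ε i := fun i => Real.sqrt_pos.2 (inv_pos.2 (by linarith [hn i]))
  have hb : UR b := ⟨c₀, fun i => i.2.1⟩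
  have hE : UR fun i => formEnergy ((p i).v 0) ((p i).dv 0) := by
    refine ⟨B, fun i => ?_⟩
    rw [abs_of_nonneg]
    · exact hB k (b i) (p i) i.2.1
    · exact integral_nonneg fun ξ => by
        simp only [potential, Pi.zero_apply]
        positivity
  have hv1 : UW 0 fun i => (p i).v 1 := UW.of_zero (fun i => ((p i).mem 1).memLp) fun i =>
    integral_sq_le_of_eLpNorm_le ((p i).mem 1).memLp i.2.2.1
  have hv2 : UW 0 fun i => (p i).v 2 := UW.of_zero (fun i => ((p i).mem 2).memLp) fun i =>
    integral_sq_le_of_eLpNorm_le ((p i).mem 2).memLp i.2.2.2.1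
  obtain ⟨bE, bS, bW⟩ := Profile.bounds p hb hE hv1 hv2
  have hBP : BoundedProfiles p ε := ⟨hb, ⟨1, fun i => by
    rw [abs_of_pos (hε0 i)]
    exact Real.sqrt_le_one.2 (inv_le_one_of_one_le₀ (hn i))⟩, bE, bS, fun j N => (bW j N).1,
    fun j N => (bW j N).2⟩
  -- The angular momentum is `k² / h = k² n`, an integer because `h = 1 / n`.
  obtain ⟨K, hK, hres⟩ := hBP.exists_residual hk hχ hε0 (m := fun i => k ^ 2 * i.1.2) fun i => by
    have := hn i
    rw [hε2]
    push_cast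
    field_simp
  refine ⟨K, hK, fun b' p' n hb' h1 h2 hn1 h hh => ?_⟩
  have := hres ⟨(⟨b', p'⟩, n), hb', h1, h2, hn1⟩
  have e := hε2 ⟨(⟨b', p'⟩, n), hb', h1, h2, hn1⟩
  rw [← hh] at e
  rw [show ε ⟨(⟨b', p'⟩, n), hb', h1, h2, hn1⟩ ^ 4 = (ε ⟨(⟨b', p'⟩, n), hb', h1, h2, hn1⟩ ^ 2) ^ 2
    by ring, show ε ⟨(⟨b', p'⟩, n), hb', h1, h2, hn1⟩ ^ 10 =
    (ε ⟨(⟨b', p'⟩, n), hb', h1, h2, hn1⟩ ^ 2) ^ 5 by ring, e] at this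
  exact this

end GrossPitaevskii

end

/-! ### Conclusion -/

open GrossPitaevskii

theorem mainTheorem3 :
    ∃ c₀ : ℝ, 0 < c₀ ∧
      ∀ (k : ℕ), 1 ≤ k →
      ∀ (χ : ℝ → ℝ), GrossPitaevskii.IsCutoff χ →
      ∀ (M : ℝ), ∃ δ : ℝ, 0 < δ ∧
        -- throughout, `h = 1 / n`, so that `log (1 / h) = log n`
        ∀ (κ : ℝ), 0 < κ →
        ∀ (a : ℕ → ℝ), (∀ n, |a n| * κ ^ 2 ≤ c₀) →
        ∀ (p : ∀ n, GrossPitaevskii.Profile k (a n * κ ^ 2)),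
          (∀ n, eLpNorm ((p n).v 1) 2 volume ≤ ENNReal.ofReal M ∧
            eLpNorm ((p n).v 2) 2 volume ≤ ENNReal.ofReal M) →
        ∀ (t : ℕ → ℝ), (∀ᶠ n : ℕ in atTop, 0 ≤ t n ∧ t n ≤ δ * Real.log n) →
        ∀ (u : ℕ → ℝ → Lp ℂ 2 (volume : Measure GrossPitaevskii.Space)),
          (∀ᶠ n : ℕ in atTop,
            GrossPitaevskii.IsStrongSolution (n : ℝ)⁻¹ (a n) (t n) (u n) ∧
            ∀ᵐ x, u n 0 x = GrossPitaevskii.uApp κ χ (p n) (n : ℝ)⁻¹ 0 x) →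
        Tendsto
          (fun n : ℕ => eLpNorm
            (fun x => u n (t n) x - GrossPitaevskii.uApp κ χ (p n) (n : ℝ)⁻¹ (t n) x) 2 volume)
          atTop (𝓝 0) := by
  obtain ⟨c₀, hc₀, hres⟩ := exists_uniform_residual
  refine ⟨c₀, hc₀, fun k hk χ hχ M => ?_⟩
  obtain ⟨K₀, hK₀, hres⟩ := hres k hk χ hχ M
  obtain ⟨K, hK, hstab⟩ := IsOrbit.exists_stability hK₀ hc₀.le
  -- The constant `δ` comes from the stability constant alone and is independent of `κ`, which has
  -- been scaled out.
  refine ⟨1 / (10 * K ^ 4), by positivity, fun κ hκ a ha p hp t ht u hu => ?_⟩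
  have hinv : Tendsto (fun n : ℕ => (n : ℝ)⁻¹) atTop (𝓝 0) := tendsto_inv_atTop_nhds_zero_nat
  have hsmall : ∀ᶠ n : ℕ in atTop, 7 * K ^ 3 * √((n : ℝ)⁻¹) < 1 := by
    have h1 : Tendsto (fun n : ℕ => 7 * K ^ 3 * √((n : ℝ)⁻¹)) atTop (𝓝 0) := by
      have := ((Real.continuous_sqrt.tendsto 0).comp hinv).const_mul (7 * K ^ 3)
      simpa using this
    exact h1.eventually_lt_const one_pos
  -- Stability gives distance at most `h` in the rotating frame; undoing the normalization
  -- multiplies it by `κ`.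
  have hlim : Tendsto (fun n : ℕ => ENNReal.ofReal (κ * (n : ℝ)⁻¹)) atTop (𝓝 0) := by
    have := ENNReal.tendsto_ofReal (hinv.const_mul κ)
    simpa using this
  refine tendsto_of_tendsto_of_tendsto_of_le_of_le' tendsto_const_nhds hlim
    (Eventually.of_forall fun _ => zero_le) ?_
  filter_upwards [ht, hu, hsmall, eventually_ge_atTop 1] with n htn hun hsn hn
  have hn0 : (0 : ℝ) < n := by exact_mod_cast hn
  obtain ⟨hsol, hinit⟩ := hun
  have hb : |a n * κ ^ 2| ≤ c₀ := by
    rw [abs_mul, abs_of_nonneg (sq_nonneg κ)]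
    exact ha n
  obtain ⟨hΛ, U, W, R, hU, hW, hB, hRn, hR⟩ :=
    hres _ (p n) n hb (hp n).1 (hp n).2 hn _ rfl
  set h := (n : ℝ)⁻¹ with hh
  set ν := frequency (p n) h with hν
  obtain ⟨l, q, c, dv, H⟩ := hsol.exists_orbit hκ ν
  have hv0 : rotationFactor κ ν 0 • u n 0 = U := by
    refine Lp.ext ?_
    filter_upwards [hU, hinit, Lp.coeFn_smul (rotationFactor κ ν 0) (u n 0)] with x h1 h2 h3
    rw [h3, Pi.smul_apply, h2, h1, uApp_eq_rotation hκ χ (p n) h 0, smul_eq_mul]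
  have key := hstab h (t n) (ν * h) (a n * κ ^ 2) _ l q c dv U W R (inv_pos.2 hn0) hsn
    (by rw [hh, one_div (n : ℝ)⁻¹, inv_inv]; exact htn.2) hb hΛ H hv0 hW hB hRn hR (t n)
    ⟨htn.1, le_rfl⟩
  have key' : ‖rotationFactor κ ν (t n) • u n (t n) - U‖ ≤ h :=
    le_of_sq_le_sq key (inv_pos.2 hn0).le
  have hrot : rotationFactor κ ν (t n) ≠ 0 := by
    rw [← norm_pos_iff, norm_rotationFactor hκ]
    positivity
  have hfun : (fun x => u n (t n) x - uApp κ χ (p n) h (t n) x) =ᵐ[volume]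
      ((rotationFactor κ ν (t n))⁻¹ • (rotationFactor κ ν (t n) • u n (t n) - U) : CL) := by
    filter_upwards [hU, Lp.coeFn_smul (rotationFactor κ ν (t n)) (u n (t n)),
      Lp.coeFn_sub (rotationFactor κ ν (t n) • u n (t n)) U, Lp.coeFn_smul (rotationFactor κ ν (t n))⁻¹
        (rotationFactor κ ν (t n) • u n (t n) - U)] with x h1 h2 h3 h4
    rw [h4, Pi.smul_apply, h3, Pi.sub_apply, h2, Pi.smul_apply, h1,
      uApp_eq_rotation hκ χ (p n) h (t n), smul_eq_mul, smul_eq_mul, ← mul_sub,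
      inv_mul_cancel_left₀ hrot]
  rw [eLpNorm_congr_ae hfun, ← Lp.enorm_def, ← ofReal_norm]
  refine ENNReal.ofReal_le_ofReal ?_
  rw [norm_smul, norm_inv, norm_rotationFactor hκ, inv_inv]
  gcongr
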